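/- Let $d\in\{2,3\}$, let $\Omega\subset\mathbb R^d$ be open and bounded, $\alpha\in(0,1)$, $\nu>0$, $\gamma\ge 0$, $T>0$, $f\in L^2(0,T;L^2(\Omega)^d)$, and $C_{d,\alpha}=\alpha 2^{2\alpha}\,\Gamma(\frac{d+2}{2})/(\Gamma(\frac12)\Gamma(1-\alpha))$. For $\lambda>0$ put $\Omega_\lambda=\{y\in\mathbb R^d\setminus\Omega:\ |x-y|\le\lambda\text{ for some }x\in\Omega\}$ and $B_\lambda(x)=\{y:|x-y|\le\lambda\}$. For $R=\mathbb R^d$ (full problem) or $R=\Omega\cup\Omega_\lambda$ (truncated problem) let $X=\{v\in H^\alpha(R)^d\cap H^1(R)^d:\ v=0\text{ in }\mathbb R^d\setminus\Omega\}$, $Q=\{q\in L^2(\Omega):\int_\Omega q=0\}$, $V=\{v\in X:\int_\Omega(\nabla\cdot v)q=0\ \forall q\in Q\}$. Let $$a(u,v)=\int_{\mathbb R^d}\int_{\mathbb R^d}\frac{(u(x)-u(y))\cdot(v(x)-v(y))}{|x-y|^{d+2\alpha}}\,dy\,dx,$$ $$a_\lambda(u,v)=\int_{\Omega\cup\Omega_\lambda}\int_{(\Omega\cup\Omega_\lambda)\cap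 B_\lambda(x)}\frac{(u(x)-u(y))\cdot(v(x)-v(y))}{|x-y|^{d+2\alpha}}\,dy\,dx,\qquad |||v|||_{\alpha,\Omega\cup\Omega_\lambda}^2=a_\lambda(v,v).$$ A solution $(u,p)$ of the full model $u_t+(u\cdot\nabla)u-\nu\Delta u+\gamma(-\Delta)^\alpha u+\nabla p=f$, $\nabla\cdot u=0$ in $\Omega$, $u=0$ in $\mathbb R^d\setminus\Omega$, $u(0)=u_0$, is understood in the weak sense: $u\in L^2(0,T;X)\cap C([0,T];L^2(\Omega)^d)$ with $u(0)=u_0$, with weak time derivative $u_t\in L^2(0,T;V')$ ($V$ normed by $\|\nabla v\|_{L^2(\Omega)}$; the pairing of $u_t$ with each $v\in X$ is integrable in time), $p(t)\in Q$, and for a.e. $t\in(0,T)$ $$\langle u_t,v\rangle+\int_\Omega(u\cdot\nabla)u\cdot v+\nu\int_\Omega\nabla u:\nabla v-\int_\Omega p\,\nabla\cdot v+\gamma\tfrac{C_{d,\alpha}}2a(u,v)=\int_\Omega f\cdot v\quad\forall v\in X,\qquad \int_\Omega(\nabla\cdot u)q=0\quad\forall q\in Q.$$ A solution $(u_\lambda,p_\lambda)$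 of the truncated problem is defined in the same way, with the same $f$ and $u_0$, with $a_\lambda$ in place of $a$ and $R=\Omega\cup\Omega_\lambda$. Let $(u,p)$ be a solution of the full model with $u\in L^\infty(0,T;H^1(\Omega)^d)$, and let $I=\min\{\rho:\ \Omega\subset B_\rho(x)\ \forall x\in\Omega\}$. Then there is a constant $C>0$, independent of $\lambda$, $(u_\lambda,p_\lambda)$ and $t$, such that for every $\lambda>0$, every solution $(u_\lambda,p_\lambda)$ of the truncated problem and every $t\in[0,T]$, the error $e_\lambda=u-u_\lambda$ satisfies $$\|e_\lambda(t)\|_{L^2(\Omega)}^2+\int_0^t\frac{\nu}{16}\|\nabla e_\lambda(s)\|_{L^2(\Omega)}^2ds+\int_0^t\gamma\frac{C_{d,\alpha}}2|||e_\lambda(s)|||^2_{\alpha,\Omega\cup\Omega_\lambda}ds\le C\left[\Big(\frac1{\lambda^{2\alpha}}\Big)^2+\Big(\frac{(\lambda+I)^d}{\lambda^{d+2\alpha}}\Big)^2+\Big(\frac1{\lambda^{d+2\alpha}}\Big)^2\right],$$ where the integrands on the left are integrable on $(0,T)$. In particular, if $\lambda\ge1$, the left-hand side is at most $C(1/\lambda^{2\alpha})^2=C\lambda^{-4\alpha}$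 for every $t\in[0,T]$. -/

import Mathlib

open MeasureTheory Set Filter Topology
open scoped ContDiff

noncomputable section

namespace FracNS

/-- Physical space `ℝ^d` with the Euclidean norm. -/
abbrev Space (d : ℕ) : Type := EuclideanSpace ℝ (Fin d)

variable {d : ℕ}

/-! ### Function spaces -/

/-- `g` is the weak partial derivative `∂_j v` on the open set `R`. -/
def HasWeakPartial (R : Set (Space d)) (j : Fin d) (v g : Space d → Space d) : Prop :=
  ∀ φ : Space d → ℝ, ContDiff ℝ ∞ φ → HasCompactSupport φ → tsupport φ ⊆ R →
    ∫ x in R, (fderiv ℝ φ x (EuclideanSpace.single j 1)) • v x = - ∫ x in R, φ x • g x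

/-- `v ∈ H¹(R)`: `v` and its weak partial derivatives are in `L²(R)`. -/
def MemH1 (R : Set (Space d)) (v : Space d → Space d) : Prop :=
  MemLp v 2 (volume.restrict R) ∧
    ∀ j : Fin d, ∃ g : Space d → Space d,
      MemLp g 2 (volume.restrict R) ∧ HasWeakPartial R j v g

/-- `v ∈ H^α(R)` (Sobolev–Slobodeckij space). -/
def MemHFrac (R : Set (Space d)) (α : ℝ) (v : Space d → Space d) : Prop :=
  MemLp v 2 (volume.restrict R) ∧
    Integrable (fun z : Space d × Space d =>
        ‖v z.1 - v z.2‖ ^ 2 / ‖z.1 - z.2‖ ^ ((d : ℝ) + 2 * α))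
      ((volume.restrict R).prod (volume.restrict R))

/-- The velocity space `X = H^α_Ω(R) ∩ H¹_Ω(R)`: fields in `H^α(R)` and in `H¹(R)` that vanish
outside `Ω`. Here `R = ℝ^d` for the full problem and `R = Ω ∪ Ω_λ` for the truncated one. -/
def velocitySpace (Ω R : Set (Space d)) (α : ℝ) : Set (Space d → Space d) :=
  {v | MemHFrac R α v ∧ MemH1 R v ∧ ∀ᵐ x : Space d, x ∉ Ω → v x = 0}

/-- The pressure space `Q = L²₀(Ω)`. -/
def pressureSpace (Ω : Set (Space d)) : Set (Space d → ℝ) :=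
  {q | MemLp q 2 (volume.restrict Ω) ∧ ∫ x in Ω, q x = 0}

open Classical in
/-- The weak partial derivative `∂_j v` on `Ω` (a representative; unique a.e. on an open `Ω`). -/
def weakPartial (Ω : Set (Space d)) (j : Fin d) (v : Space d → Space d) : Space d → Space d :=
  if h : ∃ g : Space d → Space d, MemLp g 2 (volume.restrict Ω) ∧ HasWeakPartial Ω j v g
  then h.choose else 0

/-- The divergence `∇ · v` on `Ω`. -/
def divergence (Ω : Set (Space d)) (v : Space d → Space d) (x : Space d) : ℝ :=
  ∑ j : Fin d, (weakPartial Ω j v x) j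

/-- The solenoidal space `V = {v ∈ X : (∇ · v, q) = 0 for all q ∈ Q}`. -/
def solenoidalSpace (Ω R : Set (Space d)) (α : ℝ) : Set (Space d → Space d) :=
  {v | v ∈ velocitySpace Ω R α ∧
    ∀ q ∈ pressureSpace Ω, ∫ x in Ω, divergence Ω v x * q x = 0}

/-- `‖v‖²` in `L²(Ω)`. -/
def normSq (Ω : Set (Space d)) (v : Space d → Space d) : ℝ :=
  ∫ x in Ω, ‖v x‖ ^ 2

/-- `‖∇v‖²` in `L²(Ω)`. -/
def gradNormSq (Ω : Set (Space d)) (v : Space d → Space d) : ℝ :=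
  ∫ x in Ω, ∑ j : Fin d, ‖weakPartial Ω j v x‖ ^ 2

/-! ### Forms -/

/-- The trilinear form `b_Ω(u, v, w) = ∫_Ω (u · ∇) v · w`. -/
def convForm (Ω : Set (Space d)) (u v w : Space d → Space d) : ℝ :=
  ∫ x in Ω, ∑ j : Fin d, u x j * inner ℝ (weakPartial Ω j v x) (w x)

/-- `∫_Ω ∇u : ∇v`. -/
def gradForm (Ω : Set (Space d)) (u v : Space d → Space d) : ℝ :=
  ∫ x in Ω, ∑ j : Fin d, inner ℝ (weakPartial Ω j u x) (weakPartial Ω j v x)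

/-- The normalizing constant `C_{d,α}`. -/
def fracConst (d : ℕ) (α : ℝ) : ℝ :=
  α * (2 : ℝ) ^ (2 * α) * Real.Gamma (((d : ℝ) + 2) / 2)
    / (Real.Gamma (1 / 2) * Real.Gamma (1 - α))

/-- The integrand of the nonlocal forms. -/
def nonlocalDensity (α : ℝ) (u v : Space d → Space d) (x y : Space d) : ℝ :=
  inner ℝ (u x - u y) (v x - v y) / ‖x - y‖ ^ ((d : ℝ) + 2 * α)

/-- The nonlocal form over `ℝ^d × ℝ^d`. -/
def fullForm (α : ℝ) (u v : Space d → Space d) : ℝ :=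
  ∫ x, ∫ y, nonlocalDensity α u v x y

/-- The interaction domain `Ω_λ = {y ∈ ℝ^d ∖ Ω : |x - y| ≤ λ for some x ∈ Ω}`. -/
def interactionDomain (Ω : Set (Space d)) (lam : ℝ) : Set (Space d) :=
  {y | y ∉ Ω ∧ ∃ x ∈ Ω, ‖x - y‖ ≤ lam}

/-- The nonlocal form over `x ∈ Ω ∪ Ω_λ`, `y ∈ (Ω ∪ Ω_λ) ∩ B_λ(x)`. -/
def truncForm (Ω : Set (Space d)) (α lam : ℝ) (u v : Space d → Space d) : ℝ :=
  ∫ x in Ω ∪ interactionDomain Ω lam,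
    ∫ y in (Ω ∪ interactionDomain Ω lam) ∩ Metric.closedBall x lam, nonlocalDensity α u v x y

/-- The square of the norm `|||v|||_{α, Ω ∪ Ω_λ}`. -/
def truncGagliardoSq (Ω : Set (Space d)) (α lam : ℝ) (v : Space d → Space d) : ℝ :=
  ∫ y in Ω ∪ interactionDomain Ω lam,
    ∫ x in (Ω ∪ interactionDomain Ω lam) ∩ Metric.closedBall y lam,
      ‖v x - v y‖ ^ 2 / ‖x - y‖ ^ ((d : ℝ) + 2 * α)

/-- `I = min {R : Ω ⊆ B_R(x) for all x ∈ Ω}`. -/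
def domainRadius (Ω : Set (Space d)) : ℝ :=
  sInf {R : ℝ | ∀ x ∈ Ω, Ω ⊆ Metric.closedBall x R}

/-! ### Evolution problems

A time-dependent field on `[0, T]` is a function `ℝ → Space d → Space d`. -/

/-- The time measure on `(0, T)`. -/
def timeMeasure (T : ℝ) : Measure ℝ := volume.restrict (Ioo 0 T)

/-- `u ∈ L²(0, T; X)`. -/
structure MemL2X (Ω R : Set (Space d)) (α T : ℝ) (u : ℝ → Space d → Space d) : Prop where
  memLp : MemLp (fun z : ℝ × Space d => u z.1 z.2) 2 ((timeMeasure T).prod (volume.restrict R))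
  grad : ∀ j : Fin d, ∃ g : ℝ → Space d → Space d,
    MemLp (fun z : ℝ × Space d => g z.1 z.2) 2 ((timeMeasure T).prod (volume.restrict R)) ∧
      ∀ᵐ t ∂(timeMeasure T), HasWeakPartial R j (u t) (g t)
  mem : ∀ᵐ t ∂(timeMeasure T), u t ∈ velocitySpace Ω R α

/-- `u ∈ C([0, T]; L²(Ω))`. -/
def MemCL2 (Ω : Set (Space d)) (T : ℝ) (u : ℝ → Space d → Space d) : Prop :=
  (∀ t ∈ Icc 0 T, MemLp (u t) 2 (volume.restrict Ω)) ∧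
    ∀ t ∈ Icc 0 T, Tendsto (fun s => normSq Ω (fun x => u s x - u t x)) (𝓝[Icc 0 T] t) (𝓝 0)

/-- `u ∈ L^∞(0, T; H¹(Ω))` (the bound; measurability is part of `MemL2X`). -/
def EssBoundedH1 (Ω : Set (Space d)) (T : ℝ) (u : ℝ → Space d → Space d) : Prop :=
  ∃ M : ℝ, ∀ᵐ t ∂(timeMeasure T), normSq Ω (u t) + gradNormSq Ω (u t) ≤ M

/-- `D t v = ⟨∂_t u(t), v⟩` is the weak time derivative of `u`, tested with `v ∈ X`, and
`∂_t u ∈ L²(0, T; V')`, where `V` carries the norm `‖∇v‖`.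
If `∂_t u(t)` is a function, `D t v = ∫_Ω ∂_t u(t) · v`. -/
structure IsTimeDeriv (Ω R : Set (Space d)) (α T : ℝ) (u : ℝ → Space d → Space d)
    (D : ℝ → (Space d → Space d) → ℝ) : Prop where
  integrable : ∀ v ∈ velocitySpace Ω R α, Integrable (fun t => D t v) (timeMeasure T)
  eq_integral : ∀ v ∈ velocitySpace Ω R α, ∀ t ∈ Icc 0 T,
    (∫ x in Ω, inner ℝ (u t x) (v x)) - (∫ x in Ω, inner ℝ (u 0 x) (v x))
      = ∫ s in (0 : ℝ)..t, D s v
  dual_bound : ∃ κ : ℝ → ℝ, MemLp κ 2 (timeMeasure T) ∧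
    ∀ᵐ t ∂(timeMeasure T), ∀ v ∈ solenoidalSpace Ω R α,
      |D t v| ≤ κ t * Real.sqrt (gradNormSq Ω v)

/-- Velocity–pressure weak solutions on `[0, T]` of the incompressible flow problem with
nonlocal diffusion form `a`, viscosity `ν`, force `f` and initial velocity `u₀`. -/
structure IsWeakSolution (Ω R : Set (Space d)) (α ν T : ℝ)
    (a : (Space d → Space d) → (Space d → Space d) → ℝ)
    (f : ℝ → Space d → Space d) (u₀ : Space d → Space d)
    (u : ℝ → Space d → Space d) (p : ℝ → Space d → ℝ) : Prop where
  memL2X : MemL2X Ω R α T u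
  memCL2 : MemCL2 Ω T u
  pressure : ∀ᵐ t ∂(timeMeasure T), p t ∈ pressureSpace Ω
  initial : ∀ᵐ x ∂(volume.restrict Ω), u 0 x = u₀ x
  momentum : ∃ D : ℝ → (Space d → Space d) → ℝ, IsTimeDeriv Ω R α T u D ∧
    ∀ᵐ t ∂(timeMeasure T), ∀ v ∈ velocitySpace Ω R α,
      D t v + convForm Ω (u t) (u t) v + ν * gradForm Ω (u t) v
          - (∫ x in Ω, p t x * divergence Ω v x) + a (u t) v
        = ∫ x in Ω, inner ℝ (f t x) (v x)
  incompressible : ∀ᵐ t ∂(timeMeasure T), ∀ q ∈ pressureSpace Ω,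
    ∫ x in Ω, divergence Ω (u t) x * q x = 0

/-- Solutions `(u, p)` of the full model
`u_t + (u · ∇) u - ν Δu + γ (-Δ)^α u + ∇p = f`, `∇ · u = 0` in `Ω`, `u = 0` in `ℝ^d ∖ Ω`,
`u(0) = u₀`. -/
def IsModelSolution (Ω : Set (Space d)) (α ν γ T : ℝ)
    (f : ℝ → Space d → Space d) (u₀ : Space d → Space d)
    (u : ℝ → Space d → Space d) (p : ℝ → Space d → ℝ) : Prop :=
  IsWeakSolution Ω univ α ν T (fun v w => γ * (fracConst d α / 2) * fullForm α v w) f u₀ u p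

/-- Solutions `(u_λ, p_λ)` of the problem with interactions truncated at radius `λ`. -/
def IsTruncatedSolution (Ω : Set (Space d)) (α ν γ T lam : ℝ)
    (f : ℝ → Space d → Space d) (u₀ : Space d → Space d)
    (u : ℝ → Space d → Space d) (p : ℝ → Space d → ℝ) : Prop :=
  IsWeakSolution Ω (Ω ∪ interactionDomain Ω lam) α ν T
    (fun v w => γ * (fracConst d α / 2) * truncForm Ω α lam v w) f u₀ u p

/-- The error quantity
`‖e(t)‖² + ∫₀ᵗ (ν/16) ‖∇e‖² + ∫₀ᵗ γ (C_{d,α}/2) |||e|||²_{α, Ω ∪ Ω_λ}`. -/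
def errorEnergy (Ω : Set (Space d)) (α ν γ lam : ℝ) (e : ℝ → Space d → Space d) (t : ℝ) : ℝ :=
  normSq Ω (e t) + (∫ s in (0 : ℝ)..t, 1 / 16 * ν * gradNormSq Ω (e s))
    + ∫ s in (0 : ℝ)..t, γ * (fracConst d α / 2) * truncGagliardoSq Ω α lam (e s)

end FracNS

end

/-!
The error `e = u - u_λ` obeys an energy inequality, and Gronwall's inequality closes it. Testing
the difference of the two momentum equations with `e` formally gives

`½ d/dt ‖e‖² + ν ‖∇e‖² + c a_λ(e, e) = -b(e, u, e) - c (a - a_λ)(u, e)`, `c = γ C_{d,α} / 2`,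

because the pressures drop out for divergence-free `e` and `b(u_λ, e, e) = 0`
(`IsH10.convective_self_eq_zero`). Two estimates bound the right-hand side.

* In dimensions two and three, Ladyzhenskaya's inequality (`exists_ladyzhenskaya`) and the bound
  on `∇u` give `|b(e, u, e)| ≤ ½ ν ‖∇e‖² + K ‖e‖²` (`exists_convective_bound`).
* As `u` vanishes off `Ω`, the forms `a(u, ·)` and `a_λ(u, ·)` differ only through pairs of points
  at distance larger than `λ`. The kernel has mass of order `λ^(-2α)` there, so the difference is
  at most a multiple of `λ^(-4α) ‖u‖² + ‖e‖²` (`exists_truncation_bound`).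

The result is a bound by a multiple of `λ^(-4α)` for every `λ > 0`; the other two terms of the
estimate are nonnegative and are not needed.

Both velocity spaces are described by fields with a weak gradient on all of `ℝ^d` that vanish off
`Ω` (`IsH10`, `mem_velocitySpace_iff`): a cut-off extends the weak gradient across the boundary of
`Ω`, and `H¹(ℝ^d)` embeds into `H^α(ℝ^d)` (`exists_nonlocal_energy_le`). Hence each equation may
be tested with elements of either space. No regularity of `∂Ω` is used. In particular `∂Ω` may
have positive measure, and integrals over `Ω` and over `ℝ^d` agree because a weak gradient
vanishes almost everywhere on the zero set of its field (`IsH10.grad_eq_zero`).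

The energy identity is delicate because the time derivative is only known in its action on a fixed
test field, and its bound only in the dual of `V`. Instead of differentiating `‖e‖²`, the argument
uses the increments `‖e(r)‖² - ‖e(t)‖² = ∫_t^r ⟨∂_s e(s), e(r) + e(t)⟩ ds`, in which `e(r) + e(t)`
is a fixed field in `V`. Replacing it by `2 e(s)` costs the dual norm of `∂_s e(s)` times
`‖∇(e(r) + e(t) - 2 e(s))‖`. With `r = t + h`, averaged over `t`, this is `o(h)` by the continuity of
translations in `L²` of space-time (`energy_le_of_increments`).
-/

noncomputable section

namespace FracNS

variable {d : ℕ}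

open scoped ENNReal NNReal Convolution

/-! ### Weak partial derivatives -/

lemma integrable_smul_of_memLp {φ : Space d → ℝ} (hφ : Continuous φ) (hc : HasCompactSupport φ)
    {R : Set (Space d)} {g : Space d → Space d} (hg : MemLp g 2 (volume.restrict R)) :
    Integrable (fun x => φ x • g x) (volume.restrict R) := by
  have h1 : MemLp φ 2 (volume.restrict R) := hφ.memLp_of_hasCompactSupport hc
  exact memLp_one_iff_integrable.1 (hg.smul h1)

lemma continuous_fderiv_apply_const {φ : Space d → ℝ} (hφ : ContDiff ℝ ∞ φ) (e : Space d) :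
    Continuous (fun x => fderiv ℝ φ x e) :=
  (hφ.continuous_fderiv (by simp)).clm_apply continuous_const

lemma integrable_fderiv_smul_of_memLp {φ : Space d → ℝ} (hφ : ContDiff ℝ ∞ φ)
    (hc : HasCompactSupport φ) (e : Space d)
    {R : Set (Space d)} {g : Space d → Space d} (hg : MemLp g 2 (volume.restrict R)) :
    Integrable (fun x => fderiv ℝ φ x e • g x) (volume.restrict R) :=
  integrable_smul_of_memLp (continuous_fderiv_apply_const hφ e) (hc.fderiv_apply ℝ e) hg

lemma fderiv_apply_eq_zero_of_notMem_tsupport {φ : Space d → ℝ} {x : Space d}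
    (hx : x ∉ tsupport φ) (e : Space d) : fderiv ℝ φ x e = 0 := by
  have : fderiv ℝ φ x = 0 := by
    by_contra h
    exact hx (support_fderiv_subset ℝ h)
  simp [this]

lemma HasWeakPartial.add {R : Set (Space d)} {j : Fin d} {v w g k : Space d → Space d}
    (hv : MemLp v 2 (volume.restrict R)) (hw : MemLp w 2 (volume.restrict R))
    (hg : MemLp g 2 (volume.restrict R)) (hk : MemLp k 2 (volume.restrict R))
    (h : HasWeakPartial R j v g) (h' : HasWeakPartial R j w k) :
    HasWeakPartial R j (v + w) (g + k) := by
  intro φ hφ hc hs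
  simp only [Pi.add_apply, smul_add]
  rw [integral_add (integrable_fderiv_smul_of_memLp hφ hc _ hv)
    (integrable_fderiv_smul_of_memLp hφ hc _ hw),
    integral_add (integrable_smul_of_memLp hφ.continuous hc hg)
    (integrable_smul_of_memLp hφ.continuous hc hk), h φ hφ hc hs, h' φ hφ hc hs, neg_add]

lemma HasWeakPartial.const_smul {R : Set (Space d)} {j : Fin d} {v g : Space d → Space d}
    (c : ℝ) (h : HasWeakPartial R j v g) : HasWeakPartial R j (c • v) (c • g) := by
  intro φ hφ hc hs
  simp only [Pi.smul_apply, smul_comm _ c]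
  rw [integral_smul, integral_smul, h φ hφ hc hs, smul_neg]

lemma HasWeakPartial.mono {R R' : Set (Space d)} (hR : R ⊆ R') {j : Fin d}
    {v g : Space d → Space d} (h : HasWeakPartial R' j v g) : HasWeakPartial R j v g := by
  intro φ hφ hc hs
  have key : ∀ S : Set (Space d), tsupport φ ⊆ S →
      (∫ x in S, (fderiv ℝ φ x (EuclideanSpace.single j 1)) • v x
        = ∫ x, (fderiv ℝ φ x (EuclideanSpace.single j 1)) • v x) ∧
      (∫ x in S, φ x • g x = ∫ x, φ x • g x) := by
    intro S hS
    constructor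
    · refine setIntegral_eq_integral_of_forall_compl_eq_zero fun x hx => ?_
      rw [fderiv_apply_eq_zero_of_notMem_tsupport (fun h => hx (hS h)), zero_smul]
    · refine setIntegral_eq_integral_of_forall_compl_eq_zero fun x hx => ?_
      rw [image_eq_zero_of_notMem_tsupport (fun h => hx (hS h)), zero_smul]
  have := h φ hφ hc (hs.trans hR)
  rw [(key R' (hs.trans hR)).1, (key R' (hs.trans hR)).2] at this
  rw [(key R hs).1, (key R hs).2, this]

lemma HasWeakPartial.congr {R : Set (Space d)} {j : Fin d} {v w g k : Space d → Space d}
    (h : HasWeakPartial R j v g) (hv : v =ᵐ[volume.restrict R] w)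
    (hg : g =ᵐ[volume.restrict R] k) : HasWeakPartial R j w k := by
  intro φ hφ hc hs
  have e1 : (fun x => (fderiv ℝ φ x (EuclideanSpace.single j 1)) • v x)
      =ᵐ[volume.restrict R] fun x => (fderiv ℝ φ x (EuclideanSpace.single j 1)) • w x :=
    hv.mono fun x hx => by simp only [hx]
  have e2 : (fun x => φ x • g x) =ᵐ[volume.restrict R] fun x => φ x • k x :=
    hg.mono fun x hx => by simp only [hx]
  rw [← integral_congr_ae e1, h φ hφ hc hs, integral_congr_ae e2]

/-- Weak partial derivatives are unique almost everywhere. -/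
lemma HasWeakPartial.ae_unique {R : Set (Space d)} (hR : IsOpen R) {j : Fin d}
    {v g k : Space d → Space d} (hg : MemLp g 2 (volume.restrict R))
    (hk : MemLp k 2 (volume.restrict R)) (h : HasWeakPartial R j v g)
    (h' : HasWeakPartial R j v k) : g =ᵐ[volume.restrict R] k := by
  have hl : LocallyIntegrableOn (g - k) R volume :=
    locallyIntegrableOn_of_locallyIntegrable_restrict
      ((hg.sub hk).locallyIntegrable (by norm_num))
  have := hR.ae_eq_zero_of_integral_contDiff_smul_eq_zero hl (fun φ hφ hc hs => by
    have e1 : ∫ x, φ x • (g - k) x = ∫ x in R, φ x • (g - k) x := by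
      symm
      refine setIntegral_eq_integral_of_forall_compl_eq_zero fun x hx => ?_
      rw [image_eq_zero_of_notMem_tsupport (fun h => hx (hs h)), zero_smul]
    rw [e1]
    simp only [Pi.sub_apply, smul_sub]
    rw [integral_sub (integrable_smul_of_memLp hφ.continuous hc hg)
      (integrable_smul_of_memLp hφ.continuous hc hk), sub_eq_zero]
    have := (h φ hφ hc hs).symm.trans (h' φ hφ hc hs)
    exact neg_injective this)
  rw [EventuallyEq, ae_restrict_iff' hR.measurableSet]
  filter_upwards [this] with x hx hxR
  exact sub_eq_zero.1 (hx hxR)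

/-- `v ∈ H¹(ℝ^d)` with weak partial derivatives `g`, and `v` vanishes almost everywhere outside `s`.
The gradient is carried along as data, so that the estimates can refer to it without choosing a
representative. -/
structure IsH10 (s : Set (Space d)) (v : Space d → Space d)
    (g : Fin d → Space d → Space d) : Prop where
  memLp : MemLp v 2 volume
  grad_memLp : ∀ j, MemLp (g j) 2 volume
  weak : ∀ j, HasWeakPartial univ j v (g j)
  zero : ∀ᵐ x, x ∉ s → v x = 0

lemma IsH10.add {s : Set (Space d)} {v w : Space d → Space d} {g k : Fin d → Space d → Space d}
    (h : IsH10 s v g) (h' : IsH10 s w k) : IsH10 s (v + w) (g + k) where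
  memLp := h.memLp.add h'.memLp
  grad_memLp j := (h.grad_memLp j).add (h'.grad_memLp j)
  weak j := HasWeakPartial.add (by simpa using h.memLp) (by simpa using h'.memLp)
    (by simpa using h.grad_memLp j) (by simpa using h'.grad_memLp j) (h.weak j) (h'.weak j)
  zero := by
    filter_upwards [h.zero, h'.zero] with x h1 h2 hx
    simp [h1 hx, h2 hx]

lemma IsH10.const_smul {s : Set (Space d)} {v : Space d → Space d}
    {g : Fin d → Space d → Space d} (c : ℝ) (h : IsH10 s v g) : IsH10 s (c • v) (c • g) where
  memLp := h.memLp.const_smul c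
  grad_memLp j := (h.grad_memLp j).const_smul c
  weak j := (h.weak j).const_smul c
  zero := by
    filter_upwards [h.zero] with x h1 hx
    simp [h1 hx]

lemma IsH10.sub {s : Set (Space d)} {v w : Space d → Space d} {g k : Fin d → Space d → Space d}
    (h : IsH10 s v g) (h' : IsH10 s w k) : IsH10 s (v - w) (g - k) := by
  have := h.add (h'.const_smul (-1))
  simpa [sub_eq_add_neg] using this

lemma IsH10.mono {s s' : Set (Space d)} (hs : s ⊆ s') {v : Space d → Space d}
    {g : Fin d → Space d → Space d} (h : IsH10 s v g) : IsH10 s' v g :=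
  ⟨h.memLp, h.grad_memLp, h.weak, by
    filter_upwards [h.zero] with x hx hxs using hx fun h => hxs (hs h)⟩

/-- The zero extension of a field in `H¹` of a neighbourhood of `Ω` that vanishes off `Ω` is in
`H¹(ℝ^d)`; its weak derivatives are cut off by a function `χ` that equals one near `Ω`. -/
lemma HasWeakPartial.extend {Ω R : Set (Space d)} {j : Fin d} {v g : Space d → Space d}
    {χ : Space d → ℝ} (hχ : ContDiff ℝ ∞ χ) (hs : tsupport χ ⊆ R)
    (h1 : ∀ x ∈ Ω, χ =ᶠ[𝓝 x] 1) (hv : ∀ᵐ x, x ∉ Ω → v x = 0)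
    (h : HasWeakPartial R j v g) : HasWeakPartial univ j v (fun x => χ x • g x) := by
  intro φ hφ hcφ _
  have h2 := h (fun x => χ x * φ x) (hχ.mul hφ) (hcφ.mul_left)
    ((tsupport_mul_subset_left).trans hs)
  simp only [Measure.restrict_univ]
  have e1 : ∫ x, (fderiv ℝ φ x (EuclideanSpace.single j 1)) • v x
      = ∫ x in R, (fderiv ℝ (fun x => χ x * φ x) x (EuclideanSpace.single j 1)) • v x := by
    have hae : (fun x => (fderiv ℝ φ x (EuclideanSpace.single j 1)) • v x)
        =ᵐ[volume] fun x =>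
          (fderiv ℝ (fun x => χ x * φ x) x (EuclideanSpace.single j 1)) • v x := by
      filter_upwards [hv] with x hx
      by_cases hxΩ : x ∈ Ω
      · have : (fun x => χ x * φ x) =ᶠ[𝓝 x] φ := by
          filter_upwards [h1 x hxΩ] with y hy
          simp [hy]
        rw [this.fderiv_eq]
      · simp [hx hxΩ]
    rw [integral_congr_ae hae]
    symm
    refine setIntegral_eq_integral_of_forall_compl_eq_zero fun x hx => ?_
    rw [fderiv_apply_eq_zero_of_notMem_tsupport
      (fun h => hx (hs (tsupport_mul_subset_left h))), zero_smul]
  rw [e1, h2]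
  congr 1
  rw [setIntegral_eq_integral_of_forall_compl_eq_zero]
  · congr 1
    ext1 x
    rw [smul_smul, mul_comm]
  · intro x hx
    rw [image_eq_zero_of_notMem_tsupport (f := χ) (fun h => hx (hs h)), zero_mul, zero_smul]

/-- A smooth function between zero and one that equals one near `K` and is supported in `R`. -/
lemma exists_cutoff {K R : Set (Space d)} (hK : IsCompact K) (hR : IsOpen R) (hKR : K ⊆ R) :
    ∃ χ : Space d → ℝ, ContDiff ℝ ∞ χ ∧ HasCompactSupport χ ∧ tsupport χ ⊆ R ∧
      (∀ x ∈ K, χ =ᶠ[𝓝 x] 1) ∧ ∀ x, χ x ∈ Icc (0 : ℝ) 1 := by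
  obtain ⟨L, hL, hKL, hLR⟩ := exists_compact_between hK hR hKR
  obtain ⟨f, hf1, hf0, hf⟩ := exists_contMDiffMap_one_nhds_of_subset_interior
    (n := ⊤) (modelWithCornersSelf ℝ (Space d)) hK.isClosed hKL
  have hsub : tsupport f ⊆ L := by
    refine closure_minimal (fun x hx => ?_) hL.isClosed
    by_contra h
    exact hx (hf0 x h)
  refine ⟨f, f.contMDiff.contDiff, hL.of_isClosed_subset (isClosed_tsupport _) hsub,
    hsub.trans hLR, fun x hx => ?_, hf⟩
  have := (eventually_nhdsSet_iff_forall.1 hf1) x hx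
  exact this

lemma memLp_cutoff_smul {R : Set (Space d)} (hR : MeasurableSet R) {g : Space d → Space d}
    {χ : Space d → ℝ} (hχ : Continuous χ) (hs : tsupport χ ⊆ R) (h1 : ∀ x, χ x ∈ Icc (0 : ℝ) 1)
    (hg : MemLp g 2 (volume.restrict R)) : MemLp (fun x => χ x • g x) 2 volume := by
  have e : (fun x => χ x • g x) = fun x => χ x • R.indicator g x := by
    ext1 x
    by_cases hx : x ∈ R
    · rw [indicator_of_mem hx]
    · rw [image_eq_zero_of_notMem_tsupport (fun h => hx (hs h)), zero_smul, zero_smul]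
  rw [e]
  have hg' : MemLp (R.indicator g) 2 volume := (memLp_indicator_iff_restrict hR).2 hg
  refine hg'.mono (hχ.aestronglyMeasurable.smul hg'.1) (ae_of_all _ fun x => ?_)
  rw [norm_smul]
  exact mul_le_of_le_one_left (norm_nonneg _)
    (by rw [Real.norm_eq_abs, abs_le]; constructor <;> linarith [(h1 x).1, (h1 x).2])

/-- A field in `H¹(R)` that vanishes off `Ω` has a global weak gradient, provided that `R` is a
neighbourhood of the closure of the bounded set `Ω`. -/
lemma MemH1.exists_isH10 {Ω R : Set (Space d)} (hΩb : Bornology.IsBounded Ω) (hR : IsOpen R)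
    (hΩR : closure Ω ⊆ R) {v : Space d → Space d} (hv : MemH1 R v)
    (h0 : ∀ᵐ x, x ∉ Ω → v x = 0) : ∃ g, IsH10 Ω v g := by
  obtain ⟨χ, hχ, -, hs, h1, hχ1⟩ := exists_cutoff hΩb.isCompact_closure hR hΩR
  choose g hg hw using hv.2
  have hind : R.indicator v =ᵐ[volume] v := by
    filter_upwards [h0] with x hx
    by_cases hxR : x ∈ R
    · rw [indicator_of_mem hxR]
    · rw [indicator_of_notMem hxR, hx fun h => hxR (hΩR (subset_closure h))]
  refine ⟨fun j x => χ x • g j x, ?_, fun j => ?_, fun j => ?_, h0⟩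
  · exact ((memLp_indicator_iff_restrict hR.measurableSet).2 hv.1).ae_eq hind
  · exact memLp_cutoff_smul hR.measurableSet hχ.continuous hs hχ1 (hg j)
  · exact (hw j).extend hχ hs (fun x hx => h1 x (subset_closure hx)) h0

lemma weakPartial_spec {Ω : Set (Space d)} {j : Fin d} {v g : Space d → Space d}
    (hg : MemLp g 2 (volume.restrict Ω)) (h : HasWeakPartial Ω j v g) :
    MemLp (weakPartial Ω j v) 2 (volume.restrict Ω) ∧
      HasWeakPartial Ω j v (weakPartial Ω j v) := by
  have hex : ∃ g, MemLp g 2 (volume.restrict Ω) ∧ HasWeakPartial Ω j v g := ⟨g, hg, h⟩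
  rw [weakPartial, dif_pos hex]
  exact hex.choose_spec

lemma weakPartial_ae_eq {Ω : Set (Space d)} (hΩ : IsOpen Ω) {j : Fin d} {v g : Space d → Space d}
    (hg : MemLp g 2 (volume.restrict Ω)) (h : HasWeakPartial Ω j v g) :
    weakPartial Ω j v =ᵐ[volume.restrict Ω] g :=
  HasWeakPartial.ae_unique hΩ (weakPartial_spec hg h).1 hg (weakPartial_spec hg h).2 h

lemma IsH10.weakPartial_ae_eq {Ω s : Set (Space d)} (hΩ : IsOpen Ω) {v : Space d → Space d}
    {g : Fin d → Space d → Space d} (h : IsH10 s v g) (j : Fin d) :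
    weakPartial Ω j v =ᵐ[volume.restrict Ω] g j :=
  FracNS.weakPartial_ae_eq hΩ ((h.grad_memLp j).restrict _) ((h.weak j).mono (subset_univ _))

/-! ### Translations and mollification -/

/-- Translations act continuously on `L²`. -/
lemma tendsto_eLpNorm_translate_sub {G F : Type*} [NormedAddCommGroup G] [NormedSpace ℝ G]
    [FiniteDimensional ℝ G] [MeasurableSpace G] [BorelSpace G] [NormedAddCommGroup F]
    {μ : Measure G} [μ.IsAddHaarMeasure] {u : G → F} (hu : MemLp u 2 μ) :
    Tendsto (fun y => eLpNorm (fun x => u (x + y) - u x) 2 μ) (𝓝 0) (𝓝 0) := by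
  have : ProperSpace G := FiniteDimensional.proper ℝ G
  have : SecondCountableTopology G := inferInstance
  have : Fact ((1 : ℝ≥0∞) ≤ 2) := ⟨by norm_num⟩
  let τ : G → C(G, G) := fun y => ⟨fun x => x + y, by fun_prop⟩
  have hτ : Continuous τ := by
    refine ContinuousMap.continuous_of_continuous_uncurry _ ?_
    change Continuous fun p : G × G => p.2 + p.1
    fun_prop
  have hmp : ∀ y, MeasurePreserving (τ y) μ μ := fun y => measurePreserving_add_right μ y
  let U : Lp F 2 μ := hu.toLp u
  have h1 := Filter.Tendsto.compMeasurePreservingLp (α := G) (l := 𝓝 0)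
    (f := fun _ => U) (f₀ := U) (g := τ) (g₀ := τ 0) tendsto_const_nhds
    (hτ.tendsto 0) hmp (hmp 0) (by norm_num)
  have h0 : Lp.compMeasurePreserving (τ 0) (hmp 0) U = U := by
    refine Lp.ext ((Lp.coeFn_compMeasurePreserving _ _).trans ?_)
    refine ae_of_all _ fun x => ?_
    simp [τ]
  rw [h0] at h1
  have h2 := (Lp.tendsto_Lp_iff_tendsto_eLpNorm' _ _).1 h1
  refine h2.congr fun y => eLpNorm_congr_ae ?_
  have e1 : U =ᵐ[μ] u := hu.coeFn_toLp
  have e2 := (hmp y).quasiMeasurePreserving.ae_eq_comp e1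
  filter_upwards [Lp.coeFn_compMeasurePreserving U (hmp y), e1, e2] with x hx h1x h2x
  simp only [Pi.sub_apply]
  rw [hx, h2x, h1x]
  rfl

/-- The square of the mean of a field over a probability measure is at most the mean of the
square. -/
lemma enorm_integral_sq_le {X F : Type*} [MeasurableSpace X] [NormedAddCommGroup F]
    [NormedSpace ℝ F] {m : Measure X} [IsProbabilityMeasure m] {u : X → F}
    (hu : AEStronglyMeasurable u m) : ‖∫ y, u y ∂m‖ₑ ^ 2 ≤ ∫⁻ y, ‖u y‖ₑ ^ 2 ∂m := by
  have h1 : ‖∫ y, u y ∂m‖ₑ ≤ eLpNorm u 2 m := by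
    refine (enorm_integral_le_lintegral_enorm _).trans ?_
    rw [← eLpNorm_one_eq_lintegral_enorm]
    exact eLpNorm_le_eLpNorm_of_exponent_le (by norm_num) hu
  calc ‖∫ y, u y ∂m‖ₑ ^ 2 ≤ (eLpNorm u 2 m) ^ 2 := by gcongr
    _ = ∫⁻ y, ‖u y‖ₑ ^ 2 ∂m := by
      have := eLpNorm_nnreal_pow_eq_lintegral (f := u) (μ := m) (p := 2) (by norm_num)
      simpa using this

lemma eLpNorm_two_sq {X F : Type*} [MeasurableSpace X] [NormedAddCommGroup F] {m : Measure X}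
    (u : X → F) : (eLpNorm u 2 m) ^ 2 = ∫⁻ y, ‖u y‖ₑ ^ 2 ∂m := by
  have := eLpNorm_nnreal_pow_eq_lintegral (f := u) (μ := m) (p := 2) (by norm_num)
  simpa using this

/-- The probability measure with density a normalized bump function. -/
def bumpMeasure (φ : ContDiffBump (0 : Space d)) : Measure (Space d) :=
  volume.withDensity fun y => ENNReal.ofReal (φ.normed volume y)

instance (φ : ContDiffBump (0 : Space d)) : IsProbabilityMeasure (bumpMeasure φ) := by
  constructor
  rw [bumpMeasure, withDensity_apply _ MeasurableSet.univ, Measure.restrict_univ,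
    ← ofReal_integral_eq_lintegral_ofReal φ.integrable_normed (ae_of_all _ φ.nonneg_normed),
    φ.integral_normed, ENNReal.ofReal_one]

lemma integral_bumpMeasure {F : Type*} [NormedAddCommGroup F] [NormedSpace ℝ F]
    (φ : ContDiffBump (0 : Space d)) (u : Space d → F) :
    ∫ y, u y ∂(bumpMeasure φ) = ∫ y, φ.normed volume y • u y := by
  rw [bumpMeasure, integral_withDensity_eq_integral_toReal_smul
    (φ.continuous_normed.measurable.ennreal_ofReal) (ae_of_all _ fun _ => ENNReal.ofReal_lt_top)]
  simp_rw [ENNReal.toReal_ofReal (φ.nonneg_normed _)]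

lemma ae_bumpMeasure (φ : ContDiffBump (0 : Space d)) :
    ∀ᵐ y ∂(bumpMeasure φ), y ∈ Metric.ball (0 : Space d) φ.rOut := by
  rw [bumpMeasure, ae_withDensity_iff (φ.continuous_normed.measurable.ennreal_ofReal)]
  refine ae_of_all _ fun y hy => ?_
  rw [← φ.support_normed_eq (μ := volume)]
  intro h
  exact hy (by rw [h, ENNReal.ofReal_zero])

/-- The mollification of a field. -/
def mollify (φ : ContDiffBump (0 : Space d)) (u : Space d → Space d) : Space d → Space d :=
  (φ.normed volume) ⋆[ContinuousLinearMap.lsmul ℝ ℝ, volume] u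

lemma mollify_congr (φ : ContDiffBump (0 : Space d)) {u w : Space d → Space d}
    (h : u =ᵐ[volume] w) : mollify φ u = mollify φ w :=
  convolution_congr _ (ae_eq_refl _) h

lemma mollify_apply (φ : ContDiffBump (0 : Space d)) (u : Space d → Space d) (x : Space d) :
    mollify φ u x = ∫ y, φ.normed volume y • u (x - y) := rfl

lemma integrable_mollify (φ : ContDiffBump (0 : Space d)) {u : Space d → Space d}
    (hu : MemLp u 2 volume) (x : Space d) :
    Integrable (fun y => φ.normed volume y • u (x - y)) :=
  φ.hasCompactSupport_normed.convolutionExists_left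
    (ContinuousLinearMap.lsmul ℝ ℝ) φ.continuous_normed
    (hu.locallyIntegrable (by norm_num)) x

lemma mollify_sub (φ : ContDiffBump (0 : Space d)) {u : Space d → Space d}
    (hu : MemLp u 2 volume) (x : Space d) :
    mollify φ u x - u x = ∫ y, (u (x - y) - u x) ∂(bumpMeasure φ) := by
  rw [integral_bumpMeasure]
  simp only [smul_sub]
  rw [integral_sub (integrable_mollify φ hu x) (φ.integrable_normed.smul_const _),
    integral_smul_const, φ.integral_normed, one_smul, mollify_apply]

/-- The `L²` distance of a field to its mollification is controlled by its small translations. -/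
lemma eLpNorm_mollify_sub_le (φ : ContDiffBump (0 : Space d)) {u : Space d → Space d}
    (hu : MemLp u 2 volume) {ε : ℝ≥0∞}
    (hε : ∀ y ∈ Metric.ball (0 : Space d) φ.rOut,
      eLpNorm (fun x => u (x + -y) - u x) 2 volume ≤ ε) :
    eLpNorm (mollify φ u - u) 2 volume ≤ ε := by
  wlog hm : StronglyMeasurable u generalizing u
  · have e := hu.1.ae_eq_mk
    have hmk : MemLp (hu.1.mk u) 2 volume := hu.ae_eq e
    have := this hmk (fun y hy => by
      refine le_of_eq_of_le (eLpNorm_congr_ae ?_) (hε y hy)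
      have e2 := (measurePreserving_add_right volume (-y)).quasiMeasurePreserving.ae_eq_comp e
      filter_upwards [e, e2] with x h1 h2
      simp only [Function.comp] at h2
      rw [h1, h2]) hu.1.stronglyMeasurable_mk
    refine le_of_eq_of_le (eLpNorm_congr_ae ?_) this
    rw [mollify_congr φ e]
    filter_upwards [e] with x hx
    simp [hx]
  have hsq : (eLpNorm (mollify φ u - u) 2 volume) ^ 2 ≤ ε ^ 2 := by
    rw [eLpNorm_two_sq]
    have hm2 : StronglyMeasurable (fun z : Space d × Space d => u (z.1 - z.2) - u z.1) :=
      (hm.comp_measurable (measurable_fst.sub measurable_snd)).sub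
        (hm.comp_measurable measurable_fst)
    calc ∫⁻ x, ‖(mollify φ u - u) x‖ₑ ^ 2
        ≤ ∫⁻ x, ∫⁻ y, ‖u (x - y) - u x‖ₑ ^ 2 ∂(bumpMeasure φ) := by
          refine lintegral_mono fun x => ?_
          rw [Pi.sub_apply, mollify_sub φ hu x]
          exact enorm_integral_sq_le
            (hm2.comp_measurable (measurable_const.prodMk measurable_id)).aestronglyMeasurable
      _ = ∫⁻ y, ∫⁻ x, ‖u (x - y) - u x‖ₑ ^ 2 ∂volume ∂(bumpMeasure φ) :=
          lintegral_lintegral_swap (hm2.enorm.pow_const 2).aemeasurable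
      _ ≤ ∫⁻ y, ε ^ 2 ∂(bumpMeasure φ) := by
          refine lintegral_mono_ae ?_
          filter_upwards [ae_bumpMeasure φ] with y hy
          have := hε y hy
          simp only [← sub_eq_add_neg] at this
          rw [← eLpNorm_two_sq]
          gcongr
      _ = ε ^ 2 := by simp
  exact (ENNReal.pow_right_strictMono two_ne_zero).le_iff_le.1 hsq

lemma fderiv_convolution_apply {ρ : Space d → ℝ} (hρs : ContDiff ℝ ∞ ρ)
    (hρc : HasCompactSupport ρ) {v : Space d → Space d} (hl : LocallyIntegrable v volume)
    (x e : Space d) :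
    fderiv ℝ (ρ ⋆[ContinuousLinearMap.lsmul ℝ ℝ, volume] v) x e
      = ∫ t, (fderiv ℝ ρ t e) • v (x - t) := by
  let L : ℝ →L[ℝ] Space d →L[ℝ] Space d := ContinuousLinearMap.lsmul ℝ ℝ
  have h1 : HasFDerivAt (ρ ⋆[L, volume] v) ((fderiv ℝ ρ ⋆[L.precompL (Space d), volume] v) x) x :=
    hρc.hasFDerivAt_convolution_left L (hρs.of_le (by simp)) hl x
  have hi : Integrable (fun t => L.precompL (Space d) (fderiv ℝ ρ t) (v (x - t))) volume :=
    HasCompactSupport.convolutionExists_left (L.precompL (Space d)) (hρc.fderiv (𝕜 := ℝ))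
      (hρs.continuous_fderiv (by simp)) hl x
  have h2 : (∫ t, L.precompL (Space d) (fderiv ℝ ρ t) (v (x - t))) e
      = ∫ t, L.precompL (Space d) (fderiv ℝ ρ t) (v (x - t)) e :=
    ContinuousLinearMap.integral_apply hi e
  rw [h1.fderiv]
  exact h2

lemma fderiv_reflect {ρ : Space d → ℝ} (hρs : ContDiff ℝ ∞ ρ) (x s e : Space d) :
    fderiv ℝ (fun s => ρ (x - s)) s e = - fderiv ℝ ρ (x - s) e := by
  have hb : HasFDerivAt ρ (fderiv ℝ ρ (x - s)) (x - s) :=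
    (hρs.differentiable (by simp) _).hasFDerivAt
  have hi : HasFDerivAt (fun s : Space d => x - s) (-ContinuousLinearMap.id ℝ (Space d)) s :=
    (hasFDerivAt_id s).const_sub x
  have hd := hb.comp s hi
  have := hd.fderiv
  rw [show (fun s => ρ (x - s)) = ρ ∘ (fun s => x - s) from rfl, this]
  simp

/-- Mollification commutes with weak differentiation. -/
lemma fderiv_mollify (φ : ContDiffBump (0 : Space d)) {v g : Space d → Space d} {j : Fin d}
    (hv : MemLp v 2 volume) (h : HasWeakPartial univ j v g) (x : Space d) :
    fderiv ℝ (mollify φ v) x (EuclideanSpace.single j 1) = mollify φ g x := by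
  have hρs : ContDiff ℝ ∞ (φ.normed volume) := φ.contDiff_normed
  have hρc : HasCompactSupport (φ.normed volume) := φ.hasCompactSupport_normed
  have h1 := fderiv_convolution_apply hρs hρc (hv.locallyIntegrable (by norm_num)) x
    (EuclideanSpace.single j 1)
  rw [mollify, h1, mollify_apply]
  clear h1
  generalize φ.normed volume = ρ at *
  have hcs : HasCompactSupport fun s => ρ (x - s) :=
    hρc.comp_homeomorph (Homeomorph.subLeft x)
  have hsm : ContDiff ℝ ∞ fun s => ρ (x - s) := hρs.comp (contDiff_const.sub contDiff_id)
  have h2 := h (fun s => ρ (x - s)) hsm hcs (subset_univ _)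
  simp only [Measure.restrict_univ] at h2
  simp_rw [fderiv_reflect hρs, neg_smul] at h2
  rw [integral_neg, neg_inj] at h2
  have f1 := integral_sub_left_eq_self
    (fun t => (fderiv ℝ ρ t (EuclideanSpace.single j 1)) • v (x - t)) volume x
  have f2 := integral_sub_left_eq_self (fun t => ρ t • g (x - t)) volume x
  simp only [sub_sub_cancel] at f1 f2
  rw [← f1, h2, f2]

lemma contDiff_mollify (φ : ContDiffBump (0 : Space d)) {v : Space d → Space d}
    (hv : MemLp v 2 volume) : ContDiff ℝ ∞ (mollify φ v) :=
  φ.hasCompactSupport_normed.contDiff_convolution_left (ContinuousLinearMap.lsmul ℝ ℝ)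
    φ.contDiff_normed (hv.locallyIntegrable (by norm_num))

lemma support_mollify_subset (φ : ContDiffBump (0 : Space d)) (hφ : φ.rOut ≤ 1)
    {s : Set (Space d)} {v : Space d → Space d} (h0 : ∀ᵐ x, x ∉ s → v x = 0) :
    Function.support (mollify φ v) ⊆ Metric.cthickening 1 s := by
  have e : v =ᵐ[volume] s.indicator v := by
    filter_upwards [h0] with x hx
    by_cases h : x ∈ s
    · rw [indicator_of_mem h]
    · rw [indicator_of_notMem h, hx h]
  rw [mollify_congr φ e]
  intro x hx
  obtain ⟨a, ha, b, hb, rfl⟩ := support_convolution_subset (ContinuousLinearMap.lsmul ℝ ℝ) hx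
  rw [φ.support_normed_eq, mem_ball_zero_iff] at ha
  have hbs : b ∈ s := by
    by_contra h
    exact hb (indicator_of_notMem h v)
  refine Metric.mem_cthickening_of_dist_le (a + b) b 1 s hbs ?_
  simpa using (ha.trans_le hφ).le

/-- Fields in `H¹(ℝ^d)` that vanish off a set `s` are limits of smooth fields vanishing off a
neighbourhood of `s`. -/
lemma IsH10.exists_smooth_approx {s : Set (Space d)} {v : Space d → Space d}
    {g : Fin d → Space d → Space d} (h : IsH10 s v g) :
    ∃ V : ℕ → Space d → Space d, (∀ n, ContDiff ℝ ∞ (V n)) ∧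
      (∀ n, Function.support (V n) ⊆ Metric.cthickening 1 s) ∧
      Tendsto (fun n => eLpNorm (V n - v) 2 volume) atTop (𝓝 0) ∧
      ∀ j, Tendsto (fun n => eLpNorm
        ((fun x => fderiv ℝ (V n) x (EuclideanSpace.single j 1)) - g j) 2 volume)
          atTop (𝓝 0) := by
  let φ : ℕ → ContDiffBump (0 : Space d) := fun n =>
    ⟨1 / (2 * ((n : ℝ) + 1)), 1 / ((n : ℝ) + 1), by positivity, by
      rw [div_lt_div_iff_of_pos_left one_pos (by positivity) (by positivity)]
      linarith [(Nat.cast_nonneg n : (0 : ℝ) ≤ n)]⟩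
  have hφ1 : ∀ n, (φ n).rOut ≤ 1 := fun n => by
    change 1 / ((n : ℝ) + 1) ≤ 1
    rw [div_le_one (by positivity)]
    linarith [(Nat.cast_nonneg n : (0 : ℝ) ≤ n)]
  have hφ0 : Tendsto (fun n => (φ n).rOut) atTop (𝓝 0) := tendsto_one_div_add_atTop_nhds_zero_nat
  have key : ∀ u : Space d → Space d, MemLp u 2 volume →
      Tendsto (fun n => eLpNorm (mollify (φ n) u - u) 2 volume) atTop (𝓝 0) := by
    intro u hu
    rw [ENNReal.tendsto_nhds_zero]
    intro ε hε
    have h1 := (ENNReal.tendsto_nhds_zero.1 (tendsto_eLpNorm_translate_sub hu)) ε hε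
    obtain ⟨δ, hδ, hb⟩ := Metric.eventually_nhds_iff_ball.1 h1
    filter_upwards [hφ0.eventually (gt_mem_nhds hδ)] with n hn
    refine eLpNorm_mollify_sub_le (φ n) hu fun y hy => hb (-y) ?_
    rw [mem_ball_zero_iff, norm_neg]
    exact (mem_ball_zero_iff.1 hy).trans hn
  refine ⟨fun n => mollify (φ n) v, fun n => contDiff_mollify _ h.memLp,
    fun n => support_mollify_subset _ (hφ1 n) h.zero, key v h.memLp, fun j => ?_⟩
  have := key (g j) (h.grad_memLp j)
  refine this.congr fun n => ?_
  congr 1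
  ext1 x
  simp only [Pi.sub_apply]
  rw [fderiv_mollify _ h.memLp (h.weak j)]

/-! ### The weak gradient vanishes where the field does -/

lemma IsH10.exists_smooth_approx_ae {s : Set (Space d)} {v : Space d → Space d}
    {g : Fin d → Space d → Space d} (h : IsH10 s v g) :
    ∃ V : ℕ → Space d → Space d, (∀ n, ContDiff ℝ ∞ (V n)) ∧
      (∀ n, Function.support (V n) ⊆ Metric.cthickening 1 s) ∧
      Tendsto (fun n => eLpNorm (V n - v) 2 volume) atTop (𝓝 0) ∧
      (∀ j, Tendsto (fun n => eLpNorm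
        ((fun x => fderiv ℝ (V n) x (EuclideanSpace.single j 1)) - g j) 2 volume)
          atTop (𝓝 0)) ∧
      ∀ᵐ x, Tendsto (fun n => V n x) atTop (𝓝 (v x)) := by
  obtain ⟨V, h1, h2, h3, h4⟩ := h.exists_smooth_approx
  have hm := tendstoInMeasure_of_tendsto_eLpNorm (by norm_num)
    (fun n => (h1 n).continuous.aestronglyMeasurable) h.memLp.1 h3
  obtain ⟨ns, hns, hae⟩ := hm.exists_seq_tendsto_ae
  exact ⟨fun k => V (ns k), fun k => h1 _, fun k => h2 _, h3.comp hns.tendsto_atTop,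
    fun j => (h4 j).comp hns.tendsto_atTop, hae⟩

lemma norm_integral_mul_le_eLpNorm_two {X : Type*} [MeasurableSpace X] {m : Measure X}
    {f g : X → ℝ} (hf : MemLp f 2 m) (hg : MemLp g 2 m) :
    ‖∫ x, f x * g x ∂m‖ₑ ≤ eLpNorm f 2 m * eLpNorm g 2 m := by
  refine (enorm_integral_le_lintegral_enorm _).trans ?_
  rw [← eLpNorm_one_eq_lintegral_enorm]
  exact eLpNorm_smul_le_mul_eLpNorm (f := g) (φ := f) (p := 2) (q := 2) (r := 1) hg.1 hf.1

lemma tendsto_integral_mul_zero {X : Type*} [MeasurableSpace X] {m : Measure X}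
    {f g : ℕ → X → ℝ} (hf : ∀ n, MemLp (f n) 2 m) (hg : ∀ n, MemLp (g n) 2 m) {B : ℝ≥0∞}
    (hB : B ≠ ⊤) (hfB : ∀ n, eLpNorm (f n) 2 m ≤ B)
    (h0 : Tendsto (fun n => eLpNorm (g n) 2 m) atTop (𝓝 0)) :
    Tendsto (fun n => ∫ x, f n x * g n x ∂m) atTop (𝓝 0) := by
  rw [tendsto_iff_edist_tendsto_0]
  simp only [edist_zero_right]
  have hb : Tendsto (fun n => B * eLpNorm (g n) 2 m) atTop (𝓝 0) := by
    simpa using ENNReal.Tendsto.const_mul h0 (Or.inr hB)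
  refine tendsto_of_tendsto_of_tendsto_of_le_of_le tendsto_const_nhds hb
    (fun _ => zero_le) fun n => ?_
  exact (norm_integral_mul_le_eLpNorm_two (hf n) (hg n)).trans (by gcongr; exact hfB n)

lemma memLp_coord {m : Measure (Space d)} {p : ℝ≥0∞} {g : Space d → Space d} (hg : MemLp g p m)
    (i : Fin d) : MemLp (fun x => g x i) p m := by
  refine hg.mono ?_ (ae_of_all _ fun x => PiLp.norm_apply_le _ _)
  exact (EuclideanSpace.proj i : Space d →L[ℝ] ℝ).continuous.comp_aestronglyMeasurable hg.1

lemma hasCompactSupport_of_support_subset_cthickening {s : Set (Space d)}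
    (hs : Bornology.IsBounded s) {F : Type*} [Zero F] {V : Space d → F}
    (hV : Function.support V ⊆ Metric.cthickening 1 s) : HasCompactSupport V :=
  HasCompactSupport.of_support_subset_isCompact
    (Metric.isCompact_of_isClosed_isBounded Metric.isClosed_cthickening hs.cthickening) hV

/-- The chain rule for `arctan (k v i) / k`, in integrated form, by smooth approximation of `v`. -/
lemma IsH10.integral_arctan_mul_fderiv {s : Set (Space d)} (hs : Bornology.IsBounded s)
    {v : Space d → Space d} {g : Fin d → Space d → Space d} (h : IsH10 s v g) (i j : Fin d)
    {k : ℝ} (hk : 0 < k) {φ : Space d → ℝ} (hφ : ContDiff ℝ ∞ φ) (hc : HasCompactSupport φ) :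
    ∫ x, Real.arctan (k * v x i) / k * fderiv ℝ φ x (EuclideanSpace.single j 1)
      = - ∫ x, (φ x * (1 / (1 + (k * v x i) ^ 2))) * g j x i := by
  obtain ⟨V, hV, hVs, -, hVg, hVae⟩ := h.exists_smooth_approx_ae
  set e : Space d := EuclideanSpace.single j 1 with he
  have hVi : ∀ n, ContDiff ℝ ∞ (fun x => V n x i) := fun n =>
    (EuclideanSpace.proj i : Space d →L[ℝ] ℝ).contDiff.comp (hV n)
  have hVd : ∀ n x, fderiv ℝ (fun x => V n x i) x e = (fderiv ℝ (V n) x e) i := fun n x => by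
    have := ((EuclideanSpace.proj i : Space d →L[ℝ] ℝ).hasFDerivAt.comp x
      ((hV n).differentiable (by simp) x).hasFDerivAt).fderiv
    change fderiv ℝ ((EuclideanSpace.proj i : Space d →L[ℝ] ℝ) ∘ V n) x e = _
    rw [this]; rfl
  have hFd : ∀ n x, fderiv ℝ (fun x => Real.arctan (k * V n x i) / k) x e
      = 1 / (1 + (k * V n x i) ^ 2) * (fderiv ℝ (V n) x e) i := fun n x => by
    have h1 : HasFDerivAt (fun x => V n x i) (fderiv ℝ (fun x => V n x i) x) x :=
      ((hVi n).differentiable (by simp) x).hasFDerivAt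
    have h2 := ((h1.const_mul k).arctan).mul_const (k⁻¹)
    have h3 : (fun x => Real.arctan (k * V n x i) / k)
        = fun x => Real.arctan (k * V n x i) * k⁻¹ := by ext1 x; rw [div_eq_mul_inv]
    rw [h3, h2.fderiv, ← hVd]
    simp only [smul_smul, _root_.smul_apply, smul_eq_mul]
    field_simp
  have hφ0 : MemLp φ 2 volume := hφ.continuous.memLp_of_hasCompactSupport hc
  have hdc : Continuous (fun x => fderiv ℝ φ x e) := continuous_fderiv_apply_const hφ e
  have hdcs : HasCompactSupport (fun x => fderiv ℝ φ x e) := hc.fderiv_apply ℝ e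
  have hFs : ∀ n, ContDiff ℝ ∞ (fun x => Real.arctan (k * V n x i) / k) := fun n =>
    ((contDiff_const.mul (hVi n)).arctan).div_const k
  have hFb : ∀ y : ℝ, |Real.arctan (k * y) / k| ≤ Real.pi / 2 / k := fun y => by
    rw [abs_div, abs_of_pos hk]
    gcongr
    exact abs_le.2 ⟨by linarith [Real.neg_pi_div_two_lt_arctan (k * y)],
      (Real.arctan_lt_pi_div_two _).le⟩
  have hqb : ∀ y : ℝ, |1 / (1 + (k * y) ^ 2)| ≤ 1 := fun y => by
    rw [abs_of_nonneg (by positivity), div_le_one (by positivity)]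
    nlinarith [sq_nonneg (k * y)]
  -- integration by parts for the smooth approximations
  have hibp : ∀ n, ∫ x, Real.arctan (k * V n x i) / k * fderiv ℝ φ x e
      = - ∫ x, (φ x * (1 / (1 + (k * V n x i) ^ 2))) * (fderiv ℝ (V n) x e) i := fun n => by
    have c1 : Continuous (fun x => fderiv ℝ (fun x => Real.arctan (k * V n x i) / k) x e) :=
      ((hFs n).continuous_fderiv (by simp)).clm_apply continuous_const
    rw [integral_mul_fderiv_eq_neg_fderiv_mul_of_integrable]
    · congr 1
      refine integral_congr_ae (ae_of_all _ fun x => ?_)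
      simp only [hFd]
      ring
    · exact (c1.mul hφ.continuous).integrable_of_hasCompactSupport hc.mul_left
    · exact ((hFs n).continuous.mul hdc).integrable_of_hasCompactSupport hdcs.mul_left
    · exact ((hFs n).continuous.mul hφ.continuous).integrable_of_hasCompactSupport hc.mul_left
    · exact fun x _ => (hFs n).differentiable (by simp) x
    · exact fun x _ => hφ.differentiable (by simp) x
  have hlim1 : Tendsto (fun n => ∫ x, Real.arctan (k * V n x i) / k * fderiv ℝ φ x e) atTop
      (𝓝 (∫ x, Real.arctan (k * v x i) / k * fderiv ℝ φ x e)) := by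
    refine tendsto_integral_of_dominated_convergence
      (fun x => Real.pi / 2 / k * |fderiv ℝ φ x e|)
      (fun n => ((hFs n).continuous.mul hdc).aestronglyMeasurable)
      ((hdc.integrable_of_hasCompactSupport hdcs).abs.const_mul _)
      (fun n => ae_of_all _ fun x => ?_) ?_
    · rw [norm_mul, Real.norm_eq_abs, Real.norm_eq_abs]
      gcongr
      exact hFb _
    · filter_upwards [hVae] with x hx
      have h1 : Tendsto (fun n => V n x i) atTop (𝓝 (v x i)) :=
        ((EuclideanSpace.proj i : Space d →L[ℝ] ℝ).continuous.tendsto _).comp hx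
      exact (((Real.continuous_arctan.tendsto _).comp (h1.const_mul k)).div_const k).mul_const _
  have hgi : MemLp (fun x => g j x i) 2 volume := memLp_coord (h.grad_memLp j) i
  have hVm : ∀ n, MemLp (fun x => (fderiv ℝ (V n) x e) i) 2 volume := fun n => by
    have c : Continuous (fun x => fderiv ℝ (V n) x e) :=
      ((hV n).continuous_fderiv (by simp)).clm_apply continuous_const
    have := hasCompactSupport_of_support_subset_cthickening hs (hVs n)
    exact memLp_coord (c.memLp_of_hasCompactSupport (this.fderiv_apply ℝ e)) i
  have hψ : ∀ n, MemLp (fun x => φ x * (1 / (1 + (k * V n x i) ^ 2))) 2 volume := fun n => by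
    refine hφ0.mono (hφ0.1.mul ?_) (ae_of_all _ fun x => ?_)
    · have : Continuous fun x => 1 / (1 + (k * V n x i) ^ 2) :=
        continuous_const.div (by have := (hVi n).continuous; fun_prop) fun x => by positivity
      exact this.aestronglyMeasurable
    · rw [norm_mul]
      exact mul_le_of_le_one_right (norm_nonneg _) (hqb _)
  have hlimA : Tendsto (fun n => ∫ x, (φ x * (1 / (1 + (k * V n x i) ^ 2))) * g j x i) atTop
      (𝓝 (∫ x, (φ x * (1 / (1 + (k * v x i) ^ 2))) * g j x i)) := by
    refine tendsto_integral_of_dominated_convergence (fun x => |φ x * g j x i|)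
      (fun n => (hψ n).1.mul hgi.1) (hφ0.integrable_mul hgi).abs
      (fun n => ae_of_all _ fun x => ?_) ?_
    · rw [Real.norm_eq_abs, abs_mul, abs_mul, abs_mul]
      have := hqb (V n x i)
      calc |φ x| * |1 / (1 + (k * V n x i) ^ 2)| * |g j x i| ≤ |φ x| * 1 * |g j x i| := by gcongr
        _ = |φ x| * |g j x i| := by ring
    · filter_upwards [hVae] with x hx
      have h1 : Tendsto (fun n => V n x i) atTop (𝓝 (v x i)) :=
        ((EuclideanSpace.proj i : Space d →L[ℝ] ℝ).continuous.tendsto _).comp hx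
      have h2 : Tendsto (fun n => 1 / (1 + (k * V n x i) ^ 2)) atTop
          (𝓝 (1 / (1 + (k * v x i) ^ 2))) :=
        tendsto_const_nhds.div (((h1.const_mul k).pow 2).const_add 1) (by positivity)
      exact (h2.const_mul _).mul_const _
  have hlimB : Tendsto (fun n => ∫ x, (φ x * (1 / (1 + (k * V n x i) ^ 2)))
      * ((fderiv ℝ (V n) x e) i - g j x i)) atTop (𝓝 0) := by
    refine tendsto_integral_mul_zero hψ (fun n => (hVm n).sub hgi) hφ0.2.ne (fun n => ?_) ?_
    · refine eLpNorm_mono fun x => ?_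
      rw [norm_mul]
      exact mul_le_of_le_one_right (norm_nonneg _) (hqb _)
    · refine tendsto_of_tendsto_of_tendsto_of_le_of_le tendsto_const_nhds (hVg j)
        (fun _ => zero_le) fun n => eLpNorm_mono fun x => ?_
      exact PiLp.norm_apply_le (fderiv ℝ (V n) x e - g j x) i
  have hlim2 : Tendsto (fun n => ∫ x, (φ x * (1 / (1 + (k * V n x i) ^ 2)))
      * (fderiv ℝ (V n) x e) i) atTop
      (𝓝 (∫ x, (φ x * (1 / (1 + (k * v x i) ^ 2))) * g j x i)) := by
    have := hlimA.add hlimB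
    rw [add_zero] at this
    refine this.congr fun n => ?_
    have i1 : Integrable (fun x => (φ x * (1 / (1 + (k * V n x i) ^ 2))) * g j x i) volume :=
      (hψ n).integrable_mul hgi
    have i2 : Integrable (fun x => (φ x * (1 / (1 + (k * V n x i) ^ 2)))
        * ((fderiv ℝ (V n) x e) i - g j x i)) volume :=
      (hψ n).integrable_mul ((hVm n).sub hgi)
    rw [← integral_add i1 i2]
    refine integral_congr_ae (ae_of_all _ fun x => ?_)
    simp only
    ring
  exact tendsto_nhds_unique hlim1 (by simp_rw [hibp]; exact hlim2.neg)

/-- The weak gradient of a field vanishes almost everywhere on the zero set of the field: as `k →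
∞`, `arctan (k v) / k` tends to zero uniformly, while its gradient tends to `1_{v = 0} ∇v`. -/
lemma IsH10.grad_eq_zero {s : Set (Space d)} (hs : Bornology.IsBounded s)
    {v : Space d → Space d} {g : Fin d → Space d → Space d} (h : IsH10 s v g) (j : Fin d) :
    ∀ᵐ x, v x = 0 → g j x = 0 := by
  have key : ∀ i : Fin d, ∀ᵐ x, v x i = 0 → g j x i = 0 := by
    intro i
    have hgi : MemLp (fun x => g j x i) 2 volume := memLp_coord (h.grad_memLp j) i
    have hvi : MemLp (fun x => v x i) 2 volume := memLp_coord h.memLp i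
    let q : ℕ → Space d → ℝ := fun k x => 1 / (1 + (((k : ℝ) + 1) * v x i) ^ 2)
    have hqb : ∀ k x, |q k x| ≤ 1 := fun k x => by
      simp only [q]
      rw [abs_of_nonneg (by positivity), div_le_one (by positivity)]
      nlinarith [sq_nonneg (((k : ℝ) + 1) * v x i)]
    have hkt : Tendsto (fun k : ℕ => (k : ℝ) + 1) atTop atTop :=
      tendsto_atTop_add_const_right _ _ tendsto_natCast_atTop_atTop
    -- pointwise, `q k` tends to the indicator of the zero set
    have hq : ∀ x, Tendsto (fun k => q k x) atTop
        (𝓝 ({x | v x i = 0}.indicator (fun _ => (1 : ℝ)) x)) := by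
      intro x
      by_cases hx : v x i = 0
      · rw [indicator_of_mem (by exact hx)]
        simp [q, hx]
      · rw [indicator_of_notMem (by exact hx)]
        have h1 : Tendsto (fun k : ℕ => 1 + (((k : ℝ) + 1) * v x i) ^ 2) atTop atTop := by
          simp_rw [mul_pow]
          refine tendsto_atTop_add_const_left _ _ (Tendsto.atTop_mul_const (by positivity) ?_)
          exact (tendsto_pow_atTop two_ne_zero).comp hkt
        exact tendsto_const_nhds.div_atTop h1
    have hqm : ∀ k, AEStronglyMeasurable (q k) volume := fun k => by
      have : Continuous fun y : ℝ => 1 / (1 + (((k : ℝ) + 1) * y) ^ 2) :=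
        continuous_const.div (by fun_prop) fun x => by positivity
      exact this.comp_aestronglyMeasurable hvi.1
    have hqgm : ∀ k, AEStronglyMeasurable (fun x => q k x * g j x i) volume := fun k =>
      (hqm k).mul hgi.1
    have hlimm : AEStronglyMeasurable
        (fun x => {x | v x i = 0}.indicator (fun _ => (1 : ℝ)) x * g j x i) volume :=
      aestronglyMeasurable_of_tendsto_ae atTop hqgm
        (ae_of_all _ fun x => (hq x).mul_const _)
    have hloc : MemLp (fun x => {x | v x i = 0}.indicator (fun _ => (1 : ℝ)) x * g j x i) 2
        volume := by
      refine hgi.mono hlimm (ae_of_all _ fun x => ?_)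
      rw [norm_mul]
      refine mul_le_of_le_one_left (norm_nonneg _) ?_
      by_cases hx : v x i = 0 <;> simp [hx]
    have hz := ae_eq_zero_of_integral_contDiff_smul_eq_zero
      (hloc.locallyIntegrable (by norm_num)) (fun φ hφ hc => by
        have hφ0 : MemLp φ 2 volume := hφ.continuous.memLp_of_hasCompactSupport hc
        set e : Space d := EuclideanSpace.single j 1
        have hdi : Integrable (fun x => fderiv ℝ φ x e) volume :=
          (continuous_fderiv_apply_const hφ e).integrable_of_hasCompactSupport (hc.fderiv_apply ℝ e)
        have hc1 : Tendsto (fun k : ℕ => ∫ x, (φ x * q k x) * g j x i) atTop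
            (𝓝 (∫ x, φ x • ({x | v x i = 0}.indicator (fun _ => (1 : ℝ)) x * g j x i))) := by
          refine tendsto_integral_of_dominated_convergence (fun x => |φ x * g j x i|)
            (fun k => (hφ0.1.mul (hqm k)).mul hgi.1) (hφ0.integrable_mul hgi).abs
            (fun k => ae_of_all _ fun x => ?_) (ae_of_all _ fun x => ?_)
          · rw [Real.norm_eq_abs, abs_mul, abs_mul, abs_mul]
            have := hqb k x
            calc |φ x| * |q k x| * |g j x i| ≤ |φ x| * 1 * |g j x i| := by gcongr
              _ = |φ x| * |g j x i| := by ring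
          · simp only [smul_eq_mul, ← mul_assoc]
            exact ((hq x).const_mul _).mul_const _
        have hc2 : Tendsto (fun k : ℕ => ∫ x, (φ x * q k x) * g j x i) atTop (𝓝 0) := by
          have hb : Tendsto (fun k : ℕ => Real.pi / 2 / ((k : ℝ) + 1)
              * ∫ x, |fderiv ℝ φ x e|) atTop (𝓝 0) := by
            simpa using (tendsto_const_nhds.div_atTop hkt).mul_const _
          refine squeeze_zero_norm (fun k => ?_) hb
          have hk : (0 : ℝ) < (k : ℝ) + 1 := by positivity
          have := h.integral_arctan_mul_fderiv hs i j hk hφ hc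
          rw [← norm_neg, ← this, ← integral_const_mul]
          refine norm_integral_le_of_norm_le (hdi.abs.const_mul _) (ae_of_all _ fun x => ?_)
          rw [norm_mul, Real.norm_eq_abs, Real.norm_eq_abs, abs_div, abs_of_pos hk]
          gcongr
          exact abs_le.2 ⟨by linarith [Real.neg_pi_div_two_lt_arctan (((k : ℝ) + 1) * v x i)],
            (Real.arctan_lt_pi_div_two _).le⟩
        exact tendsto_nhds_unique hc1 hc2)
    filter_upwards [hz] with x hx hx0
    simpa [hx0] using hx
  filter_upwards [ae_all_iff.2 key] with x hx hx0
  ext i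
  simpa using hx i (by simp [hx0])

lemma IsH10.grad_zero {s : Set (Space d)} (hs : Bornology.IsBounded s)
    {v : Space d → Space d} {g : Fin d → Space d → Space d} (h : IsH10 s v g) (j : Fin d) :
    ∀ᵐ x, x ∉ s → g j x = 0 := by
  filter_upwards [h.zero, h.grad_eq_zero hs j] with x h1 h2 hx using h2 (h1 hx)

/-! ### Sobolev inequalities -/

lemma norm_fderiv_le_sum {V : Space d → Space d} (x : Space d) :
    ‖fderiv ℝ V x‖ ≤ ∑ j : Fin d, ‖fderiv ℝ V x (EuclideanSpace.single j 1)‖ := by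
  refine ContinuousLinearMap.opNorm_le_bound _ (by positivity) fun y => ?_
  have hy : y = ∑ j : Fin d, y j • (EuclideanSpace.single j 1 : Space d) := by
    have := (EuclideanSpace.basisFun (Fin d) ℝ).sum_repr y
    simpa using this.symm
  conv_lhs => rw [hy, map_sum]
  rw [Finset.sum_mul]
  refine norm_sum_le_of_le _ fun j _ => ?_
  rw [map_smul, norm_smul, mul_comm]
  gcongr
  exact PiLp.norm_apply_le y j

lemma eLpNorm_fderiv_le_sum {V : Space d → Space d} (hV : ContDiff ℝ ∞ V) :
    eLpNorm (fderiv ℝ V) 2 volume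
      ≤ ∑ j : Fin d, eLpNorm (fun x => fderiv ℝ V x (EuclideanSpace.single j 1)) 2 volume := by
  have h1 : eLpNorm (fderiv ℝ V) 2 volume ≤ eLpNorm (∑ j : Fin d,
      fun x => ‖fderiv ℝ V x (EuclideanSpace.single j 1)‖) 2 volume := by
    refine eLpNorm_mono fun x => ?_
    rw [Finset.sum_apply, Real.norm_of_nonneg (by positivity)]
    exact norm_fderiv_le_sum x
  refine h1.trans ((eLpNorm_sum_le (fun j _ => ?_) (by norm_num)).trans ?_)
  · exact (((hV.continuous_fderiv (by simp)).clm_apply continuous_const).norm).aestronglyMeasurable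
  · exact Finset.sum_le_sum fun j _ => (eLpNorm_norm _).le

/-- The Sobolev inequality `‖v‖_{L^q} ≤ C ‖∇v‖_{L²}`, `q ≤ 6`, for smooth fields supported in a
fixed bounded closed set, in dimensions two and three. -/
lemma exists_sobolev_smooth (hd : d = 2 ∨ d = 3) {K : Set (Space d)}
    (hK : Bornology.IsBounded K) (hKc : IsClosed K) {q : ℝ≥0} (hq : (6 : ℝ)⁻¹ ≤ (q : ℝ)⁻¹) :
    ∃ C : ℝ≥0, ∀ V : Space d → Space d, ContDiff ℝ ∞ V → Function.support V ⊆ K →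
      eLpNorm V q volume ≤ C * ∑ j : Fin d,
        eLpNorm (fun x => fderiv ℝ V x (EuclideanSpace.single j 1)) 2 volume := by
  obtain ⟨C, hC⟩ : ∃ C : ℝ≥0, ∀ V : Space d → Space d, ContDiff ℝ ∞ V → Function.support V ⊆ K →
      eLpNorm V q volume ≤ C * eLpNorm (fderiv ℝ V) 2 volume := by
    have hfr : Module.finrank ℝ (Space d) = d := by simp
    rcases hd with hd | hd
    · -- in dimension two, pass through the exponent `3 / 2` on the bounded set `K`
      have hKt : volume K ≠ ⊤ := hK.measure_lt_top.ne
      refine ⟨eLpNormLESNormFDerivOfLeConst (Space d) (volume : Measure (Space d)) K (3 / 2) q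
        * ((volume K) ^ ((1 : ℝ) / 6)).toNNReal, fun V hV hVK => ?_⟩
      have h1 := eLpNorm_le_eLpNorm_fderiv_of_le (volume : Measure (Space d))
        (hV.of_le (by simp)) hVK (p := 3 / 2) (q := q)
        (by rw [← NNReal.coe_le_coe]; norm_num) (by
          rw [hfr, hd, ← NNReal.coe_lt_coe]; norm_num) (le_trans (by rw [hfr, hd]; norm_num) hq) hK
      have hsupp : Function.support (fun x => ‖fderiv ℝ V x‖) ⊆ K := fun x hx =>
        closure_minimal hVK hKc (support_fderiv_subset ℝ
          (Function.mem_support.2 fun h0 => hx (by simp [h0])))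
      have h2 : eLpNorm (fderiv ℝ V) ((3 / 2 : ℝ≥0) : ℝ≥0∞) volume
          ≤ eLpNorm (fderiv ℝ V) 2 volume * (volume K) ^ ((1 : ℝ) / 6) := by
        rw [← eLpNorm_norm, ← eLpNorm_norm (p := 2),
          ← eLpNorm_restrict_eq_of_support_subset hsupp,
          ← eLpNorm_restrict_eq_of_support_subset (p := 2) hsupp]
        have := eLpNorm_le_eLpNorm_mul_rpow_measure_univ (μ := volume.restrict K)
          (p := ((3 / 2 : ℝ≥0) : ℝ≥0∞)) (q := 2) (f := fun x => ‖fderiv ℝ V x‖) (by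
            rw [show (2 : ℝ≥0∞) = ((2 : ℝ≥0) : ℝ≥0∞) by norm_num, ENNReal.coe_le_coe,
              ← NNReal.coe_le_coe]; norm_num)
            (hV.continuous_fderiv (by simp)).norm.aestronglyMeasurable
        refine this.trans (le_of_eq ?_)
        rw [Measure.restrict_apply_univ]
        norm_num
      rw [ENNReal.coe_mul, ENNReal.coe_toNNReal (by
        exact ENNReal.rpow_ne_top_of_nonneg (by norm_num) hKt), mul_assoc]
      refine h1.trans ?_
      gcongr
      rw [mul_comm]
      exact h2
    · refine ⟨eLpNormLESNormFDerivOfLeConst (Space d) (volume : Measure (Space d)) K 2 q,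
        fun V hV hVK => ?_⟩
      have h1 := eLpNorm_le_eLpNorm_fderiv_of_le (volume : Measure (Space d))
        (hV.of_le (by simp)) hVK (p := 2) (q := q)
        (by norm_num) (by rw [hfr, hd]; norm_num) (le_trans (by rw [hfr, hd]; norm_num) hq) hK
      simpa using h1
  refine ⟨C, fun V hV hVK => (hC V hV hVK).trans ?_⟩
  gcongr
  exact eLpNorm_fderiv_le_sum hV

/-- The Sobolev inequality for fields that vanish off a bounded set. -/
lemma exists_sobolev (hd : d = 2 ∨ d = 3) {s : Set (Space d)} (hs : Bornology.IsBounded s)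
    {q : ℝ≥0} (hq : (6 : ℝ)⁻¹ ≤ (q : ℝ)⁻¹) :
    ∃ C : ℝ≥0, ∀ (v : Space d → Space d) (g : Fin d → Space d → Space d), IsH10 s v g →
      eLpNorm v q volume ≤ C * ∑ j : Fin d, eLpNorm (g j) 2 volume := by
  obtain ⟨C, hC⟩ := exists_sobolev_smooth hd (K := Metric.cthickening 1 s)
    hs.cthickening Metric.isClosed_cthickening hq
  refine ⟨C, fun v g h => ?_⟩
  obtain ⟨V, hV, hVs, -, hVg, hVae⟩ := h.exists_smooth_approx_ae
  -- Fatou's lemma along an almost everywhere convergent smooth approximation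
  have h1 : eLpNorm v q volume ≤ liminf (fun n => eLpNorm (V n) q volume) atTop :=
    Lp.eLpNorm_lim_le_liminf_eLpNorm (fun n => (hV n).continuous.aestronglyMeasurable) v hVae
  have h2 : Tendsto (fun n => (C : ℝ≥0∞) * ∑ j : Fin d, (eLpNorm
        ((fun x => fderiv ℝ (V n) x (EuclideanSpace.single j 1)) - g j) 2 volume
          + eLpNorm (g j) 2 volume)) atTop (𝓝 (C * ∑ j : Fin d, (0 + eLpNorm (g j) 2 volume))) := by
    refine ENNReal.Tendsto.const_mul (tendsto_finsetSum _ fun j _ => (hVg j).add_const _)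
      (Or.inr ENNReal.coe_ne_top)
  simp only [zero_add] at h2
  refine h1.trans (le_of_le_of_eq (liminf_le_liminf (Eventually.of_forall fun n => ?_))
    h2.liminf_eq)
  refine (hC (V n) (hV n) (hVs n)).trans ?_
  gcongr with j _
  have : (fun x => fderiv ℝ (V n) x (EuclideanSpace.single j 1))
      = ((fun x => fderiv ℝ (V n) x (EuclideanSpace.single j 1)) - g j) + g j := by simp
  conv_lhs => rw [this]
  refine eLpNorm_add_le (AEStronglyMeasurable.sub ?_ (h.grad_memLp j).1) (h.grad_memLp j).1
    (by norm_num)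
  exact ((hV n).continuous_fderiv (by simp)).clm_apply continuous_const |>.aestronglyMeasurable

/-! ### The convective form -/

/-- Hölder's inequality for a function dominated by a product of two `L⁴` functions and an `L²`
function. -/
lemma integrable_and_enorm_integral_le_of_triple {X A B C : Type*} [MeasurableSpace X]
    [NormedAddCommGroup A] [NormedAddCommGroup B] [NormedAddCommGroup C] {m : Measure X}
    {F : X → ℝ} {a : X → A} {b : X → B} {c : X → C} (hF : AEStronglyMeasurable F m)
    (hle : ∀ x, ‖F x‖ ≤ ‖a x‖ * ‖b x‖ * ‖c x‖) (ha : MemLp a 4 m) (hb : MemLp b 4 m)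
    (hc : MemLp c 2 m) : Integrable F m ∧
      ‖∫ x, F x ∂m‖ₑ ≤ eLpNorm a 4 m * eLpNorm b 4 m * eLpNorm c 2 m := by
  have ht : ENNReal.HolderTriple 4 4 2 := ⟨by
    rw [show (4 : ℝ≥0∞) = 2 * 2 by norm_num,
      ENNReal.mul_inv (Or.inl two_ne_zero) (Or.inl ENNReal.ofNat_ne_top), ← mul_add,
      ENNReal.inv_two_add_inv_two, mul_one]⟩
  have hab : MemLp (fun x => ‖a x‖ * ‖b x‖) 2 m := MemLp.mul (r := 2) hb.norm ha.norm
  have habc : MemLp (fun x => ‖a x‖ * ‖b x‖ * ‖c x‖) 1 m := MemLp.mul (r := 1) hc.norm hab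
  have hle' : ∀ᵐ x ∂m, ‖F x‖ ≤ ‖‖a x‖ * ‖b x‖ * ‖c x‖‖ := ae_of_all _ fun x => by
    rw [Real.norm_of_nonneg (by positivity : 0 ≤ ‖a x‖ * ‖b x‖ * ‖c x‖)]
    exact hle x
  refine ⟨(memLp_one_iff_integrable.1 habc).mono hF hle', ?_⟩
  calc ‖∫ x, F x ∂m‖ₑ ≤ eLpNorm F 1 m := by
        rw [eLpNorm_one_eq_lintegral_enorm]
        exact enorm_integral_le_lintegral_enorm _
    _ ≤ eLpNorm (fun x => ‖a x‖ * ‖b x‖ * ‖c x‖) 1 m := eLpNorm_mono_ae hle'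
    _ ≤ eLpNorm (fun x => ‖a x‖ * ‖b x‖) 2 m * eLpNorm (fun x => ‖c x‖) 2 m :=
        eLpNorm_smul_le_mul_eLpNorm (f := fun x => ‖c x‖) (φ := fun x => ‖a x‖ * ‖b x‖)
          (p := 2) (q := 2) (r := 1) hc.norm.1 hab.1
    _ ≤ (eLpNorm (fun x => ‖a x‖) 4 m * eLpNorm (fun x => ‖b x‖) 4 m)
          * eLpNorm (fun x => ‖c x‖) 2 m := by
        gcongr
        exact eLpNorm_smul_le_mul_eLpNorm (f := fun x => ‖b x‖) (φ := fun x => ‖a x‖)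
          (p := 4) (q := 4) (r := 2) hb.norm.1 ha.norm.1
    _ = _ := by simp only [eLpNorm_norm]

lemma IsH10.memLp_four (hd : d = 2 ∨ d = 3) {s : Set (Space d)} (hs : Bornology.IsBounded s)
    {v : Space d → Space d} {g : Fin d → Space d → Space d} (h : IsH10 s v g) :
    MemLp v 4 volume := by
  obtain ⟨C, hC⟩ := exists_sobolev hd hs (q := 4) (by norm_num)
  refine ⟨h.memLp.1, (hC v g h).trans_lt ?_⟩
  exact ENNReal.mul_lt_top ENNReal.coe_lt_top
    (ENNReal.sum_lt_top.2 fun j _ => (h.grad_memLp j).2)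

lemma isH10_of_contDiff {K : Set (Space d)} (hK : Bornology.IsBounded K) (hKc : IsClosed K)
    {V : Space d → Space d} (hV : ContDiff ℝ ∞ V) (hVK : Function.support V ⊆ K) :
    IsH10 K V (fun j x => fderiv ℝ V x (EuclideanSpace.single j 1)) := by
  have hc : HasCompactSupport V := HasCompactSupport.of_support_subset_isCompact
    (Metric.isCompact_of_isClosed_isBounded hKc hK) hVK
  have hfd : ∀ j : Fin d, Continuous fun x => fderiv ℝ V x (EuclideanSpace.single j 1) :=
    fun j => (hV.continuous_fderiv (by simp)).clm_apply continuous_const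
  refine ⟨hV.continuous.memLp_of_hasCompactSupport hc,
    fun j => (hfd j).memLp_of_hasCompactSupport (hc.fderiv_apply ℝ _), fun j φ hφ hcφ _ => ?_,
    ae_of_all _ fun x hx => by_contra fun h => hx (hVK h)⟩
  simp only [Measure.restrict_univ]
  rw [integral_smul_fderiv_eq_neg_fderiv_smul_of_integrable, neg_neg]
  · exact ((continuous_fderiv_apply_const hφ _).smul hV.continuous).integrable_of_hasCompactSupport
      hc.smul_left
  · exact (hφ.continuous.smul (hfd j)).integrable_of_hasCompactSupport
      (hcφ.smul_right)
  · exact (hφ.continuous.smul hV.continuous).integrable_of_hasCompactSupport hc.smul_left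
  · exact fun x _ => hφ.differentiable (by simp) x
  · exact fun x _ => hV.differentiable (by simp) x

lemma HasWeakPartial.coord {v g : Space d → Space d} {j : Fin d} (hv : MemLp v 2 volume)
    (hg : MemLp g 2 volume) (h : HasWeakPartial univ j v g) {φ : Space d → ℝ}
    (hφ : ContDiff ℝ ∞ φ) (hc : HasCompactSupport φ) (i : Fin d) :
    ∫ x, fderiv ℝ φ x (EuclideanSpace.single j 1) * v x i = - ∫ x, φ x * g x i := by
  have h1 := h φ hφ hc (subset_univ _)
  simp only [Measure.restrict_univ] at h1
  have i1 := integrable_fderiv_smul_of_memLp (R := univ) hφ hc (EuclideanSpace.single j 1)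
    (by simpa using hv)
  have i2 := integrable_smul_of_memLp (R := univ) hφ.continuous hc (by simpa using hg)
  rw [Measure.restrict_univ] at i1 i2
  have e1 := (EuclideanSpace.proj i : Space d →L[ℝ] ℝ).integral_comp_comm i1
  have e2 := (EuclideanSpace.proj i : Space d →L[ℝ] ℝ).integral_comp_comm i2
  rw [h1, map_neg] at e1
  rw [← e2] at e1
  simpa using e1

/-- Integration by parts `∫ w_j ∂_j |e|² = -∫ ∂_j w_j |e|²`. -/
lemma IsH10.integral_mul_inner_grad (hd : d = 2 ∨ d = 3) {s : Set (Space d)}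
    (hs : Bornology.IsBounded s) {w e : Space d → Space d} {k g : Fin d → Space d → Space d}
    (hw : IsH10 s w k) (he : IsH10 s e g) (j : Fin d) :
    ∫ x, w x j * inner ℝ (g j x) (e x) = - (1 / 2) * ∫ x, k j x j * ‖e x‖ ^ 2 := by
  obtain ⟨V, hV, hVs, -, hVg⟩ := he.exists_smooth_approx
  set s' := Metric.cthickening 1 s with hs'
  have hsb : Bornology.IsBounded s' := hs.cthickening
  have hVH : ∀ n, IsH10 s' (V n) (fun j x => fderiv ℝ (V n) x (EuclideanSpace.single j 1)) :=
    fun n => isH10_of_contDiff hsb Metric.isClosed_cthickening (hV n) (hVs n)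
  have heH : IsH10 s' e g := he.mono (Metric.self_subset_cthickening s)
  obtain ⟨C, hC⟩ := exists_sobolev hd hsb (q := 4) (by norm_num)
  have hL4 : Tendsto (fun n => eLpNorm (V n - e) 4 volume) atTop (𝓝 0) := by
    have hb : Tendsto (fun n => (C : ℝ≥0∞) * ∑ j : Fin d, eLpNorm
        ((fun x => fderiv ℝ (V n) x (EuclideanSpace.single j 1)) - g j) 2 volume) atTop
        (𝓝 (C * ∑ j : Fin d, 0)) :=
      ENNReal.Tendsto.const_mul (tendsto_finsetSum _ fun j _ => hVg j)
        (Or.inr ENNReal.coe_ne_top)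
    simp only [Finset.sum_const_zero, mul_zero] at hb
    exact tendsto_of_tendsto_of_tendsto_of_le_of_le tendsto_const_nhds hb
      (fun _ => zero_le) fun n => hC _ _ ((hVH n).sub heH)
  have he4 := he.memLp_four hd hs
  have hw4 := hw.memLp_four hd hs
  have hV4 : ∀ n, MemLp (V n) 4 volume := fun n => (hVH n).memLp_four hd hsb
  set D : ℕ → Space d → Space d := fun n x => fderiv ℝ (V n) x (EuclideanSpace.single j 1) with hD
  have hD2 : ∀ n, MemLp (D n) 2 volume := fun n => (hVH n).grad_memLp j
  have hg2 := he.grad_memLp j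
  have hk2 := hw.grad_memLp j
  have hVb : ∃ B : ℝ≥0∞, B ≠ ⊤ ∧ ∀ᶠ n in atTop, eLpNorm (V n) 4 volume ≤ B := by
    refine ⟨1 + eLpNorm e 4 volume, by simp [he4.2.ne], ?_⟩
    filter_upwards [hL4.eventually (gt_mem_nhds one_pos)] with n hn
    have : V n = (V n - e) + e := by simp
    rw [this]
    exact (eLpNorm_add_le ((hV4 n).sub he4).1 he4.1 (by norm_num)).trans (by gcongr)
  obtain ⟨B, hB, hVB⟩ := hVb
  have hwj : AEStronglyMeasurable (fun x => w x j) volume := (memLp_coord hw.memLp j).1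
  have hkj : AEStronglyMeasurable (fun x => k j x j) volume := (memLp_coord hk2 j).1
  have hcoord : ∀ (z : Space d), |z j| ≤ ‖z‖ := fun z => PiLp.norm_apply_le z j
  -- the two sides are continuous along the approximation
  have key1 : ∀ (a b : Space d → Space d), MemLp a 4 volume → MemLp b 2 volume →
      Integrable (fun x => w x j * inner ℝ (b x) (a x)) volume ∧
      ‖∫ x, w x j * inner ℝ (b x) (a x)‖ₑ
        ≤ eLpNorm w 4 volume * eLpNorm a 4 volume * eLpNorm b 2 volume := fun a b ha hb =>
    integrable_and_enorm_integral_le_of_triple (hwj.mul (hb.1.inner ha.1)) (fun x => by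
      rw [norm_mul, Real.norm_eq_abs, mul_assoc]
      refine mul_le_mul (hcoord _) ((norm_inner_le_norm _ _).trans (mul_comm _ _).le)
        (norm_nonneg _) (norm_nonneg _)) hw4 ha hb
  have key2 : ∀ (a b : Space d → Space d), MemLp a 4 volume → MemLp b 4 volume →
      Integrable (fun x => k j x j * inner ℝ (a x) (b x)) volume ∧
      ‖∫ x, k j x j * inner ℝ (a x) (b x)‖ₑ
        ≤ eLpNorm a 4 volume * eLpNorm b 4 volume * eLpNorm (k j) 2 volume := fun a b ha hb =>
    integrable_and_enorm_integral_le_of_triple (hkj.mul (ha.1.inner hb.1)) (fun x => by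
      rw [norm_mul, Real.norm_eq_abs, mul_comm]
      refine mul_le_mul (norm_inner_le_norm _ _) (hcoord _) (abs_nonneg _) (by positivity))
      ha hb hk2
  have lim1 : Tendsto (fun n => ∫ x, w x j * inner ℝ (D n x) (V n x)) atTop
      (𝓝 (∫ x, w x j * inner ℝ (g j x) (e x))) := by
    rw [tendsto_iff_edist_tendsto_0]
    have hb : Tendsto (fun n => eLpNorm w 4 volume * B * eLpNorm (D n - g j) 2 volume
        + eLpNorm w 4 volume * eLpNorm (V n - e) 4 volume * eLpNorm (g j) 2 volume)
        atTop (𝓝 (eLpNorm w 4 volume * B * 0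
          + eLpNorm w 4 volume * 0 * eLpNorm (g j) 2 volume)) := by
      refine (ENNReal.Tendsto.const_mul (hVg j)
        (Or.inr (ENNReal.mul_ne_top hw4.2.ne hB))).add ?_
      exact ENNReal.Tendsto.mul_const (ENNReal.Tendsto.const_mul hL4 (Or.inr hw4.2.ne))
        (Or.inr hg2.2.ne)
    simp only [mul_zero, zero_mul, add_zero] at hb
    refine tendsto_of_tendsto_of_tendsto_of_le_of_le' tendsto_const_nhds hb
      (Eventually.of_forall fun _ => zero_le) ?_
    filter_upwards [hVB] with n hn
    rw [edist_eq_enorm_sub, ← integral_sub (key1 _ _ (hV4 n) (hD2 n)).1 (key1 _ _ he4 hg2).1]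
    have : ∀ x, w x j * inner ℝ (D n x) (V n x) - w x j * inner ℝ (g j x) (e x)
        = w x j * inner ℝ ((D n - g j) x) (V n x) + w x j * inner ℝ (g j x) ((V n - e) x) := by
      intro x
      simp only [Pi.sub_apply, inner_sub_left, inner_sub_right]
      ring
    simp_rw [this]
    rw [integral_add (key1 _ _ (hV4 n) ((hD2 n).sub hg2)).1
      (key1 _ _ ((hV4 n).sub he4) hg2).1]
    refine (enorm_add_le _ _).trans (add_le_add ?_ (key1 _ _ ((hV4 n).sub he4) hg2).2)
    refine (key1 _ _ (hV4 n) ((hD2 n).sub hg2)).2.trans ?_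
    gcongr
  have lim2 : Tendsto (fun n => ∫ x, k j x j * inner ℝ (V n x) (V n x)) atTop
      (𝓝 (∫ x, k j x j * inner ℝ (e x) (e x))) := by
    rw [tendsto_iff_edist_tendsto_0]
    have hb : Tendsto (fun n => eLpNorm (V n - e) 4 volume * B * eLpNorm (k j) 2 volume
        + eLpNorm e 4 volume * eLpNorm (V n - e) 4 volume * eLpNorm (k j) 2 volume)
        atTop (𝓝 (0 * B * eLpNorm (k j) 2 volume
          + eLpNorm e 4 volume * 0 * eLpNorm (k j) 2 volume)) := by
      refine Tendsto.add ?_ ?_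
      · exact ENNReal.Tendsto.mul_const (ENNReal.Tendsto.mul_const hL4 (Or.inr hB))
          (Or.inr hk2.2.ne)
      · exact ENNReal.Tendsto.mul_const (ENNReal.Tendsto.const_mul hL4 (Or.inr he4.2.ne))
          (Or.inr hk2.2.ne)
    simp only [mul_zero, zero_mul, add_zero] at hb
    refine tendsto_of_tendsto_of_tendsto_of_le_of_le' tendsto_const_nhds hb
      (Eventually.of_forall fun _ => zero_le) ?_
    filter_upwards [hVB] with n hn
    rw [edist_eq_enorm_sub, ← integral_sub (key2 _ _ (hV4 n) (hV4 n)).1 (key2 _ _ he4 he4).1]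
    have : ∀ x, k j x j * inner ℝ (V n x) (V n x) - k j x j * inner ℝ (e x) (e x)
        = k j x j * inner ℝ ((V n - e) x) (V n x) + k j x j * inner ℝ (e x) ((V n - e) x) := by
      intro x
      simp only [Pi.sub_apply, inner_sub_left, inner_sub_right]
      ring
    simp_rw [this]
    rw [integral_add (key2 _ _ ((hV4 n).sub he4) (hV4 n)).1
      (key2 _ _ he4 ((hV4 n).sub he4)).1]
    refine (enorm_add_le _ _).trans (add_le_add ?_ (key2 _ _ he4 ((hV4 n).sub he4)).2)
    refine (key2 _ _ ((hV4 n).sub he4) (hV4 n)).2.trans ?_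
    gcongr
  -- for smooth fields, test the weak derivative of `w` with `|V n|²`
  have hn : ∀ n, ∫ x, w x j * inner ℝ (D n x) (V n x)
      = - (1 / 2) * ∫ x, k j x j * inner ℝ (V n x) (V n x) := by
    intro n
    have hcV : HasCompactSupport (V n) := hasCompactSupport_of_support_subset_cthickening hs (hVs n)
    have hφ : ContDiff ℝ ∞ fun x => inner ℝ (V n x) (V n x) := (hV n).inner ℝ (hV n)
    have hcφ : HasCompactSupport fun x => inner ℝ (V n x) (V n x) :=
      hcV.mono fun x hx h0 => hx (by simp [h0])
    have hfd : ∀ x, fderiv ℝ (fun x => inner ℝ (V n x) (V n x)) x (EuclideanSpace.single j 1)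
        = 2 * inner ℝ (D n x) (V n x) := fun x => by
      have hdx := (hV n).differentiable (by simp) x
      rw [fderiv_inner_apply ℝ hdx hdx, real_inner_comm]
      simp only [hD]
      ring
    have := (hw.weak j).coord hw.memLp hk2 hφ hcφ j
    simp_rw [hfd] at this
    have e1 : ∫ x, 2 * inner ℝ (D n x) (V n x) * w x j
        = 2 * ∫ x, w x j * inner ℝ (D n x) (V n x) := by
      rw [← integral_const_mul]
      refine integral_congr_ae (ae_of_all _ fun x => ?_)
      simp only
      ring
    have e2 : ∫ x, inner ℝ (V n x) (V n x) * k j x j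
        = ∫ x, k j x j * inner ℝ (V n x) (V n x) := by
      simp_rw [mul_comm]
    rw [e1, e2] at this
    linarith
  have := tendsto_nhds_unique lim1 (by simp_rw [hn]; exact lim2.const_mul _)
  simpa only [real_inner_self_eq_norm_sq] using this

/-- The weak derivatives of a field vanishing off a bounded set have zero mean. -/
lemma IsH10.integral_grad_eq_zero {s : Set (Space d)} (hs : Bornology.IsBounded s)
    {w : Space d → Space d} {k : Fin d → Space d → Space d} (hw : IsH10 s w k) (i j : Fin d) :
    ∫ x, k j x i = 0 := by
  obtain ⟨χ, hχ, hc, -, h1, -⟩ := exists_cutoff hs.isCompact_closure isOpen_univ (subset_univ _)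
  have := (hw.weak j).coord hw.memLp (hw.grad_memLp j) hχ hc i
  have e1 : ∫ x, fderiv ℝ χ x (EuclideanSpace.single j 1) * w x i = 0 := by
    refine integral_eq_zero_of_ae ?_
    filter_upwards [hw.zero] with x hx
    by_cases hxs : x ∈ s
    · rw [(h1 x (subset_closure hxs)).fderiv_eq]
      simp
    · simp [hx hxs]
  have e2 : ∫ x, χ x * k j x i = ∫ x, k j x i := by
    refine integral_congr_ae ?_
    filter_upwards [hw.grad_zero hs j] with x hx
    by_cases hxs : x ∈ s
    · simp [(h1 x (subset_closure hxs)).eq_of_nhds]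
    · simp [hx hxs]
  rw [e1, e2] at this
  linarith

/-- The convective form `b(w, e, e)` vanishes for divergence-free `w`. -/
lemma IsH10.convective_self_eq_zero (hd : d = 2 ∨ d = 3) {Ω : Set (Space d)} (hΩ : IsOpen Ω)
    (hΩb : Bornology.IsBounded Ω) {w e : Space d → Space d} {k g : Fin d → Space d → Space d}
    (hw : IsH10 Ω w k) (he : IsH10 Ω e g)
    (hdiv : ∀ q ∈ pressureSpace Ω, ∫ x in Ω, divergence Ω w x * q x = 0) :
    ∫ x, ∑ j : Fin d, w x j * inner ℝ (g j x) (e x) = 0 := by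
  have he4 := he.memLp_four hd hΩb
  have hw4 := hw.memLp_four hd hΩb
  have hcoord : ∀ (z : Space d) (j : Fin d), |z j| ≤ ‖z‖ := fun z j => PiLp.norm_apply_le z j
  have hi1 : ∀ j : Fin d, Integrable (fun x => w x j * inner ℝ (g j x) (e x)) volume := fun j =>
    (integrable_and_enorm_integral_le_of_triple (F := fun x => w x j * inner ℝ (g j x) (e x))
      ((memLp_coord hw.memLp j).1.mul ((he.grad_memLp j).1.inner he.memLp.1)) (fun x => by
        rw [norm_mul, Real.norm_eq_abs, mul_assoc]
        refine mul_le_mul (hcoord _ _) ((norm_inner_le_norm _ _).trans (mul_comm _ _).le)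
          (norm_nonneg _) (norm_nonneg _)) hw4 he4 (he.grad_memLp j)).1
  have hi2 : ∀ j : Fin d, Integrable (fun x => k j x j * ‖e x‖ ^ 2) volume := fun j =>
    (integrable_and_enorm_integral_le_of_triple (F := fun x => k j x j * ‖e x‖ ^ 2)
      ((memLp_coord (hw.grad_memLp j) j).1.mul (he.memLp.1.norm.pow 2)) (fun x => by
        rw [norm_mul, Real.norm_eq_abs, norm_pow, norm_norm, mul_comm, pow_two]
        exact mul_le_mul_of_nonneg_left (hcoord _ _) (by positivity))
        he4 he4 (hw.grad_memLp j)).1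
  rw [integral_finsetSum _ fun j _ => hi1 j]
  simp_rw [hw.integral_mul_inner_grad hd hΩb he]
  rw [← Finset.mul_sum, ← integral_finsetSum _ fun j _ => hi2 j]
  simp_rw [← Finset.sum_mul]
  have hdivae : ∀ᵐ x ∂(volume.restrict Ω), divergence Ω w x = ∑ j : Fin d, k j x j := by
    filter_upwards [ae_all_iff.2 fun j => hw.weakPartial_ae_eq hΩ j] with x hx
    simp only [divergence, hx]
  have hk0 : ∀ᵐ x, x ∉ Ω → ∑ j : Fin d, k j x j = 0 := by
    filter_upwards [ae_all_iff.2 fun j => hw.grad_zero hΩb j] with x hx hxs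
    simp [fun j => hx j hxs]
  have hfin : IsFiniteMeasure (volume.restrict Ω) := ⟨by
    simpa using hΩb.measure_lt_top⟩
  -- test with `|e|²` minus its mean
  set c : ℝ := (∫ x in Ω, ‖e x‖ ^ 2) / (volume.restrict Ω).real univ with hcdef
  have he2 : MemLp (fun x => ‖e x‖ ^ 2) 2 (volume.restrict Ω) := by
    have ht : ENNReal.HolderTriple 4 4 2 := ⟨by
      rw [show (4 : ℝ≥0∞) = 2 * 2 by norm_num,
        ENNReal.mul_inv (Or.inl two_ne_zero) (Or.inl ENNReal.ofNat_ne_top), ← mul_add,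
        ENNReal.inv_two_add_inv_two, mul_one]⟩
    have : MemLp (fun x => ‖e x‖ * ‖e x‖) 2 volume := MemLp.mul (r := 2) he4.norm he4.norm
    simp_rw [pow_two]
    exact this.restrict Ω
  have hq : (fun x => ‖e x‖ ^ 2 - c) ∈ pressureSpace Ω := by
    refine ⟨he2.sub (memLp_const c), ?_⟩
    rw [integral_sub (he2.integrable (by norm_num)) (integrable_const c), integral_const, hcdef]
    by_cases h0 : (volume.restrict Ω).real univ = 0
    · have h00 : volume.restrict Ω = 0 := by
        rwa [measureReal_eq_zero_iff, Measure.measure_univ_eq_zero] at h0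
      simp [h00]
    · rw [smul_eq_mul, mul_div_cancel₀ _ h0, sub_self]
  have h1 := hdiv _ hq
  have h2 : ∫ x, (∑ j : Fin d, k j x j) * (‖e x‖ ^ 2 - c) = 0 := by
    rw [← h1, ← setIntegral_eq_integral_of_ae_compl_eq_zero (s := Ω)]
    · refine integral_congr_ae ?_
      filter_upwards [hdivae] with x hx
      rw [hx]
    · filter_upwards [hk0] with x hx hxs
      rw [hx hxs, zero_mul]
  have hi3 : Integrable (fun x => ∑ j : Fin d, k j x j) volume := by
    have : IntegrableOn (fun x => ∑ j : Fin d, k j x j) Ω volume :=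
      integrable_finsetSum _ fun j _ =>
        (memLp_coord ((hw.grad_memLp j).restrict Ω) j).integrable (by norm_num)
    refine this.integrable_of_ae_notMem_eq_zero ?_
    filter_upwards [hk0] with x hx hxs using hx hxs
  have h3 : ∫ x, (∑ j : Fin d, k j x j) = 0 := by
    rw [integral_finsetSum]
    · exact Finset.sum_eq_zero fun j _ => hw.integral_grad_eq_zero hΩb j j
    · intro j _
      have : IntegrableOn (fun x => k j x j) Ω volume :=
        (memLp_coord ((hw.grad_memLp j).restrict Ω) j).integrable (by norm_num)
      refine this.integrable_of_ae_notMem_eq_zero ?_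
      filter_upwards [hw.grad_zero hΩb j] with x hx hxs
      simp [hx hxs]
  have hi4 : Integrable (fun x => (∑ j : Fin d, k j x j) * ‖e x‖ ^ 2) volume := by
    simp_rw [Finset.sum_mul]
    exact integrable_finsetSum _ fun j _ => hi2 j
  simp_rw [mul_sub] at h2
  rw [integral_sub hi4 (hi3.mul_const c), integral_mul_const, h3, zero_mul, sub_zero] at h2
  rw [h2, mul_zero]

/-! ### Ladyzhenskaya's inequality and the convective term -/

lemma integral_norm_pow_eq_toReal_eLpNorm {X F : Type*} [MeasurableSpace X] [NormedAddCommGroup F]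
    {m : Measure X} {u : X → F} {n : ℕ} (hn : n ≠ 0) (hu : MemLp u n m) :
    ∫ x, ‖u x‖ ^ n ∂m = (eLpNorm u n m).toReal ^ n := by
  have h := eLpNorm_nnreal_pow_eq_lintegral (f := u) (μ := m) (p := (n : ℝ≥0))
    (by exact_mod_cast hn)
  simp only [NNReal.coe_natCast, ENNReal.coe_natCast, ENNReal.rpow_natCast] at h
  rw [← ENNReal.toReal_pow, h, integral_eq_lintegral_of_nonneg_ae
    (f := fun x => ‖u x‖ ^ n) (ae_of_all _ fun x => by positivity) (hu.1.norm.pow n)]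
  congr 1
  refine lintegral_congr fun x => ?_
  rw [← ofReal_norm, ENNReal.ofReal_pow (norm_nonneg _)]

lemma integral_norm_sq_eq {X F : Type*} [MeasurableSpace X] [NormedAddCommGroup F]
    {m : Measure X} {u : X → F} (hu : MemLp u 2 m) :
    ∫ x, ‖u x‖ ^ 2 ∂m = (eLpNorm u 2 m).toReal ^ 2 := by
  have := integral_norm_pow_eq_toReal_eLpNorm (n := 2) two_ne_zero (u := u) (m := m)
    (by exact_mod_cast hu)
  exact_mod_cast this

/-- The Cauchy–Schwarz inequality. -/
lemma sq_integral_mul_le {X : Type*} [MeasurableSpace X] {m : Measure X} {f g : X → ℝ}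
    (hf : MemLp f 2 m) (hg : MemLp g 2 m) :
    (∫ x, f x * g x ∂m) ^ 2 ≤ (∫ x, f x ^ 2 ∂m) * ∫ x, g x ^ 2 ∂m := by
  have h := ENNReal.toReal_mono (ENNReal.mul_ne_top hf.2.ne hg.2.ne)
    (norm_integral_mul_le_eLpNorm_two hf hg)
  rw [toReal_enorm, ENNReal.toReal_mul] at h
  have e1 := integral_norm_sq_eq hf
  have e2 := integral_norm_sq_eq hg
  simp only [Real.norm_eq_abs, sq_abs] at e1 e2 h
  rw [e1, e2, ← mul_pow, ← sq_abs (∫ x, f x * g x ∂m)]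
  gcongr

/-- Ladyzhenskaya's inequality `‖v‖⁸_{L⁴} ≤ C ‖v‖²_{L²} ‖∇v‖⁶_{L²}` for fields vanishing off a
bounded set, in dimensions two and three. -/
lemma exists_ladyzhenskaya (hd : d = 2 ∨ d = 3) {s : Set (Space d)} (hs : Bornology.IsBounded s) :
    ∃ C : ℝ, 0 ≤ C ∧ ∀ (v : Space d → Space d) (g : Fin d → Space d → Space d), IsH10 s v g →
      ((eLpNorm v 4 volume).toReal ^ 2) ^ 4
        ≤ (∫ x, ‖v x‖ ^ 2) * (C * ∑ j : Fin d, ∫ x, ‖g j x‖ ^ 2) ^ 3 := by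
  obtain ⟨C, hC⟩ := exists_sobolev hd hs (q := 6) (by norm_num)
  refine ⟨C ^ 2 * d, by positivity, fun v g h => ?_⟩
  have h4 : MemLp v 4 volume := h.memLp_four hd hs
  have hsumlt : (C : ℝ≥0∞) * ∑ j : Fin d, eLpNorm (g j) 2 volume < ⊤ :=
    ENNReal.mul_lt_top ENNReal.coe_lt_top (ENNReal.sum_lt_top.2 fun j _ => (h.grad_memLp j).2)
  have h6 : MemLp v 6 volume := ⟨h.memLp.1, (hC v g h).trans_lt hsumlt⟩
  have i6 : ∫ x, ‖v x‖ ^ 6 = (eLpNorm v 6 volume).toReal ^ 6 := by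
    have := integral_norm_pow_eq_toReal_eLpNorm (n := 6) (by norm_num) (u := v)
      (m := (volume : Measure (Space d))) (by exact_mod_cast h6)
    exact_mod_cast this
  have i4 : ∫ x, ‖v x‖ ^ 4 = (eLpNorm v 4 volume).toReal ^ 4 := by
    have := integral_norm_pow_eq_toReal_eLpNorm (n := 4) (by norm_num) (u := v)
      (m := (volume : Measure (Space d))) (by exact_mod_cast h4)
    exact_mod_cast this
  have hcube : MemLp (fun x => ‖v x‖ ^ 3) 2 volume := by
    refine (memLp_two_iff_integrable_sq (h.memLp.1.norm.pow 3)).2 ?_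
    have : Integrable (fun x => ‖v x‖ ^ 6) volume := by
      have := h6.integrable_norm_pow (p := 6) (by norm_num)
      exact this
    refine this.congr (ae_of_all _ fun x => ?_)
    simp only [Pi.pow_apply]
    ring
  -- `|v|⁴ = |v| |v|³` interpolates `L⁴` between `L²` and `L⁶`
  have hcs := sq_integral_mul_le h.memLp.norm hcube
  have e1 : ∫ x, ‖v x‖ * ‖v x‖ ^ 3 = ∫ x, ‖v x‖ ^ 4 :=
    integral_congr_ae (ae_of_all _ fun x => by ring)
  have e2 : ∫ x, (‖v x‖ ^ 3) ^ 2 = ∫ x, ‖v x‖ ^ 6 :=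
    integral_congr_ae (ae_of_all _ fun x => by ring)
  rw [e1, e2, i4, i6] at hcs
  have hS := ENNReal.toReal_mono hsumlt.ne (hC v g h)
  rw [ENNReal.toReal_mul, ENNReal.toReal_sum fun j _ => (h.grad_memLp j).2.ne] at hS
  simp only [ENNReal.coe_toReal] at hS
  have hS2 : (eLpNorm v 6 volume).toReal ^ 2
      ≤ C ^ 2 * d * ∑ j : Fin d, ∫ x, ‖g j x‖ ^ 2 := by
    calc (eLpNorm v 6 volume).toReal ^ 2
        ≤ (C * ∑ j : Fin d, (eLpNorm (g j) 2 volume).toReal) ^ 2 := by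
          gcongr
          exact hS
      _ = C ^ 2 * (∑ j : Fin d, (eLpNorm (g j) 2 volume).toReal) ^ 2 := by ring
      _ ≤ C ^ 2 * (d * ∑ j : Fin d, (eLpNorm (g j) 2 volume).toReal ^ 2) := by
          gcongr
          simpa using sq_sum_le_card_mul_sum_sq (s := Finset.univ)
            (f := fun j : Fin d => (eLpNorm (g j) 2 volume).toReal)
      _ = C ^ 2 * d * ∑ j : Fin d, ∫ x, ‖g j x‖ ^ 2 := by
          simp_rw [fun j => integral_norm_sq_eq (h.grad_memLp j)]
          ring
  calc ((eLpNorm v 4 volume).toReal ^ 2) ^ 4 = ((eLpNorm v 4 volume).toReal ^ 4) ^ 2 := by ring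
    _ ≤ (∫ x, ‖v x‖ ^ 2) * ((eLpNorm v 6 volume).toReal ^ 2) ^ 3 := by
        refine hcs.trans (le_of_eq ?_)
        ring
    _ ≤ _ := by gcongr

/-- Young's inequality for the product `n^(1/4) b^(3/4)`. -/
lemma le_add_of_pow_four_le {q n b η : ℝ} (hn : 0 ≤ n) (hb : 0 ≤ b) (hη : 0 < η)
    (h : q ^ 4 ≤ n * b ^ 3) : q ≤ η * b + n / η ^ 3 := by
  by_contra! hlt
  have hb' : 0 ≤ η * b := by positivity
  have hn' : 0 ≤ n / η ^ 3 := by positivity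
  have h1 : η * b < q := by linarith
  have hq : 0 < q := by linarith
  have h2 : n / η ^ 3 ≤ q := by linarith
  have h3 : n ≤ q * η ^ 3 := by rwa [div_le_iff₀ (by positivity)] at h2
  have h4 : (η * b) ^ 3 < q ^ 3 := by gcongr
  have : n * b ^ 3 < q ^ 4 := by
    calc n * b ^ 3 ≤ q * η ^ 3 * b ^ 3 := by gcongr
      _ = q * (η * b) ^ 3 := by ring
      _ < q * q ^ 3 := by gcongr
      _ = q ^ 4 := by ring
  linarith

/-- The convective term `b(e, u, e)` is absorbed by the viscous term, for `∇u` bounded in `L²`. -/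
lemma exists_convective_bound (hd : d = 2 ∨ d = 3) {s : Set (Space d)}
    (hs : Bornology.IsBounded s) {ε : ℝ} (hε : 0 < ε) (M : ℝ) :
    ∃ K : ℝ, 0 ≤ K ∧ ∀ (e : Space d → Space d) (g k : Fin d → Space d → Space d), IsH10 s e g →
      (∀ j, MemLp (k j) 2 volume) → (∑ j : Fin d, ∫ x, ‖k j x‖ ^ 2) ≤ M →
      |∫ x, ∑ j : Fin d, e x j * inner ℝ (k j x) (e x)|
        ≤ ε * (∑ j : Fin d, ∫ x, ‖g j x‖ ^ 2) + K * ∫ x, ‖e x‖ ^ 2 := by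
  obtain ⟨C, hC0, hC⟩ := exists_ladyzhenskaya hd hs
  obtain ⟨m, hm⟩ : ∃ m : ℝ, m = d * Real.sqrt M := ⟨_, rfl⟩
  have hm0 : 0 ≤ m := by rw [hm]; positivity
  -- the weight in Young's inequality that leaves at most `ε` in front of the gradient
  obtain ⟨η, hη0, h4⟩ : ∃ η : ℝ, 0 < η ∧ m * (η * C) ≤ ε := by
    refine ⟨ε / (m * C + 1), by positivity, ?_⟩
    rw [div_mul_eq_mul_div, mul_div_assoc', div_le_iff₀ (by positivity)]
    nlinarith
  refine ⟨m / η ^ 3, by positivity, fun e g k he hk hkM => ?_⟩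
  have he4 := he.memLp_four hd hs
  have hcoord : ∀ (z : Space d) (j : Fin d), |z j| ≤ ‖z‖ := fun z j => PiLp.norm_apply_le z j
  have htr := fun j : Fin d => integrable_and_enorm_integral_le_of_triple
    (F := fun x => e x j * inner ℝ (k j x) (e x))
      ((memLp_coord he.memLp j).1.mul ((hk j).1.inner he.memLp.1)) (fun x => by
        rw [norm_mul, Real.norm_eq_abs, mul_assoc]
        refine mul_le_mul (hcoord _ _) ((norm_inner_le_norm _ _).trans (mul_comm _ _).le)
          (norm_nonneg _) (norm_nonneg _)) he4 he4 (hk j)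
  set q := (eLpNorm e 4 volume).toReal ^ 2 with hq
  have hkj : ∀ j, (eLpNorm (k j) 2 volume).toReal ≤ Real.sqrt M := fun j => by
    refine Real.le_sqrt_of_sq_le ?_
    rw [← integral_norm_sq_eq (hk j)]
    exact (Finset.single_le_sum (f := fun j => ∫ x, ‖k j x‖ ^ 2)
      (fun i _ => integral_nonneg fun x => by positivity) (Finset.mem_univ j)).trans hkM
  have h1 : ∀ j : Fin d, |∫ x, e x j * inner ℝ (k j x) (e x)| ≤ q * Real.sqrt M := fun j => by
    have := ENNReal.toReal_mono (ENNReal.mul_ne_top (ENNReal.mul_ne_top he4.2.ne he4.2.ne)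
      (hk j).2.ne) (htr j).2
    rw [toReal_enorm, ENNReal.toReal_mul, ENNReal.toReal_mul, ← pow_two, Real.norm_eq_abs] at this
    refine this.trans ?_
    gcongr
    exact hkj j
  have h2 : |∫ x, ∑ j : Fin d, e x j * inner ℝ (k j x) (e x)| ≤ m * q := by
    rw [integral_finsetSum _ fun j _ => (htr j).1]
    refine (Finset.abs_sum_le_sum_abs _ _).trans ((Finset.sum_le_sum fun j _ => h1 j).trans ?_)
    rw [Finset.sum_const, Finset.card_univ, Fintype.card_fin, nsmul_eq_mul, hm]
    exact le_of_eq (by ring)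
  set N := ∫ x, ‖e x‖ ^ 2
  set G := ∑ j : Fin d, ∫ x, ‖g j x‖ ^ 2
  have hN0 : 0 ≤ N := integral_nonneg fun x => by positivity
  have hG0 : 0 ≤ G := Finset.sum_nonneg fun j _ => integral_nonneg fun x => by positivity
  have hL : q ^ 4 ≤ N * (C * G) ^ 3 := hC e g he
  have h3 : q ≤ η * (C * G) + N / η ^ 3 :=
    le_add_of_pow_four_le (q := q) (n := N) (b := C * G) (η := η) hN0 (mul_nonneg hC0 hG0) hη0 hL
  clear_value N G q
  calc _ ≤ m * q := h2
    _ ≤ m * (η * (C * G) + N / η ^ 3) := by gcongr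
    _ = (m * (η * C)) * G + m / η ^ 3 * N := by ring
    _ ≤ ε * G + m / η ^ 3 * N := by gcongr

/-! ### Increments of fields in `H¹` and the nonlocal energy near the diagonal -/

lemma eLpNorm_translate_sub_le_smooth {V : Space d → Space d} (hV : ContDiff ℝ ∞ V)
    (h : Space d) : eLpNorm (fun x => V (x + h) - V x) 2 volume
      ≤ ‖h‖ₑ * eLpNorm (fderiv ℝ V) 2 volume := by
  have hc : Continuous (fderiv ℝ V) := hV.continuous_fderiv (by simp)
  have hF : Continuous fun z : Space d × ℝ => fderiv ℝ V (z.1 + z.2 • h) h :=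
    (hc.comp (by fun_prop)).clm_apply continuous_const
  have : IsProbabilityMeasure (volume.restrict (Ioc (0 : ℝ) 1)) := ⟨by simp⟩
  have hftc : ∀ x, V (x + h) - V x
      = ∫ t in Ioc (0 : ℝ) 1, fderiv ℝ V (x + t • h) h := fun x => by
    have hd : ∀ t ∈ uIcc (0 : ℝ) 1, HasDerivAt (fun t : ℝ => V (x + t • h))
        (fderiv ℝ V (x + t • h) h) t := fun t _ => by
      have h1 : HasFDerivAt V (fderiv ℝ V (x + t • h)) (x + t • h) :=
        (hV.differentiable (by simp) _).hasFDerivAt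
      have h2 : HasDerivAt (fun t : ℝ => x + t • h) h t := by
        simpa using ((hasDerivAt_id t).smul_const h).const_add x
      exact h1.comp_hasDerivAt t h2
    have := intervalIntegral.integral_eq_sub_of_hasDerivAt hd
      ((hF.comp (Continuous.prodMk continuous_const continuous_id)).intervalIntegrable 0 1)
    rw [intervalIntegral.integral_of_le zero_le_one] at this
    rw [this]
    simp
  refine (ENNReal.pow_le_pow_left_iff two_ne_zero).1 ?_
  rw [mul_pow, eLpNorm_two_sq, eLpNorm_two_sq]
  calc ∫⁻ x, ‖V (x + h) - V x‖ₑ ^ 2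
      ≤ ∫⁻ x, ∫⁻ t in Ioc (0 : ℝ) 1, ‖fderiv ℝ V (x + t • h) h‖ₑ ^ 2 := by
        refine lintegral_mono fun x => ?_
        rw [hftc]
        exact enorm_integral_sq_le
          (hF.comp (Continuous.prodMk continuous_const continuous_id)).aestronglyMeasurable
    _ = ∫⁻ t in Ioc (0 : ℝ) 1, ∫⁻ x, ‖fderiv ℝ V (x + t • h) h‖ₑ ^ 2 :=
        lintegral_lintegral_swap (hF.enorm.measurable.pow_const 2).aemeasurable
    _ ≤ ∫⁻ t in Ioc (0 : ℝ) 1, ‖h‖ₑ ^ 2 * ∫⁻ x, ‖fderiv ℝ V x‖ₑ ^ 2 := by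
        refine lintegral_mono fun t => ?_
        rw [lintegral_add_right_eq_self (fun x => ‖fderiv ℝ V x h‖ₑ ^ 2) (t • h),
          ← lintegral_const_mul _ (hc.enorm.measurable.pow_const 2)]
        refine lintegral_mono fun x => ?_
        rw [← mul_pow, mul_comm]
        gcongr
        exact ContinuousLinearMap.le_opENorm _ _
    _ = ‖h‖ₑ ^ 2 * ∫⁻ x, ‖fderiv ℝ V x‖ₑ ^ 2 := by simp

/-- Increments of a field in `H¹(ℝ^d)` are bounded by its gradient. -/
lemma IsH10.eLpNorm_translate_sub_le {s : Set (Space d)} {v : Space d → Space d}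
    {g : Fin d → Space d → Space d} (hv : IsH10 s v g) (h : Space d) :
    eLpNorm (fun x => v (x + h) - v x) 2 volume
      ≤ ‖h‖ₑ * ∑ j : Fin d, eLpNorm (g j) 2 volume := by
  obtain ⟨V, hV, -, hV2, hVg⟩ := hv.exists_smooth_approx
  have hlim : Tendsto (fun n => eLpNorm (V n - v) 2 volume + (‖h‖ₑ * ∑ j : Fin d, (eLpNorm
        ((fun x => fderiv ℝ (V n) x (EuclideanSpace.single j 1)) - g j) 2 volume
          + eLpNorm (g j) 2 volume) + eLpNorm (V n - v) 2 volume)) atTop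
      (𝓝 (0 + (‖h‖ₑ * ∑ j : Fin d, (0 + eLpNorm (g j) 2 volume) + 0))) := by
    refine hV2.add (Tendsto.add ?_ hV2)
    exact ENNReal.Tendsto.const_mul (tendsto_finsetSum _ fun j _ => (hVg j).add_const _)
      (Or.inr enorm_ne_top)
  simp only [zero_add, add_zero] at hlim
  refine ge_of_tendsto' hlim fun n => ?_
  have hsm : AEStronglyMeasurable (V n - v) volume :=
    (hV n).continuous.aestronglyMeasurable.sub hv.memLp.1
  have hmp := measurePreserving_add_right (volume : Measure (Space d)) h
  have hsm' : AEStronglyMeasurable (fun x => (V n - v) (x + h)) volume :=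
    hsm.comp_quasiMeasurePreserving hmp.quasiMeasurePreserving
  have hVm : AEStronglyMeasurable (fun x => V n (x + h) - V n x) volume :=
    (((hV n).continuous.comp (continuous_add_const h)).sub (hV n).continuous).aestronglyMeasurable
  have e : (fun x => v (x + h) - v x) = (fun x => - (V n - v) (x + h))
      + ((fun x => V n (x + h) - V n x) + (V n - v)) := by
    ext1 x
    simp only [Pi.add_apply, Pi.sub_apply]
    abel
  have e2 : eLpNorm (fun x => -(V n - v) (x + h)) 2 volume = eLpNorm (V n - v) 2 volume := by
    rw [show (fun x => -(V n - v) (x + h)) = -((V n - v) ∘ (fun x => x + h)) from rfl, eLpNorm_neg]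
    exact eLpNorm_comp_measurePreserving hsm hmp
  rw [e]
  refine (eLpNorm_add_le (f := fun x => -(V n - v) (x + h)) hsm'.neg (hVm.add hsm)
    (by norm_num)).trans ?_
  rw [e2]
  gcongr
  refine (eLpNorm_add_le hVm hsm (by norm_num)).trans ?_
  gcongr
  refine (eLpNorm_translate_sub_le_smooth (hV n) h).trans ?_
  gcongr
  refine (eLpNorm_fderiv_le_sum (hV n)).trans ?_
  gcongr with j _
  have : (fun x => fderiv ℝ (V n) x (EuclideanSpace.single j 1))
      = ((fun x => fderiv ℝ (V n) x (EuclideanSpace.single j 1)) - g j) + g j := by simp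
  conv_lhs => rw [this]
  refine eLpNorm_add_le (AEStronglyMeasurable.sub ?_ (hv.grad_memLp j).1) (hv.grad_memLp j).1
    (by norm_num)
  exact ((hV n).continuous_fderiv (by simp)).clm_apply continuous_const |>.aestronglyMeasurable

/-! ### The nonlocal forms -/

/-- Two powers of `‖z‖` compensate the singularity of the kernel, since `2 - 2 α > 0`. -/
lemma lintegral_near_kernel_lt_top (hd : 0 < d) {α : ℝ} (hα : α ∈ Ioo (0 : ℝ) 1) {r : ℝ}
    (hr : 0 < r) : ∫⁻ z in Metric.ball (0 : Space d) r,
      ENNReal.ofReal (‖z‖ ^ 2 / ‖z‖ ^ ((d : ℝ) + 2 * α)) < ⊤ := by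
  have : Nonempty (Fin d) := ⟨⟨0, hd⟩⟩
  have hfr : Module.finrank ℝ (Space d) = d := by simp
  have hi : IntegrableOn (fun z : Space d => ‖z‖ ^ 2 / ‖z‖ ^ ((d : ℝ) + 2 * α))
      (Metric.ball 0 r) volume := by
    refine (integrableOn_fun_norm_addHaar (volume : Measure (Space d))
      (f := fun y : ℝ => y ^ 2 / y ^ ((d : ℝ) + 2 * α))).2 ?_
    have h1 : IntegrableOn (fun y : ℝ => y ^ (1 - 2 * α)) (Ioo 0 r) :=
      (intervalIntegral.integrableOn_Ioo_rpow_iff hr).2 (by linarith [hα.2])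
    refine h1.congr_fun (fun y hy => ?_) measurableSet_Ioo
    have hy0 : 0 < y := hy.1
    simp only [hfr, smul_eq_mul]
    rw [← Real.rpow_natCast y (d - 1), ← Real.rpow_natCast y 2, mul_div_assoc',
      ← Real.rpow_add hy0, ← Real.rpow_sub hy0]
    congr 1
    rw [Nat.cast_sub (by omega)]
    push_cast
    ring
  exact hi.lintegral_lt_top

/-- The tail of the kernel has total mass of order `λ^(-2α)`. -/
lemma exists_lintegral_far_kernel_le (hd : 0 < d) {α : ℝ} (hα : α ∈ Ioo (0 : ℝ) 1) :
    ∃ κ : ℝ, 0 ≤ κ ∧ ∀ r : ℝ, 0 < r → ∫⁻ z : Space d,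
      (if r < ‖z‖ then ENNReal.ofReal (1 / ‖z‖ ^ ((d : ℝ) + 2 * α)) else 0)
        ≤ ENNReal.ofReal (κ * (1 / r ^ (2 * α))) := by
  have : Nonempty (Fin d) := ⟨⟨0, hd⟩⟩
  have hfr : Module.finrank ℝ (Space d) = d := by simp
  have hα0 := hα.1
  refine ⟨d * ((volume : Measure (Space d)).real (Metric.ball 0 1) * (1 / (2 * α))),
    by positivity, fun r hr => ?_⟩
  set f : ℝ → ℝ := fun y => if r < y then 1 / y ^ ((d : ℝ) + 2 * α) else 0 with hf
  have hpt : ∀ y ∈ Ioi (0 : ℝ), y ^ (d - 1) • f y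
      = (Ioi r).indicator (fun y : ℝ => y ^ (-1 - 2 * α)) y := fun y hy => by
    have hy0 : 0 < y := hy
    by_cases hry : r < y
    · rw [indicator_of_mem (by exact hry)]
      simp only [hf, if_pos hry, smul_eq_mul]
      rw [← Real.rpow_natCast y (d - 1), mul_one_div, ← Real.rpow_sub hy0]
      congr 1
      rw [Nat.cast_sub (by omega)]
      push_cast
      ring
    · rw [indicator_of_notMem (by exact hry)]
      simp [hf, if_neg hry]
  have hint : IntegrableOn (fun y : ℝ => y ^ (-1 - 2 * α)) (Ioi r) :=
    integrableOn_Ioi_rpow_of_lt (by linarith) hr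
  have hi : Integrable (fun z : Space d => f ‖z‖) volume := by
    rw [integrable_fun_norm_addHaar, hfr]
    refine IntegrableOn.congr_fun ?_ (fun y hy => (hpt y hy).symm) measurableSet_Ioi
    exact ((integrable_indicator_iff measurableSet_Ioi).2 hint).integrableOn
  have hnn : ∀ z : Space d, 0 ≤ f ‖z‖ := fun z => by
    simp only [hf]
    split_ifs <;> positivity
  have hval : ∫ z : Space d, f ‖z‖ = d * ((volume : Measure (Space d)).real (Metric.ball 0 1)
      * (1 / (2 * α))) * (1 / r ^ (2 * α)) := by
    rw [integral_fun_norm_addHaar, hfr, setIntegral_congr_fun measurableSet_Ioi hpt,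
      setIntegral_indicator measurableSet_Ioi,
      inter_eq_self_of_subset_right (Ioi_subset_Ioi hr.le),
      integral_Ioi_rpow_of_lt (by linarith) hr, nsmul_eq_mul, smul_eq_mul]
    rw [show -1 - 2 * α + 1 = -(2 * α) by ring, Real.rpow_neg hr.le]
    field_simp
  rw [← hval, ofReal_integral_eq_lintegral_ofReal hi (ae_of_all _ hnn)]
  refine lintegral_mono fun z => ?_
  simp only [hf]
  split_ifs <;> simp

/-- The nonlocal energy over pairs of points at distance less than `r` is controlled by the
gradient. -/
lemma IsH10.lintegral_near_le {s : Set (Space d)} {v : Space d → Space d}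
    {g : Fin d → Space d → Space d} (hv : IsH10 s v g) (hm : StronglyMeasurable v)
    (p r : ℝ) :
    ∫⁻ x, ∫⁻ y, (if ‖x - y‖ < r then ENNReal.ofReal (1 / ‖x - y‖ ^ p) * ‖v x - v y‖ₑ ^ 2 else 0)
      ≤ (∫⁻ z in Metric.ball (0 : Space d) r, ENNReal.ofReal (‖z‖ ^ 2 / ‖z‖ ^ p))
          * (∑ j : Fin d, eLpNorm (g j) 2 volume) ^ 2 := by
  have hmeas : Measurable fun q : Space d × Space d =>
      (if ‖q.1 - q.2‖ < r then ENNReal.ofReal (1 / ‖q.1 - q.2‖ ^ p) * ‖v q.1 - v q.2‖ₑ ^ 2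
        else 0) := by
    refine Measurable.ite (measurableSet_lt (by fun_prop) measurable_const)
      (Measurable.fun_mul ?_ ?_) measurable_const
    · exact (measurable_const.div
        ((measurable_fst.sub measurable_snd).norm.pow_const p)).ennreal_ofReal
    · exact ((hm.comp_measurable measurable_fst).sub
        (hm.comp_measurable measurable_snd)).enorm.pow_const 2
  rw [lintegral_lintegral_swap hmeas.aemeasurable]
  have h1 : ∀ y, ∫⁻ x, (if ‖x - y‖ < r then ENNReal.ofReal (1 / ‖x - y‖ ^ p)
        * ‖v x - v y‖ₑ ^ 2 else 0)
      = ∫⁻ z, (if ‖z‖ < r then ENNReal.ofReal (1 / ‖z‖ ^ p) * ‖v (y + z) - v y‖ₑ ^ 2 else 0) :=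
    fun y => by
      rw [← lintegral_add_right_eq_self _ y]
      refine lintegral_congr fun z => ?_
      rw [add_sub_cancel_right, add_comm]
  simp_rw [h1]
  have hmeas2 : Measurable fun q : Space d × Space d =>
      (if ‖q.2‖ < r then ENNReal.ofReal (1 / ‖q.2‖ ^ p) * ‖v (q.1 + q.2) - v q.1‖ₑ ^ 2
        else 0) := by
    have := hmeas.comp ((measurable_fst.add measurable_snd).prodMk measurable_fst :
      Measurable fun q : Space d × Space d => (q.1 + q.2, q.1))
    simpa [Function.comp_def] using this
  rw [lintegral_lintegral_swap hmeas2.aemeasurable, ← lintegral_indicator measurableSet_ball,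
    ← lintegral_mul_const'']
  swap
  · refine (Measurable.indicator ?_ measurableSet_ball).aemeasurable
    exact ((measurable_norm.pow_const 2).div (measurable_norm.pow_const p)).ennreal_ofReal
  refine lintegral_mono fun z => ?_
  by_cases hz : ‖z‖ < r
  · rw [indicator_of_mem (by simpa using hz)]
    simp only [if_pos hz]
    rw [lintegral_const_mul' _ _ ENNReal.ofReal_ne_top, ← eLpNorm_two_sq]
    calc ENNReal.ofReal (1 / ‖z‖ ^ p) * eLpNorm (fun y => v (y + z) - v y) 2 volume ^ 2
        ≤ ENNReal.ofReal (1 / ‖z‖ ^ p) * (‖z‖ₑ * ∑ j : Fin d, eLpNorm (g j) 2 volume) ^ 2 := by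
          gcongr
          exact hv.eLpNorm_translate_sub_le z
      _ = ENNReal.ofReal (‖z‖ ^ 2 / ‖z‖ ^ p) * (∑ j : Fin d, eLpNorm (g j) 2 volume) ^ 2 := by
          rw [mul_pow, ← mul_assoc]
          congr 1
          rw [← ofReal_norm, ← ENNReal.ofReal_pow (norm_nonneg _),
            ← ENNReal.ofReal_mul (by positivity)]
          congr 1
          ring
  · simp [if_neg hz]

lemma measurable_norm_sub_rpow (p : ℝ) :
    Measurable fun z : Space d × Space d => ‖z.1 - z.2‖ ^ p :=
  (measurable_fst.sub measurable_snd).norm.pow_const p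

lemma aestronglyMeasurable_nonlocalDensity {α : ℝ} {v w : Space d → Space d}
    (hv : AEStronglyMeasurable v volume) (hw : AEStronglyMeasurable w volume) :
    AEStronglyMeasurable (fun z : Space d × Space d => nonlocalDensity α v w z.1 z.2)
      (volume.prod volume) :=
  (((hv.comp_fst.sub hv.comp_snd).inner (hw.comp_fst.sub hw.comp_snd)).aemeasurable.div
    (measurable_norm_sub_rpow _).aemeasurable).aestronglyMeasurable

lemma abs_nonlocalDensity_le {α : ℝ} (v w : Space d → Space d) {t : ℝ} (ht : 0 < t)
    (x y : Space d) : |nonlocalDensity α v w x y|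
      ≤ (t * ‖v x - v y‖ ^ 2 + t⁻¹ * ‖w x - w y‖ ^ 2) / ‖x - y‖ ^ ((d : ℝ) + 2 * α) := by
  rw [nonlocalDensity, abs_div, abs_of_nonneg (by positivity : 0 ≤ ‖x - y‖ ^ ((d : ℝ) + 2 * α))]
  gcongr
  refine (abs_real_inner_le_norm _ _).trans ?_
  set a := ‖v x - v y‖
  set b := ‖w x - w y‖
  have h : 0 ≤ t * (a - t⁻¹ * b) ^ 2 := by positivity
  have h2 : t * (a - t⁻¹ * b) ^ 2 = t * a ^ 2 + t⁻¹ * b ^ 2 - 2 * (a * b) := by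
    field_simp
    ring
  have : 0 ≤ a * b := by positivity
  linarith

/-- The nonlocal density of two fields in `H^α(ℝ^d)` is integrable. -/
lemma MemHFrac.integrable_nonlocalDensity {α : ℝ} {v w : Space d → Space d}
    (hv : MemHFrac univ α v) (hw : MemHFrac univ α w) :
    Integrable (fun z : Space d × Space d => nonlocalDensity α v w z.1 z.2)
      (volume.prod volume) := by
  have h1 := hv.2
  have h2 := hw.2
  have hv1 := hv.1.1
  have hw1 := hw.1.1
  rw [Measure.restrict_univ] at h1 h2 hv1 hw1
  refine (h1.add h2).mono' (aestronglyMeasurable_nonlocalDensity hv1 hw1)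
    (ae_of_all _ fun z => ?_)
  refine (abs_nonlocalDensity_le v w one_pos z.1 z.2).trans (le_of_eq ?_)
  simp only [Pi.add_apply]
  ring

/-- Pairs of points of `R` at distance at most `r`. -/
def nearPairs (R : Set (Space d)) (r : ℝ) : Set (Space d × Space d) :=
  {z | z.1 ∈ R ∧ z.2 ∈ R ∧ ‖z.1 - z.2‖ ≤ r}

lemma measurableSet_nearPairs {R : Set (Space d)} (hR : MeasurableSet R) (r : ℝ) :
    MeasurableSet (nearPairs R r) :=
  (measurable_fst hR).inter ((measurable_snd hR).inter
    (measurableSet_le (measurable_fst.sub measurable_snd).norm measurable_const))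

lemma fullForm_eq_integral {α : ℝ} {v w : Space d → Space d}
    (hv : MemHFrac univ α v) (hw : MemHFrac univ α w) :
    fullForm α v w = ∫ z : Space d × Space d, nonlocalDensity α v w z.1 z.2 :=
  (integral_prod _ (hv.integrable_nonlocalDensity hw)).symm

lemma setIntegral_near_eq {R : Set (Space d)} (hR : MeasurableSet R) {r : ℝ}
    {F : Space d × Space d → ℝ} (hF : Integrable F (volume.prod volume)) :
    ∫ x in R, ∫ y in R ∩ Metric.closedBall x r, F (x, y)
      = ∫ z in nearPairs R r, F z ∂(volume.prod volume) := by
  have hS := measurableSet_nearPairs hR r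
  rw [← integral_indicator hS, integral_prod _ (hF.indicator hS), ← integral_indicator hR]
  congr 1
  ext1 x
  by_cases hx : x ∈ R
  · rw [indicator_of_mem hx,
      ← integral_indicator (hR.inter Metric.isClosed_closedBall.measurableSet)]
    congr 1
    ext1 y
    by_cases hy : y ∈ R ∩ Metric.closedBall x r
    · rw [indicator_of_mem hy, indicator_of_mem]
      exact ⟨hx, hy.1, by rw [← dist_eq_norm, dist_comm]; exact hy.2⟩
    · rw [indicator_of_notMem hy, indicator_of_notMem]
      exact fun h => hy ⟨h.2.1, by rw [Metric.mem_closedBall, dist_comm, dist_eq_norm]; exact h.2.2⟩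
  · rw [indicator_of_notMem hx]
    symm
    refine integral_eq_zero_of_ae (ae_of_all _ fun y => ?_)
    exact indicator_of_notMem (fun h => hx h.1) _

/-- Every point within distance `λ` of a point of `Ω` belongs to `Ω ∪ Ω_λ`. -/
lemma mem_union_interactionDomain {Ω : Set (Space d)} {lam : ℝ} {x y : Space d} (hx : x ∈ Ω)
    (hxy : ‖x - y‖ ≤ lam) : y ∈ Ω ∪ interactionDomain Ω lam := by
  by_cases hy : y ∈ Ω
  · exact Or.inl hy
  · exact Or.inr ⟨hy, x, hx, hxy⟩

/-- For open `Ω` the domain `Ω ∪ Ω_λ` is the open `λ`-neighbourhood of `Ω`, although `Ω_λ` is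
defined by a non-strict inequality. -/
lemma union_interactionDomain_eq {Ω : Set (Space d)} (hΩ : IsOpen Ω) {lam : ℝ} (hlam : 0 < lam) :
    Ω ∪ interactionDomain Ω lam = Metric.thickening lam Ω := by
  ext y
  rw [Metric.mem_thickening_iff]
  constructor
  · rintro (hy | ⟨hy, x, hx, hxy⟩)
    · exact ⟨y, hy, by simpa using hlam⟩
    · -- move the point `x` of the open set `Ω` slightly towards `y`
      have hc : Continuous fun t : ℝ => x + t • (y - x) := by fun_prop
      have h0 : (fun t : ℝ => x + t • (y - x)) 0 ∈ Ω := by simpa using hx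
      have hev : ∀ᶠ t in 𝓝[>] (0 : ℝ), x + t • (y - x) ∈ Ω :=
        (hc.continuousAt.eventually_mem (hΩ.mem_nhds h0)).filter_mono nhdsWithin_le_nhds
      have hev1 : ∀ᶠ t in 𝓝[>] (0 : ℝ), t ∈ Ioo (0 : ℝ) 1 := Ioo_mem_nhdsGT one_pos
      obtain ⟨t, ht, ht1⟩ := (hev.and hev1).exists
      refine ⟨_, ht, ?_⟩
      rw [dist_eq_norm, show y - (x + t • (y - x)) = (1 - t) • (y - x) by module, norm_smul,
        Real.norm_of_nonneg (by linarith [ht1.2]), norm_sub_rev]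
      have hpos : 0 < ‖x - y‖ := norm_pos_iff.2 fun h => hy (sub_eq_zero.1 h ▸ hx)
      nlinarith [ht1.1]
  · rintro ⟨x, hx, hxy⟩
    exact mem_union_interactionDomain hx (by rw [← dist_eq_norm, dist_comm]; exact hxy.le)

lemma isOpen_union_interactionDomain {Ω : Set (Space d)} (hΩ : IsOpen Ω) {lam : ℝ}
    (hlam : 0 < lam) : IsOpen (Ω ∪ interactionDomain Ω lam) := by
  rw [union_interactionDomain_eq hΩ hlam]
  exact Metric.isOpen_thickening

lemma closure_subset_union_interactionDomain {Ω : Set (Space d)} (hΩ : IsOpen Ω) {lam : ℝ}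
    (hlam : 0 < lam) : closure Ω ⊆ Ω ∪ interactionDomain Ω lam := by
  rw [union_interactionDomain_eq hΩ hlam]
  exact Metric.closure_subset_thickening hlam Ω

lemma truncForm_eq_integral {Ω : Set (Space d)} (hΩ : IsOpen Ω) {lam : ℝ} (hlam : 0 < lam) {α : ℝ}
    {v w : Space d → Space d} (hv : MemHFrac univ α v) (hw : MemHFrac univ α w) :
    truncForm Ω α lam v w = ∫ z in nearPairs (Ω ∪ interactionDomain Ω lam) lam,
      nonlocalDensity α v w z.1 z.2 :=
  setIntegral_near_eq (isOpen_union_interactionDomain hΩ hlam).measurableSet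
    (hv.integrable_nonlocalDensity hw)

lemma truncForm_self (Ω : Set (Space d)) (α lam : ℝ) (v : Space d → Space d) :
    truncForm Ω α lam v v = truncGagliardoSq Ω α lam v := by
  simp only [truncForm, truncGagliardoSq, nonlocalDensity, real_inner_self_eq_norm_sq]
  congr 1
  ext1 x
  congr 1
  ext1 y
  rw [norm_sub_rev (v x), norm_sub_rev x]

lemma nonlocalDensity_add_right (α : ℝ) (u v w : Space d → Space d) (x y : Space d) :
    nonlocalDensity α u (v + w) x y = nonlocalDensity α u v x y + nonlocalDensity α u w x y := by
  simp only [nonlocalDensity, Pi.add_apply]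
  rw [← add_div, ← inner_add_right]
  congr 2
  abel

lemma nonlocalDensity_sub_left (α : ℝ) (u v w : Space d → Space d) (x y : Space d) :
    nonlocalDensity α (u - v) w x y = nonlocalDensity α u w x y - nonlocalDensity α v w x y := by
  simp only [nonlocalDensity, Pi.sub_apply]
  rw [← sub_div, ← inner_sub_left]
  congr 2
  abel

lemma MemHFrac.add {α : ℝ} {R : Set (Space d)} {v w : Space d → Space d}
    (hv : MemHFrac R α v) (hw : MemHFrac R α w) : MemHFrac R α (v + w) := by
  refine ⟨hv.1.add hw.1, ((hv.2.const_mul 2).add (hw.2.const_mul 2)).mono' ?_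
    (ae_of_all _ fun z => ?_)⟩
  · have h := (hv.1.add hw.1).1
    exact (((h.comp_fst.sub h.comp_snd).norm.aemeasurable.pow_const 2).div
      (measurable_norm_sub_rpow _).aemeasurable).aestronglyMeasurable
  · rw [Real.norm_of_nonneg (by positivity)]
    simp only [Pi.add_apply]
    rw [mul_div_assoc', mul_div_assoc', ← add_div]
    gcongr
    have h1 : v z.1 + w z.1 - (v z.2 + w z.2) = (v z.1 - v z.2) + (w z.1 - w z.2) := by abel
    rw [h1]
    have h2 := norm_add_le (v z.1 - v z.2) (w z.1 - w z.2)
    have h3 : ‖(v z.1 - v z.2) + (w z.1 - w z.2)‖ ^ 2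
        ≤ (‖v z.1 - v z.2‖ + ‖w z.1 - w z.2‖) ^ 2 := by gcongr
    nlinarith [sq_nonneg (‖v z.1 - v z.2‖ - ‖w z.1 - w z.2‖)]

lemma MemHFrac.const_smul {α : ℝ} {R : Set (Space d)} {v : Space d → Space d} (c : ℝ)
    (hv : MemHFrac R α v) : MemHFrac R α (c • v) := by
  refine ⟨hv.1.const_smul c, (hv.2.const_mul (c ^ 2)).congr (ae_of_all _ fun z => ?_)⟩
  simp only [Pi.smul_apply, ← smul_sub, norm_smul, mul_pow, Real.norm_eq_abs, sq_abs]
  ring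

lemma MemHFrac.sub {α : ℝ} {R : Set (Space d)} {v w : Space d → Space d}
    (hv : MemHFrac R α v) (hw : MemHFrac R α w) : MemHFrac R α (v - w) := by
  have := hv.add (hw.const_smul (-1))
  simpa [sub_eq_add_neg] using this

lemma fullForm_add_right {α : ℝ} {u v w : Space d → Space d} (hu : MemHFrac univ α u)
    (hv : MemHFrac univ α v) (hw : MemHFrac univ α w) :
    fullForm α u (v + w) = fullForm α u v + fullForm α u w := by
  rw [fullForm_eq_integral hu hv, fullForm_eq_integral hu hw, fullForm_eq_integral hu (hv.add hw)]
  simp_rw [nonlocalDensity_add_right]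
  exact integral_add (hu.integrable_nonlocalDensity hv) (hu.integrable_nonlocalDensity hw)

lemma truncForm_add_right {Ω : Set (Space d)} (hΩ : IsOpen Ω) {lam : ℝ} (hlam : 0 < lam) {α : ℝ}
    {u v w : Space d → Space d} (hu : MemHFrac univ α u)
    (hv : MemHFrac univ α v) (hw : MemHFrac univ α w) :
    truncForm Ω α lam u (v + w) = truncForm Ω α lam u v + truncForm Ω α lam u w := by
  rw [truncForm_eq_integral hΩ hlam hu hv, truncForm_eq_integral hΩ hlam hu hw,
    truncForm_eq_integral hΩ hlam hu (hv.add hw)]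
  simp_rw [nonlocalDensity_add_right]
  exact integral_add (hu.integrable_nonlocalDensity hv).integrableOn
    (hu.integrable_nonlocalDensity hw).integrableOn

lemma truncForm_sub_left {Ω : Set (Space d)} (hΩ : IsOpen Ω) {lam : ℝ} (hlam : 0 < lam) {α : ℝ}
    {u v w : Space d → Space d} (hu : MemHFrac univ α u)
    (hv : MemHFrac univ α v) (hw : MemHFrac univ α w) :
    truncForm Ω α lam (u - v) w = truncForm Ω α lam u w - truncForm Ω α lam v w := by
  rw [truncForm_eq_integral hΩ hlam hu hw, truncForm_eq_integral hΩ hlam hv hw,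
    truncForm_eq_integral hΩ hlam (hu.sub hv) hw]
  simp_rw [nonlocalDensity_sub_left]
  exact integral_sub (hu.integrable_nonlocalDensity hw).integrableOn
    (hv.integrable_nonlocalDensity hw).integrableOn

/-- For fields that vanish off `Ω`, truncating the interactions at distance `λ` changes the nonlocal
form only through pairs of points at distance larger than `λ`, where the kernel has mass of order
`λ^(-2α)`. -/
lemma exists_truncation_bound (hd : 0 < d) {α : ℝ} (hα : α ∈ Ioo (0 : ℝ) 1) :
    ∃ κ : ℝ, 0 ≤ κ ∧ ∀ (Ω : Set (Space d)), IsOpen Ω → ∀ lam : ℝ, 0 < lam →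
      ∀ v w : Space d → Space d, MemHFrac univ α v → MemHFrac univ α w →
      (∀ᵐ x, x ∉ Ω → v x = 0) →
      |fullForm α v w - truncForm Ω α lam v w|
        ≤ κ * ((1 / lam ^ (2 * α)) ^ 2 * (∫ x, ‖v x‖ ^ 2) + ∫ x, ‖w x‖ ^ 2) := by
  obtain ⟨κ, hκ0, hκ⟩ := exists_lintegral_far_kernel_le hd hα
  refine ⟨4 * κ, by positivity, fun Ω hΩ lam hlam v w hv hw hv0 => ?_⟩
  set R := Ω ∪ interactionDomain Ω lam
  have hRm : MeasurableSet R := (isOpen_union_interactionDomain hΩ hlam).measurableSet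
  have hS := measurableSet_nearPairs hRm lam
  have hint : Integrable (fun z : Space d × Space d => nonlocalDensity α v w z.1 z.2) volume :=
    hv.integrable_nonlocalDensity hw
  have hv2 : MemLp v 2 volume := by simpa using hv.1
  have hw2 : MemLp w 2 volume := by simpa using hw.1
  have hdiff : fullForm α v w - truncForm Ω α lam v w = ∫ z : Space d × Space d,
      (nearPairs R lam)ᶜ.indicator (fun z => nonlocalDensity α v w z.1 z.2) z := by
    rw [fullForm_eq_integral hv hw, truncForm_eq_integral hΩ hlam hv hw,
      integral_indicator hS.compl, setIntegral_compl hS hint]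
  rw [hdiff]
  -- the weight in Young's inequality; the kernel contributes another factor `t`, so that `v`
  -- appears with `t²` and `w` with a constant
  set t : ℝ := 1 / lam ^ (2 * α) with ht
  have ht0 : 0 < t := by positivity
  set K : Space d → ℝ≥0∞ := fun z =>
    if lam < ‖z‖ then ENNReal.ofReal (1 / ‖z‖ ^ ((d : ℝ) + 2 * α)) else 0 with hK
  have hKm : Measurable K := Measurable.ite (measurableSet_lt measurable_const measurable_norm)
    ((measurable_const.div (measurable_norm.pow_const _)).ennreal_ofReal) measurable_const
  set h : Space d → ℝ := fun x => t * ‖v x‖ ^ 2 + t⁻¹ * ‖w x‖ ^ 2 with hh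
  have hh0 : ∀ x, 0 ≤ h x := fun x => by positivity
  have hhi : Integrable h volume := by
    have h1 : Integrable (fun x => ‖v x‖ ^ 2) volume := hv2.integrable_norm_pow two_ne_zero
    have h2 : Integrable (fun x => ‖w x‖ ^ 2) volume := hw2.integrable_norm_pow two_ne_zero
    exact (h1.const_mul t).add (h2.const_mul t⁻¹)
  have hhm : AEMeasurable (fun x => ENNReal.ofReal (h x)) volume :=
    hhi.1.aemeasurable.ennreal_ofReal
  -- the pointwise bound
  have hzero : ∀ᵐ z : Space d × Space d, (z.1 ∉ Ω → v z.1 = 0) ∧ (z.2 ∉ Ω → v z.2 = 0) :=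
    (Measure.quasiMeasurePreserving_fst.ae hv0).and (Measure.quasiMeasurePreserving_snd.ae hv0)
  have hpt : ∀ᵐ z : Space d × Space d,
      ‖(nearPairs R lam)ᶜ.indicator (fun z => nonlocalDensity α v w z.1 z.2) z‖ₑ
        ≤ 2 * (K (z.1 - z.2) * ENNReal.ofReal (h z.1))
          + 2 * (K (z.1 - z.2) * ENNReal.ofReal (h z.2)) := by
    filter_upwards [hzero] with z hz
    by_cases hzS : z ∈ (nearPairs R lam)ᶜ
    swap
    · rw [indicator_of_notMem hzS]; simp
    rw [indicator_of_mem hzS]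
    by_cases hfar : lam < ‖z.1 - z.2‖
    · have h1 := abs_nonlocalDensity_le (α := α) v w ht0 z.1 z.2
      have h2 : |nonlocalDensity α v w z.1 z.2| ≤ 2 * (1 / ‖z.1 - z.2‖ ^ ((d : ℝ) + 2 * α) * h z.1)
          + 2 * (1 / ‖z.1 - z.2‖ ^ ((d : ℝ) + 2 * α) * h z.2) := by
        refine h1.trans ?_
        have e : 2 * (1 / ‖z.1 - z.2‖ ^ ((d : ℝ) + 2 * α) * h z.1)
          + 2 * (1 / ‖z.1 - z.2‖ ^ ((d : ℝ) + 2 * α) * h z.2)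
            = (2 * h z.1 + 2 * h z.2) / ‖z.1 - z.2‖ ^ ((d : ℝ) + 2 * α) := by ring
        rw [e]
        refine div_le_div_of_nonneg_right ?_ (by positivity)
        have q : ∀ f : Space d → Space d, ‖f z.1 - f z.2‖ ^ 2
            ≤ 2 * ‖f z.1‖ ^ 2 + 2 * ‖f z.2‖ ^ 2 := fun f => by
          have h2 := norm_sub_le (f z.1) (f z.2)
          have h3 : ‖f z.1 - f z.2‖ ^ 2 ≤ (‖f z.1‖ + ‖f z.2‖) ^ 2 := by gcongr
          nlinarith [sq_nonneg (‖f z.1‖ - ‖f z.2‖)]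
        calc t * ‖v z.1 - v z.2‖ ^ 2 + t⁻¹ * ‖w z.1 - w z.2‖ ^ 2
            ≤ t * (2 * ‖v z.1‖ ^ 2 + 2 * ‖v z.2‖ ^ 2)
              + t⁻¹ * (2 * ‖w z.1‖ ^ 2 + 2 * ‖w z.2‖ ^ 2) := by
              gcongr
              · exact q v
              · exact q w
          _ = 2 * h z.1 + 2 * h z.2 := by simp only [hh]; ring
      rw [← ofReal_norm, Real.norm_eq_abs]
      refine (ENNReal.ofReal_le_ofReal h2).trans ?_
      rw [ENNReal.ofReal_add (by have := hh0 z.1; positivity) (by have := hh0 z.2; positivity),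
        ENNReal.ofReal_mul zero_le_two, ENNReal.ofReal_mul zero_le_two,
        ENNReal.ofReal_mul (by positivity), ENNReal.ofReal_mul (by positivity)]
      simp only [hK, if_pos hfar]
      simp
    · -- here neither point lies in `Ω`, so the density vanishes
      have hle : ‖z.1 - z.2‖ ≤ lam := not_lt.1 hfar
      have hz1 : z.1 ∉ Ω := fun h1 =>
        hzS ⟨Or.inl h1, mem_union_interactionDomain h1 hle, hle⟩
      have hz2 : z.2 ∉ Ω := fun h1 =>
        hzS ⟨mem_union_interactionDomain h1 (by rwa [norm_sub_rev]), Or.inl h1, hle⟩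
      simp [nonlocalDensity, hz.1 hz1, hz.2 hz2]
  have hI : ∫⁻ x, ENNReal.ofReal (h x) = ENNReal.ofReal (∫ x, h x) :=
    (ofReal_integral_eq_lintegral_ofReal hhi (ae_of_all _ hh0)).symm
  have hKK : ∫⁻ z, K z ≤ ENNReal.ofReal (κ * t) := hκ lam hlam
  have hKsub : Measurable fun z : Space d × Space d => K (z.1 - z.2) :=
    hKm.comp (measurable_fst.sub measurable_snd)
  have hm1 : AEMeasurable (fun z : Space d × Space d => K (z.1 - z.2) * ENNReal.ofReal (h z.1))
      volume := hKsub.aemeasurable.mul hhm.comp_fst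
  have hm2 : AEMeasurable (fun z : Space d × Space d => K (z.1 - z.2) * ENNReal.ofReal (h z.2))
      volume := hKsub.aemeasurable.mul hhm.comp_snd
  have hA : ∫⁻ z : Space d × Space d, K (z.1 - z.2) * ENNReal.ofReal (h z.1)
      = (∫⁻ z, K z) * ∫⁻ x, ENNReal.ofReal (h x) := by
    rw [Measure.volume_eq_prod, lintegral_prod _ hm1,
      ← lintegral_const_mul'' _ hhm]
    refine lintegral_congr fun x => ?_
    simp only
    rw [lintegral_mul_const (f := fun y => K (x - y)) _
        (hKm.comp (measurable_const.sub measurable_id)),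
      lintegral_sub_left_eq_self K x]
  have hB : ∫⁻ z : Space d × Space d, K (z.1 - z.2) * ENNReal.ofReal (h z.2)
      = (∫⁻ z, K z) * ∫⁻ x, ENNReal.ofReal (h x) := by
    rw [Measure.volume_eq_prod, lintegral_prod_symm _ hm2,
      ← lintegral_const_mul'' _ hhm]
    refine lintegral_congr fun x => ?_
    simp only
    rw [lintegral_mul_const (f := fun y => K (y - x)) _
        (hKm.comp (measurable_id.sub measurable_const)),
      lintegral_sub_right_eq_self K x]
  have hfin : ‖∫ z : Space d × Space d,
      (nearPairs R lam)ᶜ.indicator (fun z => nonlocalDensity α v w z.1 z.2) z‖ₑ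
      ≤ ENNReal.ofReal (4 * (κ * t * ∫ x, h x)) := by
    refine (enorm_integral_le_lintegral_enorm _).trans ((lintegral_mono_ae hpt).trans ?_)
    rw [lintegral_add_left' (hm1.const_mul 2), lintegral_const_mul'' _ hm1,
      lintegral_const_mul'' _ hm2, hA, hB, hI, ← two_mul,
      ← mul_assoc, ENNReal.ofReal_mul (by norm_num), ENNReal.ofReal_mul (by positivity)]
    gcongr
    norm_num
  have hh1 : 0 ≤ ∫ x, h x := integral_nonneg hh0
  rw [← ofReal_norm, ENNReal.ofReal_le_ofReal_iff (by positivity), Real.norm_eq_abs] at hfin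
  refine hfin.trans (le_of_eq ?_)
  have e : ∫ x, h x = t * (∫ x, ‖v x‖ ^ 2) + t⁻¹ * ∫ x, ‖w x‖ ^ 2 := by
    rw [hh, integral_add ((hv2.integrable_norm_pow two_ne_zero).const_mul t)
      ((hw2.integrable_norm_pow two_ne_zero).const_mul t⁻¹), integral_const_mul,
      integral_const_mul]
  rw [e]
  field_simp

/-! ### An energy inequality for weakly differentiable curves -/

lemma ofReal_integral_le_lintegral {X : Type*} [MeasurableSpace X] {m : Measure X} {f : X → ℝ}
    (hf : Integrable f m) : ENNReal.ofReal (∫ x, f x ∂m) ≤ ∫⁻ x, ENNReal.ofReal (f x) ∂m := by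
  rw [integral_eq_lintegral_pos_part_sub_lintegral_neg_part hf]
  refine (ENNReal.ofReal_le_ofReal (sub_le_self _ ENNReal.toReal_nonneg)).trans ?_
  exact ENNReal.ofReal_toReal_le

/-- A continuous function whose increments over short intervals are nonpositive on average, up to
`o(h)`, does not increase. -/
lemma le_of_integral_increment_le {F : ℝ → ℝ} (hF : Continuous F) {τ : ℝ}
    (h : ∀ ε : ℝ, 0 < ε → ∀ᶠ h in 𝓝[>] (0 : ℝ),
      ∫ t in (0 : ℝ)..(τ - h), (F (t + h) - F t) ≤ h * ε) : F τ ≤ F 0 := by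
  have hi : ∀ a b, IntervalIntegrable F volume a b := fun a b => hF.intervalIntegrable a b
  have hd0 : HasDerivAt (fun x => ∫ t in (0 : ℝ)..x, F t) (F 0) 0 :=
    intervalIntegral.integral_hasDerivAt_right (hi _ _)
      (hF.stronglyMeasurableAtFilter _ _) hF.continuousAt
  have hdτ : HasDerivAt (fun x => ∫ t in (0 : ℝ)..x, F t) (F τ) τ :=
    intervalIntegral.integral_hasDerivAt_right (hi _ _)
      (hF.stronglyMeasurableAtFilter _ _) hF.continuousAt
  have h1 : Tendsto (fun h : ℝ => h⁻¹ * ∫ t in (0 : ℝ)..h, F t) (𝓝[>] 0) (𝓝 (F 0)) := by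
    have := hd0.tendsto_slope_zero_right
    simpa using this
  have h2 : Tendsto (fun h : ℝ => h⁻¹ * ∫ t in (τ - h)..τ, F t) (𝓝[>] 0) (𝓝 (F τ)) := by
    have h3 := hdτ.tendsto_slope_zero_left
    have h4 : Tendsto (fun h : ℝ => -h) (𝓝[>] 0) (𝓝[<] 0) := by
      have := tendsto_neg_nhdsGT (a := (0 : ℝ))
      simpa using this
    refine (h3.comp h4).congr fun h => ?_
    simp only [Function.comp, smul_eq_mul]
    rw [intervalIntegral.integral_interval_sub_left (hi _ _) (hi _ _),
      intervalIntegral.integral_symm, ← sub_eq_add_neg]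
    rw [inv_neg]
    ring
  have h3 : Tendsto (fun h : ℝ => h⁻¹ * ∫ t in (0 : ℝ)..(τ - h), (F (t + h) - F t)) (𝓝[>] 0)
      (𝓝 (F τ - F 0)) := by
    refine (h2.sub h1).congr fun h => ?_
    have hi' : IntervalIntegrable (fun t => F (t + h)) volume 0 (τ - h) :=
      (hF.comp (continuous_add_const h)).intervalIntegrable _ _
    rw [intervalIntegral.integral_sub hi' (hi _ _),
      intervalIntegral.integral_comp_add_right (fun t => F t) h, ← mul_sub]
    congr 1
    have b1 : ∫ t in (0 + h)..(τ - h + h), F t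
        = (∫ t in (0 : ℝ)..τ, F t) - ∫ t in (0 : ℝ)..h, F t := by
      rw [intervalIntegral.integral_interval_sub_left (hi _ _) (hi _ _)]
      simp
    have b2 : ∫ t in (τ - h)..τ, F t
        = (∫ t in (0 : ℝ)..τ, F t) - ∫ t in (0 : ℝ)..(τ - h), F t := by
      rw [intervalIntegral.integral_interval_sub_left (hi _ _) (hi _ _)]
    rw [b1, b2]
    ring
  by_contra! hlt
  have hev := h ((F τ - F 0) / 2) (by linarith)
  have hle : F τ - F 0 ≤ (F τ - F 0) / 2 := by
    refine le_of_tendsto h3 ?_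
    filter_upwards [hev, self_mem_nhdsWithin] with h hh hpos
    have hpos' : (0 : ℝ) < h := hpos
    rw [inv_mul_le_iff₀ hpos']
    exact hh
  linarith

/-- The squared `L²` distance of the time slices of a family of space-time fields. -/
def sliceDistSq (γ : Fin d → ℝ × Space d → Space d) (t s : ℝ) : ℝ≥0∞ :=
  ∑ j : Fin d, ∫⁻ x, ‖γ j (t, x) - γ j (s, x)‖ₑ ^ 2

lemma sliceDistSq_comm (γ : Fin d → ℝ × Space d → Space d) (t s : ℝ) :
    sliceDistSq γ t s = sliceDistSq γ s t := by
  simp only [sliceDistSq]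
  refine Finset.sum_congr rfl fun j _ => lintegral_congr fun x => ?_
  rw [← edist_eq_enorm_sub, edist_comm, edist_eq_enorm_sub]

lemma measurable_sliceDistSq {γ : Fin d → ℝ × Space d → Space d}
    (hγ : ∀ j, StronglyMeasurable (γ j)) :
    Measurable fun z : ℝ × ℝ => sliceDistSq γ z.1 z.2 := by
  refine Finset.measurable_fun_sum _ fun j _ => ?_
  have hm : Measurable fun q : (ℝ × ℝ) × Space d =>
      ‖γ j (q.1.1, q.2) - γ j (q.1.2, q.2)‖ₑ ^ 2 := by
    refine Measurable.pow_const (StronglyMeasurable.enorm (StronglyMeasurable.sub ?_ ?_)) 2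
    · exact (hγ j).comp_measurable (by fun_prop)
    · exact (hγ j).comp_measurable (by fun_prop)
  exact hm.lintegral_prod_right'

/-- Small time shifts of square-integrable fields are small on average. -/
lemma eventually_lintegral_sliceDistSq_le {γ : Fin d → ℝ × Space d → Space d}
    (hγ : ∀ j, StronglyMeasurable (γ j)) (hγ2 : ∀ j, MemLp (γ j) 2 volume) {ε : ℝ≥0∞}
    (hε : 0 < ε) : ∀ᶠ h in 𝓝[>] (0 : ℝ), ∀ σ ∈ Ioc 0 h,
      ∫⁻ t, sliceDistSq γ t (t + σ) ≤ ε := by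
  have h1 : Tendsto (fun σ : ℝ => ∑ j : Fin d,
      (eLpNorm (fun z : ℝ × Space d => γ j (z + (σ, 0)) - γ j z) 2 volume) ^ 2) (𝓝 0) (𝓝 0) := by
    have h0 : Tendsto (fun σ : ℝ => ((σ, 0) : ℝ × Space d)) (𝓝 0) (𝓝 0) := by
      have : Continuous fun σ : ℝ => ((σ, 0) : ℝ × Space d) := by fun_prop
      exact this.tendsto 0
    have : (0 : ℝ≥0∞) = ∑ j : Fin d, 0 ^ 2 := by simp
    rw [this]
    have hH : (volume : Measure (ℝ × Space d)).IsAddHaarMeasure := by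
      rw [Measure.volume_eq_prod]; infer_instance
    refine tendsto_finsetSum _ fun j _ => ENNReal.Tendsto.pow ?_
    exact (tendsto_eLpNorm_translate_sub (hγ2 j)).comp h0
  have h2 : ∀ σ : ℝ, ∫⁻ t, sliceDistSq γ t (t + σ) = ∑ j : Fin d,
      (eLpNorm (fun z : ℝ × Space d => γ j (z + (σ, 0)) - γ j z) 2 volume) ^ 2 := fun σ => by
    simp only [sliceDistSq]
    have hm : ∀ j, Measurable fun q : ℝ × Space d =>
        ‖γ j (q.1, q.2) - γ j (q.1 + σ, q.2)‖ₑ ^ 2 := fun j => by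
      refine Measurable.pow_const (StronglyMeasurable.enorm (StronglyMeasurable.sub ?_ ?_)) 2
      · exact (hγ j).comp_measurable (by fun_prop)
      · exact (hγ j).comp_measurable (by fun_prop)
    rw [lintegral_finsetSum _ fun j _ => (hm j).lintegral_prod_right']
    refine Finset.sum_congr rfl fun j _ => ?_
    rw [eLpNorm_two_sq, Measure.volume_eq_prod, lintegral_prod]
    · refine lintegral_congr fun t => lintegral_congr fun x => ?_
      rw [← edist_eq_enorm_sub, edist_comm, edist_eq_enorm_sub]
      simp
    · refine (Measurable.pow_const (StronglyMeasurable.enorm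
        (StronglyMeasurable.sub ?_ (hγ j))) 2).aemeasurable
      exact (hγ j).comp_measurable (by fun_prop)
  have h3 := (ENNReal.tendsto_nhds_zero.1 h1) ε hε
  obtain ⟨δ, hδ, hb⟩ := Metric.eventually_nhds_iff_ball.1 h3
  filter_upwards [Ioo_mem_nhdsGT hδ] with h hh σ hσ
  rw [h2]
  refine hb σ ?_
  rw [mem_ball_zero_iff, Real.norm_of_nonneg hσ.1.le]
  exact hσ.2.trans_lt hh.2

lemma lintegral_Ioc_add {f : ℝ → ℝ≥0∞} (t h : ℝ) :
    ∫⁻ s in Ioc t (t + h), f s = ∫⁻ σ in Ioc 0 h, f (t + σ) := by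
  rw [← lintegral_indicator measurableSet_Ioc, ← lintegral_indicator measurableSet_Ioc,
    ← lintegral_add_left_eq_self _ t]
  refine lintegral_congr fun σ => ?_
  simp only [indicator, mem_Ioc]
  congr 1
  simp

/-- The slice distances from the ends of the windows `(t, t + h]`, integrated over all windows, are
of order `h` times the bound for time shifts of length at most `h`. -/
lemma lintegral_sliceDistSq_window_le {γ : Fin d → ℝ × Space d → Space d}
    (hγ : ∀ j, StronglyMeasurable (γ j)) {ε : ℝ≥0∞} {h : ℝ}
    (hε : ∀ σ ∈ Ioc 0 h, ∫⁻ t, sliceDistSq γ t (t + σ) ≤ ε) :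
    ∫⁻ t, ∫⁻ s in Ioc t (t + h), sliceDistSq γ t s + sliceDistSq γ (t + h) s
      ≤ 2 * (ENNReal.ofReal h * ε) := by
  have hm := measurable_sliceDistSq hγ
  have hcomm := sliceDistSq_comm γ
  generalize sliceDistSq γ = S at hm hcomm hε ⊢
  simp_rw [lintegral_Ioc_add]
  have hm1 : Measurable fun q : ℝ × ℝ => S q.1 (q.1 + q.2) :=
    hm.comp (g := fun z : ℝ × ℝ => S z.1 z.2)
      (f := fun q : ℝ × ℝ => (q.1, q.1 + q.2)) (by fun_prop)
  have hm2 : Measurable fun q : ℝ × ℝ => S (q.1 + h) (q.1 + q.2) :=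
    hm.comp (g := fun z : ℝ × ℝ => S z.1 z.2)
      (f := fun q : ℝ × ℝ => (q.1 + h, q.1 + q.2)) (by fun_prop)
  rw [lintegral_lintegral_swap (hm1.add hm2).aemeasurable]
  have key : ∀ σ ∈ Ioo 0 h, ∫⁻ t, (S t (t + σ) + S (t + h) (t + σ))
      ≤ 2 * ε := fun σ hσ => by
    have hm1σ : Measurable fun t : ℝ => S t (t + σ) :=
      hm1.comp (by fun_prop : Measurable fun t : ℝ => (t, σ))
    rw [lintegral_add_left hm1σ, two_mul]
    refine add_le_add (hε σ ⟨hσ.1, hσ.2.le⟩) ?_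
    have := lintegral_add_right_eq_self (μ := (volume : Measure ℝ))
      (fun t => S t (t + (h - σ))) σ
    have e : ∀ t, S (t + h) (t + σ) = S (t + σ) (t + σ + (h - σ)) :=
      fun t => by
        rw [hcomm, show t + σ + (h - σ) = t + h by ring]
    simp_rw [e]
    rw [this]
    exact hε _ ⟨by linarith [hσ.2], by linarith [hσ.1]⟩
  calc ∫⁻ σ in Ioc 0 h, ∫⁻ t, (S t (t + σ) + S (t + h) (t + σ))
      ≤ ∫⁻ σ in Ioc 0 h, 2 * ε := by
        rw [← restrict_Ioo_eq_restrict_Ioc]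
        exact setLIntegral_mono' measurableSet_Ioo key
    _ = 2 * (ENNReal.ofReal h * ε) := by
        rw [setLIntegral_const, Real.volume_Ioc, sub_zero]
        ring

/-- The energy inequality: if the increments `E r - E t` are integrals of functions that are
bounded by `Ψ` up to an error controlled by the `L²` distances of the gradients at the times `t`,
`r` and the integration time, then `E' ≤ Ψ` in integrated form. The errors are averaged out by the
continuity of translations in `L²`. -/
lemma energy_le_of_increments {T : ℝ} (hT : 0 < T) {E Ψ κ : ℝ → ℝ}
    (hE : ContinuousOn E (Icc 0 T)) (hΨ : IntegrableOn Ψ (Ioo 0 T))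
    (hκ : MemLp κ 2 (timeMeasure T)) {γ : Fin d → ℝ × Space d → Space d}
    (hγ : ∀ j, StronglyMeasurable (γ j)) (hγ2 : ∀ j, MemLp (γ j) 2 volume) {P : ℝ → Prop}
    (hP : ∀ᵐ t ∂(timeMeasure T), P t)
    (hinc : ∀ t ∈ Ioo 0 T, ∀ r ∈ Ioo 0 T, t < r → P t → P r → ∃ f : ℝ → ℝ,
      IntegrableOn f (Ioc t r) ∧ E r - E t = ∫ s in Ioc t r, f s ∧
      ∀ᵐ s ∂(volume.restrict (Ioc t r)), f s ≤ Ψ s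
        + κ s * Real.sqrt (2 * sliceDistSq γ t s + 2 * sliceDistSq γ r s).toReal)
    {τ : ℝ} (hτ : τ ∈ Icc 0 T) : E τ ≤ E 0 + ∫ s in (0 : ℝ)..τ, Ψ s := by
  rcases eq_or_lt_of_le hτ.1 with h0 | hτ0
  · simp [← h0]
  -- it suffices to allow an error `δ κ²`
  suffices H : ∀ δ : ℝ, 0 < δ →
      E τ ≤ E 0 + (∫ s in (0 : ℝ)..τ, Ψ s) + δ * ∫ s in (0 : ℝ)..τ, κ s ^ 2 by
    have hlim : Tendsto (fun δ : ℝ => E 0 + (∫ s in (0 : ℝ)..τ, Ψ s)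
        + δ * ∫ s in (0 : ℝ)..τ, κ s ^ 2) (𝓝[>] 0)
        (𝓝 (E 0 + (∫ s in (0 : ℝ)..τ, Ψ s) + 0 * ∫ s in (0 : ℝ)..τ, κ s ^ 2)) :=
      ((tendsto_id.mul_const _).const_add _).mono_left nhdsWithin_le_nhds
    rw [zero_mul, add_zero] at hlim
    exact ge_of_tendsto hlim (eventually_mem_nhdsWithin.mono fun δ hδ => H δ hδ)
  intro δ hδ
  have hκ2 : IntegrableOn (fun s => κ s ^ 2) (Ioo 0 T) := hκ.integrable_sq
  set Θ : ℝ → ℝ := (Ioo 0 T).indicator (fun s => Ψ s + δ * κ s ^ 2) with hΘ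
  have hΘi : Integrable Θ := (integrable_indicator_iff measurableSet_Ioo).2
    (hΨ.add (hκ2.const_mul δ))
  -- the claim is that `F` does not increase
  set F : ℝ → ℝ := fun t => IccExtend hT.le ((Icc 0 T).domRestrict E) t - ∫ s in (0 : ℝ)..t, Θ s
    with hF
  have hFc : Continuous F := by
    refine Continuous.sub ?_ ?_
    · exact (continuousOn_iff_continuous_domRestrict.1 hE).Icc_extend'
    · exact intervalIntegral.continuous_primitive (fun a b => hΘi.intervalIntegrable) 0
  have hFE : ∀ t ∈ Icc 0 T, F t = E t - ∫ s in (0 : ℝ)..t, Θ s := fun t ht => by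
    simp only [hF]
    rw [IccExtend_of_mem _ _ ht]
    rfl
  have hΘint : ∀ t ∈ Icc 0 T, ∫ s in (0 : ℝ)..t, Θ s
      = (∫ s in (0 : ℝ)..t, Ψ s) + δ * ∫ s in (0 : ℝ)..t, κ s ^ 2 := fun t ht => by
    have hsub : Ioo 0 t ⊆ Ioo 0 T := Ioo_subset_Ioo_right ht.2
    have hδκ : IntegrableOn (fun s => δ * κ s ^ 2) (Ioo 0 T) := hκ2.const_mul δ
    rw [← intervalIntegral.integral_const_mul, intervalIntegral.integral_of_le ht.1,
      intervalIntegral.integral_of_le ht.1, intervalIntegral.integral_of_le ht.1,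
      integral_Ioc_eq_integral_Ioo, integral_Ioc_eq_integral_Ioo, integral_Ioc_eq_integral_Ioo,
      ← integral_add (hΨ.mono_set hsub) (hδκ.mono_set hsub)]
    exact setIntegral_congr_fun measurableSet_Ioo fun s hs => indicator_of_mem (hsub hs) _
  have hP' : ∀ᵐ t : ℝ, t ∈ Ioo 0 T → P t := (ae_restrict_iff' measurableSet_Ioo).1 hP
  have key : F τ ≤ F 0 := by
    refine le_of_integral_increment_le hFc fun ε hε => ?_
    have hε' : (0 : ℝ≥0∞) < ENNReal.ofReal (δ * ε) := by
      rw [ENNReal.ofReal_pos]; positivity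
    filter_upwards [eventually_lintegral_sliceDistSq_le hγ hγ2 hε', Ioo_mem_nhdsGT hτ0]
      with h hh hhτ
    have hwin := lintegral_sliceDistSq_window_le hγ hh
    have hPh : ∀ᵐ t : ℝ, t + h ∈ Ioo 0 T → P (t + h) :=
      (measurePreserving_add_right (volume : Measure ℝ) h).quasiMeasurePreserving.ae hP'
    have hpt : ∀ᵐ t ∂(volume.restrict (Ioo 0 (τ - h))), ENNReal.ofReal (F (t + h) - F t)
        ≤ ENNReal.ofReal (1 / (2 * δ)) *
          ∫⁻ s in Ioc t (t + h), sliceDistSq γ t s + sliceDistSq γ (t + h) s := by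
      rw [ae_restrict_iff' measurableSet_Ioo]
      filter_upwards [hP', hPh] with t h1 h2 ht
      have htT : t ∈ Ioo 0 T := ⟨ht.1, by linarith [ht.2, hτ.2, hhτ.1]⟩
      have hthT : t + h ∈ Ioo 0 T := by
        refine ⟨by linarith [ht.1, hhτ.1], ?_⟩
        linarith [ht.2, hτ.2]
      obtain ⟨f, hf, hEf, hfle⟩ := hinc t htT (t + h) hthT (by linarith [hhτ.1]) (h1 htT)
        (h2 hthT)
      have hFinc : F (t + h) - F t = ∫ s in Ioc t (t + h), (f s - Θ s) := by
        rw [hFE _ ⟨htT.1.le, htT.2.le⟩, hFE _ ⟨hthT.1.le, hthT.2.le⟩,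
          integral_sub hf hΘi.integrableOn, ← hEf,
          ← intervalIntegral.integral_of_le (by linarith [hhτ.1] : t ≤ t + h),
          ← intervalIntegral.integral_interval_sub_left (a := 0) (b := t + h)
            (c := t) hΘi.intervalIntegrable
            hΘi.intervalIntegrable]
        ring
      rw [hFinc, ← lintegral_const_mul' _ _ ENNReal.ofReal_ne_top]
      refine (ofReal_integral_le_lintegral (hf.sub hΘi.integrableOn)).trans
        (lintegral_mono_ae ?_)
      filter_upwards [hfle, ae_restrict_mem measurableSet_Ioc] with s hs hsI
      have hsT : s ∈ Ioo 0 T := ⟨htT.1.trans hsI.1, hsI.2.trans_lt hthT.2⟩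
      have hΘs : Θ s = Ψ s + δ * κ s ^ 2 := indicator_of_mem hsT _
      set y := 2 * sliceDistSq γ t s + 2 * sliceDistSq γ (t + h) s with hy
      -- Young's inequality with weight `δ`; the term `δ κ²` is part of `Θ`
      have hyoung : κ s * Real.sqrt y.toReal ≤ δ * κ s ^ 2 + 1 / (4 * δ) * y.toReal := by
        have e1 : Real.sqrt y.toReal ^ 2 = y.toReal := Real.sq_sqrt ENNReal.toReal_nonneg
        have e2 : 0 ≤ δ * (κ s - 1 / (2 * δ) * Real.sqrt y.toReal) ^ 2 := by positivity
        have e3 : δ * (κ s - 1 / (2 * δ) * Real.sqrt y.toReal) ^ 2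
            = δ * κ s ^ 2 - κ s * Real.sqrt y.toReal
              + 1 / (4 * δ) * Real.sqrt y.toReal ^ 2 := by
          field_simp
          ring
        rw [e3, e1] at e2
        linarith
      calc ENNReal.ofReal (f s - Θ s) ≤ ENNReal.ofReal (1 / (4 * δ) * y.toReal) := by
            refine ENNReal.ofReal_le_ofReal ?_
            rw [hΘs]
            linarith
        _ ≤ ENNReal.ofReal (1 / (4 * δ)) * y := by
            rw [ENNReal.ofReal_mul (by positivity)]
            gcongr
            exact ENNReal.ofReal_toReal_le
        _ = ENNReal.ofReal (1 / (2 * δ)) * (sliceDistSq γ t s + sliceDistSq γ (t + h) s) := by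
            rw [hy, ← mul_add, ← mul_assoc, show (2 : ℝ≥0∞) = ENNReal.ofReal 2 by simp,
              ← ENNReal.ofReal_mul (by positivity)]
            congr 2
            field_simp
            norm_num
    have hcont : Continuous fun t => F (t + h) - F t :=
      (hFc.comp (continuous_add_const h)).sub hFc
    have hτh : (0 : ℝ) ≤ τ - h := by linarith [hhτ.2]
    have hfinal : ENNReal.ofReal (∫ t in (0 : ℝ)..(τ - h), (F (t + h) - F t))
        ≤ ENNReal.ofReal (h * ε) := by
      rw [intervalIntegral.integral_of_le hτh, integral_Ioc_eq_integral_Ioo]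
      refine (ofReal_integral_le_lintegral ?_).trans ((lintegral_mono_ae hpt).trans ?_)
      · exact (hcont.integrableOn_Icc).mono_set Ioo_subset_Icc_self
      · rw [lintegral_const_mul' _ _ ENNReal.ofReal_ne_top]
        calc _ ≤ ENNReal.ofReal (1 / (2 * δ)) *
              (2 * (ENNReal.ofReal h * ENNReal.ofReal (δ * ε))) := by
              gcongr
              exact (setLIntegral_le_lintegral _ _).trans hwin
          _ = ENNReal.ofReal (h * ε) := by
              have hh0 : 0 < h := hhτ.1
              rw [show (2 : ℝ≥0∞) = ENNReal.ofReal 2 by simp, ← ENNReal.ofReal_mul hh0.le,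
                ← ENNReal.ofReal_mul (by positivity), ← ENNReal.ofReal_mul (by positivity)]
              congr 1
              field_simp
    exact (ENNReal.ofReal_le_ofReal_iff (mul_nonneg hhτ.1.le hε.le)).1 hfinal
  rw [hFE _ hτ, hFE 0 ⟨le_rfl, hT.le⟩, hΘint _ hτ, intervalIntegral.integral_same] at key
  linarith

/-! ### The nonlocal energy of `H¹` fields and the velocity spaces -/

/-- `H¹(ℝ^d)` embeds continuously into `H^α(ℝ^d)`: near the diagonal the nonlocal energy is bounded
by the gradient, away from it by the `L²` norm. -/
lemma exists_nonlocal_energy_le (hd : 0 < d) {α : ℝ} (hα : α ∈ Ioo (0 : ℝ) 1) :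
    ∃ A : ℝ≥0∞, A ≠ ⊤ ∧ ∀ (s : Set (Space d)) (v : Space d → Space d)
      (g : Fin d → Space d → Space d), IsH10 s v g →
      ∫⁻ z : Space d × Space d,
          ENNReal.ofReal (‖v z.1 - v z.2‖ ^ 2 / ‖z.1 - z.2‖ ^ ((d : ℝ) + 2 * α))
        ≤ A * ((∑ j : Fin d, eLpNorm (g j) 2 volume) ^ 2 + eLpNorm v 2 volume ^ 2) := by
  obtain ⟨κ, -, hκ⟩ := exists_lintegral_far_kernel_le hd hα
  set p : ℝ := (d : ℝ) + 2 * α with hp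
  set B := ∫⁻ z in Metric.ball (0 : Space d) 2, ENNReal.ofReal (‖z‖ ^ 2 / ‖z‖ ^ p) with hB
  set K : Space d → ℝ≥0∞ := fun z => if 1 < ‖z‖ then ENNReal.ofReal (1 / ‖z‖ ^ p) else 0 with hK
  have hKm : Measurable K := Measurable.ite (measurableSet_lt measurable_const measurable_norm)
    ((measurable_const.div (measurable_norm.pow_const _)).ennreal_ofReal) measurable_const
  have hKfin : ∫⁻ z, K z ≠ ⊤ := ((hκ 1 one_pos).trans_lt ENNReal.ofReal_lt_top).ne
  have hBfin : B ≠ ⊤ := (lintegral_near_kernel_lt_top hd hα two_pos).ne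
  refine ⟨B + 4 * ∫⁻ z, K z, ENNReal.add_ne_top.2 ⟨hBfin, ENNReal.mul_ne_top (by simp) hKfin⟩,
    fun s v g h => ?_⟩
  wlog hm : StronglyMeasurable v generalizing v with H
  · have hae := h.memLp.1.ae_eq_mk
    have h' : IsH10 s (h.memLp.1.mk v) g := by
      refine ⟨h.memLp.ae_eq hae, h.grad_memLp, fun j => (h.weak j).congr (by simpa using hae)
        (by simp), ?_⟩
      filter_upwards [h.zero, hae] with x h1 h2 hx
      rw [← h2, h1 hx]
    have := H _ h' h.memLp.1.stronglyMeasurable_mk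
    rw [eLpNorm_congr_ae hae]
    refine le_of_eq_of_le (lintegral_congr_ae ?_) this
    filter_upwards [Measure.quasiMeasurePreserving_fst.ae hae,
      Measure.quasiMeasurePreserving_snd.ae hae] with z h1 h2
    rw [h1, h2]
  have hvm : Measurable fun x => ‖v x‖ₑ ^ 2 := hm.enorm.pow_const 2
  have hnear := h.lintegral_near_le hm p 2
  have hN : Measurable fun z : Space d × Space d => if ‖z.1 - z.2‖ < 2 then
      ENNReal.ofReal (1 / ‖z.1 - z.2‖ ^ p) * ‖v z.1 - v z.2‖ₑ ^ 2 else 0 := by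
    refine Measurable.ite (measurableSet_lt (by fun_prop) measurable_const) ?_ measurable_const
    refine ((measurable_const.div (measurable_norm_sub_rpow p)).ennreal_ofReal).mul ?_
    refine Measurable.pow_const (StronglyMeasurable.enorm (StronglyMeasurable.sub ?_ ?_)) 2
    · exact hm.comp_measurable measurable_fst
    · exact hm.comp_measurable measurable_snd
  have hKsub : Measurable fun z : Space d × Space d => K (z.1 - z.2) :=
    hKm.comp (measurable_fst.sub measurable_snd)
  have hm1 : Measurable fun z : Space d × Space d => K (z.1 - z.2) * ‖v z.1‖ₑ ^ 2 :=
    hKsub.mul (hvm.comp measurable_fst)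
  have hm2 : Measurable fun z : Space d × Space d => K (z.1 - z.2) * ‖v z.2‖ₑ ^ 2 :=
    hKsub.mul (hvm.comp measurable_snd)
  have hpt : ∀ z : Space d × Space d, ENNReal.ofReal (‖v z.1 - v z.2‖ ^ 2 / ‖z.1 - z.2‖ ^ p)
      ≤ (if ‖z.1 - z.2‖ < 2 then
          ENNReal.ofReal (1 / ‖z.1 - z.2‖ ^ p) * ‖v z.1 - v z.2‖ₑ ^ 2 else 0)
        + (2 * (K (z.1 - z.2) * ‖v z.1‖ₑ ^ 2) + 2 * (K (z.1 - z.2) * ‖v z.2‖ₑ ^ 2)) := by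
    intro z
    have e : ENNReal.ofReal (‖v z.1 - v z.2‖ ^ 2 / ‖z.1 - z.2‖ ^ p)
        = ENNReal.ofReal (1 / ‖z.1 - z.2‖ ^ p) * ‖v z.1 - v z.2‖ₑ ^ 2 := by
      rw [div_eq_mul_one_div, mul_comm, ENNReal.ofReal_mul (by positivity), ← ofReal_norm,
        ENNReal.ofReal_pow (norm_nonneg _)]
    rw [e]
    by_cases hz : ‖z.1 - z.2‖ < 2
    · rw [if_pos hz]
      exact le_self_add
    · have hz1 : 1 < ‖z.1 - z.2‖ := by linarith [not_lt.1 hz]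
      rw [if_neg hz, zero_add]
      simp only [hK, if_pos hz1]
      have q : ‖v z.1 - v z.2‖ₑ ^ 2 ≤ 2 * ‖v z.1‖ₑ ^ 2 + 2 * ‖v z.2‖ₑ ^ 2 := by
        simp only [← ofReal_norm, ← ENNReal.ofReal_pow (norm_nonneg _)]
        have e2 : ∀ r : ℝ, 2 * ENNReal.ofReal r = ENNReal.ofReal (2 * r) := fun r => by
          rw [ENNReal.ofReal_mul zero_le_two, ENNReal.ofReal_ofNat]
        rw [e2, e2, ← ENNReal.ofReal_add (by positivity) (by positivity)]
        refine ENNReal.ofReal_le_ofReal ?_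
        have h2 := norm_sub_le (v z.1) (v z.2)
        have h3 : ‖v z.1 - v z.2‖ ^ 2 ≤ (‖v z.1‖ + ‖v z.2‖) ^ 2 := by gcongr
        nlinarith [sq_nonneg (‖v z.1‖ - ‖v z.2‖)]
      calc _ ≤ ENNReal.ofReal (1 / ‖z.1 - z.2‖ ^ p) * (2 * ‖v z.1‖ₑ ^ 2 + 2 * ‖v z.2‖ₑ ^ 2) := by
            gcongr
        _ = _ := by ring
  have hA : ∫⁻ z : Space d × Space d, K (z.1 - z.2) * ‖v z.1‖ₑ ^ 2
      = (∫⁻ z, K z) * eLpNorm v 2 volume ^ 2 := by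
    rw [Measure.volume_eq_prod, lintegral_prod _ hm1.aemeasurable, eLpNorm_two_sq,
      ← lintegral_const_mul _ hvm]
    refine lintegral_congr fun x => ?_
    have hx : Measurable fun y : Space d => K (x - y) :=
      hKm.comp (g := K) (f := fun y => x - y) (by fun_prop)
    rw [← lintegral_sub_left_eq_self K x, ← lintegral_mul_const _ hx]
  have hA' : ∫⁻ z : Space d × Space d, K (z.1 - z.2) * ‖v z.2‖ₑ ^ 2
      = (∫⁻ z, K z) * eLpNorm v 2 volume ^ 2 := by
    rw [Measure.volume_eq_prod, lintegral_prod_symm _ hm2.aemeasurable, eLpNorm_two_sq,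
      ← lintegral_const_mul _ hvm]
    refine lintegral_congr fun y => ?_
    have hy : Measurable fun x : Space d => K (x - y) :=
      hKm.comp (g := K) (f := fun x => x - y) (by fun_prop)
    rw [← lintegral_sub_right_eq_self K y, ← lintegral_mul_const _ hy]
  calc _ ≤ _ := lintegral_mono hpt
    _ ≤ B * (∑ j : Fin d, eLpNorm (g j) 2 volume) ^ 2
        + (2 * ((∫⁻ z, K z) * eLpNorm v 2 volume ^ 2)
          + 2 * ((∫⁻ z, K z) * eLpNorm v 2 volume ^ 2)) := by
        rw [lintegral_add_left hN, lintegral_add_left (hm1.const_mul 2),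
          lintegral_const_mul _ hm1, lintegral_const_mul _ hm2, hA, hA']
        gcongr
        rw [Measure.volume_eq_prod, lintegral_prod _ hN.aemeasurable]
        exact hnear
    _ = B * (∑ j : Fin d, eLpNorm (g j) 2 volume) ^ 2
        + 4 * (∫⁻ z, K z) * eLpNorm v 2 volume ^ 2 := by ring
    _ ≤ _ := by
        rw [mul_add]
        gcongr
        · exact le_self_add
        · exact le_add_self

lemma IsH10.memHFrac (hd : 0 < d) {α : ℝ} (hα : α ∈ Ioo (0 : ℝ) 1) {s : Set (Space d)}
    {v : Space d → Space d} {g : Fin d → Space d → Space d} (h : IsH10 s v g) :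
    MemHFrac univ α v := by
  obtain ⟨A, hA, hle⟩ := exists_nonlocal_energy_le hd hα
  refine ⟨by simpa using h.memLp, ?_⟩
  rw [Measure.restrict_univ]
  have hm : AEStronglyMeasurable (fun z : Space d × Space d =>
      ‖v z.1 - v z.2‖ ^ 2 / ‖z.1 - z.2‖ ^ ((d : ℝ) + 2 * α)) (volume.prod volume) := by
    have := aestronglyMeasurable_nonlocalDensity (α := α) h.memLp.1 h.memLp.1
    simpa [nonlocalDensity, real_inner_self_eq_norm_sq] using this
  refine ⟨hm, ?_⟩
  rw [hasFiniteIntegral_iff_ofReal (ae_of_all _ fun z => by positivity)]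
  refine (hle s v g h).trans_lt (ENNReal.mul_lt_top hA.lt_top (ENNReal.add_lt_top.2 ⟨?_, ?_⟩))
  · exact ENNReal.pow_lt_top (ENNReal.sum_lt_top.2 fun j _ => (h.grad_memLp j).2)
  · exact ENNReal.pow_lt_top h.memLp.2

/-- Both velocity spaces consist of the fields in `H¹(ℝ^d)` that vanish off `Ω`. -/
lemma mem_velocitySpace_iff (hd : 0 < d) {α : ℝ} (hα : α ∈ Ioo (0 : ℝ) 1) {Ω R : Set (Space d)}
    (hΩb : Bornology.IsBounded Ω) (hR : IsOpen R) (hΩR : closure Ω ⊆ R) {v : Space d → Space d} :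
    v ∈ velocitySpace Ω R α ↔ ∃ g, IsH10 Ω v g := by
  constructor
  · rintro ⟨-, h1, h0⟩
    exact h1.exists_isH10 hΩb hR hΩR h0
  · rintro ⟨g, h⟩
    have hf := h.memHFrac hd hα
    rw [MemHFrac, Measure.restrict_univ] at hf
    refine ⟨⟨h.memLp.restrict R, hf.2.mono_measure ?_⟩, ⟨h.memLp.restrict R, fun j =>
      ⟨g j, (h.grad_memLp j).restrict R, (h.weak j).mono (subset_univ R)⟩⟩, h.zero⟩
    exact Measure.prod_mono Measure.restrict_le_self Measure.restrict_le_self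

/-! ### The forms in terms of global weak gradients -/

lemma integrable_inner_of_memLp {X : Type*} [MeasurableSpace X] {m : Measure X}
    {f h : X → Space d} (hf : MemLp f 2 m) (hh : MemLp h 2 m) :
    Integrable (fun x => inner ℝ (f x) (h x)) m := by
  have hi : Integrable (fun x => ‖f x‖ * ‖h x‖) m := hf.norm.integrable_mul hh.norm
  refine hi.mono (hf.1.inner hh.1) (ae_of_all _ fun x => ?_)
  rw [Real.norm_of_nonneg (by positivity : 0 ≤ ‖f x‖ * ‖h x‖)]
  exact norm_inner_le_norm _ _

section Forms

variable {Ω : Set (Space d)} {v w : Space d → Space d} {g k : Fin d → Space d → Space d}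

lemma IsH10.normSq_eq (h : IsH10 Ω v g) : normSq Ω v = ∫ x, ‖v x‖ ^ 2 :=
  setIntegral_eq_integral_of_ae_compl_eq_zero (by
    filter_upwards [h.zero] with x hx hxΩ
    simp [hx hxΩ])

lemma IsH10.gradForm_eq (hΩ : IsOpen Ω) (hΩb : Bornology.IsBounded Ω) (h : IsH10 Ω v g)
    (h' : IsH10 Ω w k) :
    gradForm Ω v w = ∑ j : Fin d, ∫ x, inner ℝ (g j x) (k j x) := by
  have hi : ∀ j : Fin d, Integrable (fun x => inner ℝ (g j x) (k j x)) volume := fun j =>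
    integrable_inner_of_memLp (h.grad_memLp j) (h'.grad_memLp j)
  have hz : ∀ᵐ x, x ∉ Ω → ∑ j : Fin d, inner ℝ (g j x) (k j x) = 0 := by
    filter_upwards [eventually_countable_forall.2 fun j => h.grad_zero hΩb j] with x hx hxΩ
    simp [fun j => hx j hxΩ]
  rw [← integral_finsetSum _ fun j _ => hi j, gradForm,
    ← setIntegral_eq_integral_of_ae_compl_eq_zero hz]
  refine integral_congr_ae ?_
  filter_upwards [eventually_countable_forall.2 fun j => h.weakPartial_ae_eq hΩ j,
    eventually_countable_forall.2 fun j => h'.weakPartial_ae_eq hΩ j] with x h1 h2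
  simp only [h1, h2]

lemma gradNormSq_eq_gradForm (Ω : Set (Space d)) (v : Space d → Space d) :
    gradNormSq Ω v = gradForm Ω v v := by
  simp only [gradNormSq, gradForm, real_inner_self_eq_norm_sq]

lemma IsH10.gradNormSq_eq (hΩ : IsOpen Ω) (hΩb : Bornology.IsBounded Ω) (h : IsH10 Ω v g) :
    gradNormSq Ω v = ∑ j : Fin d, ∫ x, ‖g j x‖ ^ 2 := by
  rw [gradNormSq_eq_gradForm, h.gradForm_eq hΩ hΩb h]
  simp only [real_inner_self_eq_norm_sq]

lemma IsH10.gradForm_add_right (hΩ : IsOpen Ω) (hΩb : Bornology.IsBounded Ω)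
    {u : Space d → Space d} {l : Fin d → Space d → Space d} (hu : IsH10 Ω u l) (h : IsH10 Ω v g)
    (h' : IsH10 Ω w k) : gradForm Ω u (v + w) = gradForm Ω u v + gradForm Ω u w := by
  rw [hu.gradForm_eq hΩ hΩb (h.add h'), hu.gradForm_eq hΩ hΩb h, hu.gradForm_eq hΩ hΩb h',
    ← Finset.sum_add_distrib]
  refine Finset.sum_congr rfl fun j _ => ?_
  simp only [Pi.add_apply, inner_add_right]
  exact integral_add (integrable_inner_of_memLp (hu.grad_memLp j) (h.grad_memLp j))
    (integrable_inner_of_memLp (hu.grad_memLp j) (h'.grad_memLp j))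

lemma IsH10.gradForm_sub_left (hΩ : IsOpen Ω) (hΩb : Bornology.IsBounded Ω)
    {u : Space d → Space d} {l : Fin d → Space d → Space d} (hu : IsH10 Ω u l) (h : IsH10 Ω v g)
    (h' : IsH10 Ω w k) : gradForm Ω (v - w) u = gradForm Ω v u - gradForm Ω w u := by
  rw [(h.sub h').gradForm_eq hΩ hΩb hu, h.gradForm_eq hΩ hΩb hu, h'.gradForm_eq hΩ hΩb hu,
    ← Finset.sum_sub_distrib]
  refine Finset.sum_congr rfl fun j _ => ?_
  simp only [Pi.sub_apply, inner_sub_left]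
  exact integral_sub (integrable_inner_of_memLp (h.grad_memLp j) (hu.grad_memLp j))
    (integrable_inner_of_memLp (h'.grad_memLp j) (hu.grad_memLp j))

lemma IsH10.integrable_convective (hd : d = 2 ∨ d = 3) (hΩb : Bornology.IsBounded Ω)
    {u : Space d → Space d} {l : Fin d → Space d → Space d} (hu : IsH10 Ω u l) (h : IsH10 Ω v g)
    (h' : IsH10 Ω w k) :
    Integrable (fun x => ∑ j : Fin d, u x j * inner ℝ (g j x) (w x)) volume := by
  refine integrable_finsetSum _ fun j _ => (integrable_and_enorm_integral_le_of_triple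
    (F := fun x => u x j * inner ℝ (g j x) (w x)) (a := u) (b := w) (c := g j)
    ((memLp_coord hu.memLp j).1.mul ((h.grad_memLp j).1.inner h'.memLp.1)) (fun x => ?_)
    (hu.memLp_four hd hΩb) (h'.memLp_four hd hΩb) (h.grad_memLp j)).1
  rw [norm_mul, mul_assoc]
  exact mul_le_mul (PiLp.norm_apply_le _ _) ((norm_inner_le_norm _ _).trans (mul_comm _ _).le)
    (norm_nonneg _) (norm_nonneg _)

lemma IsH10.convForm_eq (hΩ : IsOpen Ω) (h : IsH10 Ω v g) (h' : IsH10 Ω w k)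
    (u : Space d → Space d) :
    convForm Ω u v w = ∫ x, ∑ j : Fin d, u x j * inner ℝ (g j x) (w x) := by
  have hz : ∀ᵐ x, x ∉ Ω → ∑ j : Fin d, u x j * inner ℝ (g j x) (w x) = 0 := by
    filter_upwards [h'.zero] with x hx hxΩ
    simp [hx hxΩ]
  rw [convForm, ← setIntegral_eq_integral_of_ae_compl_eq_zero hz]
  refine integral_congr_ae ?_
  filter_upwards [eventually_countable_forall.2 fun j => h.weakPartial_ae_eq hΩ j] with x h1
  simp only [h1]

lemma IsH10.convForm_add_right (hd : d = 2 ∨ d = 3) (hΩ : IsOpen Ω)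
    (hΩb : Bornology.IsBounded Ω) {u : Space d → Space d} {l : Fin d → Space d → Space d}
    (hu : IsH10 Ω u l) (h : IsH10 Ω v g) (h' : IsH10 Ω w k) :
    convForm Ω u u (v + w) = convForm Ω u u v + convForm Ω u u w := by
  rw [hu.convForm_eq hΩ (h.add h'), hu.convForm_eq hΩ h, hu.convForm_eq hΩ h',
    ← integral_add (hu.integrable_convective hd hΩb hu h)
      (hu.integrable_convective hd hΩb hu h')]
  simp only [Pi.add_apply, inner_add_right, mul_add, Finset.sum_add_distrib]

lemma IsH10.divergence_ae_eq (hΩ : IsOpen Ω) (h : IsH10 Ω v g) :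
    divergence Ω v =ᵐ[volume.restrict Ω] fun x => ∑ j : Fin d, g j x j := by
  filter_upwards [eventually_countable_forall.2 fun j => h.weakPartial_ae_eq hΩ j] with x h1
  simp only [divergence, h1]

lemma IsH10.memLp_divergence (hΩ : IsOpen Ω) (h : IsH10 Ω v g) :
    MemLp (divergence Ω v) 2 (volume.restrict Ω) :=
  MemLp.ae_eq (h.divergence_ae_eq hΩ).symm
    (memLp_finsetSum _ fun j _ => (memLp_coord (h.grad_memLp j) j).restrict Ω)

lemma IsH10.divergence_add_ae_eq (hΩ : IsOpen Ω) (h : IsH10 Ω v g) (h' : IsH10 Ω w k) :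
    divergence Ω (v + w) =ᵐ[volume.restrict Ω] divergence Ω v + divergence Ω w := by
  filter_upwards [(h.add h').divergence_ae_eq hΩ, h.divergence_ae_eq hΩ,
    h'.divergence_ae_eq hΩ] with x h1 h2 h3
  simp [h1, h2, h3, Finset.sum_add_distrib]

lemma IsH10.divergence_const_smul_ae_eq (hΩ : IsOpen Ω) (h : IsH10 Ω v g) (c : ℝ) :
    divergence Ω (c • v) =ᵐ[volume.restrict Ω] c • divergence Ω v := by
  filter_upwards [(h.const_smul c).divergence_ae_eq hΩ, h.divergence_ae_eq hΩ] with x h1 h2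
  simp [h1, h2, Finset.mul_sum]

lemma IsH10.integral_mul_divergence_add (hΩ : IsOpen Ω) (h : IsH10 Ω v g) (h' : IsH10 Ω w k)
    {q : Space d → ℝ} (hq : q ∈ pressureSpace Ω) :
    ∫ x in Ω, q x * divergence Ω (v + w) x
      = (∫ x in Ω, q x * divergence Ω v x) + ∫ x in Ω, q x * divergence Ω w x := by
  have h1 : Integrable (fun x => q x * divergence Ω v x) (volume.restrict Ω) :=
    hq.1.integrable_mul (h.memLp_divergence hΩ)
  have h2 : Integrable (fun x => q x * divergence Ω w x) (volume.restrict Ω) :=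
    hq.1.integrable_mul (h'.memLp_divergence hΩ)
  rw [← integral_add h1 h2]
  refine integral_congr_ae ?_
  filter_upwards [h.divergence_add_ae_eq hΩ h'] with x hx
  rw [hx, Pi.add_apply, mul_add]

lemma IsH10.integral_mul_divergence_const_smul (hΩ : IsOpen Ω) (h : IsH10 Ω v g) (c : ℝ)
    (q : Space d → ℝ) :
    ∫ x in Ω, q x * divergence Ω (c • v) x = c * ∫ x in Ω, q x * divergence Ω v x := by
  rw [← integral_const_mul]
  refine integral_congr_ae ?_
  filter_upwards [h.divergence_const_smul_ae_eq hΩ c] with x hx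
  rw [hx, Pi.smul_apply, smul_eq_mul]
  ring

end Forms

/-- `∇ · v = 0` in `Ω`, in the sense of the incompressibility constraint. -/
def IsDivFree (Ω : Set (Space d)) (v : Space d → Space d) : Prop :=
  ∀ q ∈ pressureSpace Ω, ∫ x in Ω, q x * divergence Ω v x = 0

lemma IsDivFree.add {Ω : Set (Space d)} (hΩ : IsOpen Ω) {v w : Space d → Space d}
    {g k : Fin d → Space d → Space d} (h : IsH10 Ω v g) (h' : IsH10 Ω w k) (hv : IsDivFree Ω v)
    (hw : IsDivFree Ω w) : IsDivFree Ω (v + w) := fun q hq => by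
  rw [h.integral_mul_divergence_add hΩ h' hq, hv q hq, hw q hq, add_zero]

lemma IsDivFree.const_smul {Ω : Set (Space d)} (hΩ : IsOpen Ω) {v : Space d → Space d}
    {g : Fin d → Space d → Space d} (h : IsH10 Ω v g) (hv : IsDivFree Ω v) (c : ℝ) :
    IsDivFree Ω (c • v) := fun q hq => by
  rw [h.integral_mul_divergence_const_smul hΩ c, hv q hq, mul_zero]

lemma IsDivFree.sub {Ω : Set (Space d)} (hΩ : IsOpen Ω) {v w : Space d → Space d}
    {g k : Fin d → Space d → Space d} (h : IsH10 Ω v g) (h' : IsH10 Ω w k) (hv : IsDivFree Ω v)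
    (hw : IsDivFree Ω w) : IsDivFree Ω (v - w) := by
  have := hv.add hΩ h (h'.const_smul (-1)) (hw.const_smul hΩ h' (-1))
  simpa [sub_eq_add_neg] using this

lemma mem_solenoidalSpace_iff (hd : 0 < d) {α : ℝ} (hα : α ∈ Ioo (0 : ℝ) 1) {Ω R : Set (Space d)}
    (hΩb : Bornology.IsBounded Ω) (hR : IsOpen R) (hΩR : closure Ω ⊆ R) {v : Space d → Space d} :
    v ∈ solenoidalSpace Ω R α ↔ (∃ g, IsH10 Ω v g) ∧ IsDivFree Ω v := by
  rw [← mem_velocitySpace_iff hd hα hΩb hR hΩR]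
  simp only [IsDivFree, solenoidalSpace, mem_ofPred_eq, mul_comm]

/-! ### The energy balance at a fixed time -/

/-- The momentum balance at a fixed time without time derivative and force: convection, viscosity,
pressure and a nonlocal form `a`, tested with `v`. -/
def spatialForm (Ω : Set (Space d)) (ν : ℝ) (a : (Space d → Space d) → (Space d → Space d) → ℝ)
    (u : Space d → Space d) (p : Space d → ℝ) (v : Space d → Space d) : ℝ :=
  convForm Ω u u v + ν * gradForm Ω u v - (∫ x in Ω, p x * divergence Ω v x) + a u v

lemma spatialForm_add_right (hd : d = 2 ∨ d = 3) {Ω : Set (Space d)} (hΩ : IsOpen Ω)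
    (hΩb : Bornology.IsBounded Ω) {ν : ℝ} {a : (Space d → Space d) → (Space d → Space d) → ℝ}
    {u v w : Space d → Space d} {l g k : Fin d → Space d → Space d} {p : Space d → ℝ}
    (hu : IsH10 Ω u l) (hv : IsH10 Ω v g) (hw : IsH10 Ω w k) (hp : p ∈ pressureSpace Ω)
    (ha : a u (v + w) = a u v + a u w) :
    spatialForm Ω ν a u p (v + w) = spatialForm Ω ν a u p v + spatialForm Ω ν a u p w := by
  simp only [spatialForm]
  rw [hu.convForm_add_right hd hΩ hΩb hv hw, hu.gradForm_add_right hΩ hΩb hv hw,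
    hv.integral_mul_divergence_add hΩ hw hp, ha]
  ring

lemma normSq_nonneg (Ω : Set (Space d)) (v : Space d → Space d) : 0 ≤ normSq Ω v :=
  integral_nonneg fun x => by positivity

lemma gradNormSq_nonneg (Ω : Set (Space d)) (v : Space d → Space d) : 0 ≤ gradNormSq Ω v :=
  integral_nonneg fun x => by positivity

lemma truncGagliardoSq_nonneg (Ω : Set (Space d)) (α lam : ℝ) (v : Space d → Space d) :
    0 ≤ truncGagliardoSq Ω α lam v :=
  integral_nonneg fun x => integral_nonneg fun y => by positivity

/-- For divergence-free `u` and `u_λ` with difference `e`, the convective terms differ by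
`b(e, u, e)`. -/
lemma convForm_sub_convForm (hd : d = 2 ∨ d = 3) {Ω : Set (Space d)} (hΩ : IsOpen Ω)
    (hΩb : Bornology.IsBounded Ω) {u ul : Space d → Space d} {g l : Fin d → Space d → Space d}
    (hu : IsH10 Ω u g) (hul : IsH10 Ω ul l) (hdiv : IsDivFree Ω ul) :
    convForm Ω u u (u - ul) - convForm Ω ul ul (u - ul)
      = ∫ x, ∑ j : Fin d, (u - ul) x j * inner ℝ (g j x) ((u - ul) x) := by
  have he := hu.sub hul
  have h0 := hul.convective_self_eq_zero hd hΩ hΩb he (fun q hq => by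
    simpa only [mul_comm] using hdiv q hq)
  rw [hu.convForm_eq hΩ he, hul.convForm_eq hΩ he, ← integral_sub
    (hu.integrable_convective hd hΩb hu he) (hul.integrable_convective hd hΩb hul he),
    ← add_zero (∫ x, ∑ j : Fin d, (u - ul) x j * inner ℝ (g j x) ((u - ul) x)), ← h0,
    ← integral_add (he.integrable_convective hd hΩb hu he)
      (hul.integrable_convective hd hΩb he he)]
  refine integral_congr_ae (ae_of_all _ fun x => ?_)
  simp only [← Finset.sum_sub_distrib, ← Finset.sum_add_distrib]
  refine Finset.sum_congr rfl fun j _ => ?_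
  simp only [Pi.sub_apply, PiLp.sub_apply, inner_sub_left]
  ring

/-- The rate of change of the energy of the error. The convective difference is absorbed by the
viscous term, the pressures drop out, and the truncation costs `O(λ^(-4α))`. -/
lemma exists_energy_rate_le (hd : d = 2 ∨ d = 3) {Ω : Set (Space d)} (hΩ : IsOpen Ω)
    (hΩb : Bornology.IsBounded Ω) {α : ℝ} (hα : α ∈ Ioo (0 : ℝ) 1) {ν c : ℝ} (hν : 0 < ν)
    (hc : 0 ≤ c) (M : ℝ) :
    ∃ K : ℝ, 0 ≤ K ∧ ∀ lam : ℝ, 0 < lam → ∀ (u ul : Space d → Space d)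
      (g l : Fin d → Space d → Space d) (p pl : Space d → ℝ), IsH10 Ω u g → IsH10 Ω ul l →
      IsDivFree Ω u → IsDivFree Ω ul → p ∈ pressureSpace Ω → pl ∈ pressureSpace Ω →
      normSq Ω u + gradNormSq Ω u ≤ M →
      2 * (spatialForm Ω ν (fun v w => c * truncForm Ω α lam v w) ul pl (u - ul)
          - spatialForm Ω ν (fun v w => c * fullForm α v w) u p (u - ul))
        ≤ -(ν * gradNormSq Ω (u - ul)) - 2 * c * truncGagliardoSq Ω α lam (u - ul)
          + K * (normSq Ω (u - ul) + (1 / lam ^ (2 * α)) ^ 2) := by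
  have hd0 : 0 < d := by omega
  obtain ⟨K₁, hK₁, hconv⟩ := exists_convective_bound hd hΩb (half_pos hν) M
  obtain ⟨κ, hκ, htrunc⟩ := exists_truncation_bound hd0 hα
  refine ⟨2 * K₁ + 2 * c * κ + 2 * c * κ * |M|, by positivity,
    fun lam hlam u ul g l p pl hu hul hdu hdul hp hpl hM => ?_⟩
  have he := hu.sub hul
  have hde : IsDivFree Ω (u - ul) := hdu.sub hΩ hu hul hdul
  have hgu := hu.gradNormSq_eq hΩ hΩb
  have hge := he.gradNormSq_eq hΩ hΩb
  have hgM : (∑ j : Fin d, ∫ x, ‖g j x‖ ^ 2) ≤ M := by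
    rw [← hgu]
    linarith [normSq_nonneg Ω u]
  have h1 := hconv _ _ g he hu.grad_memLp hgM
  rw [← convForm_sub_convForm hd hΩ hΩb hu hul hdul, ← hge, ← he.normSq_eq] at h1
  have h2 := htrunc Ω hΩ lam hlam u (u - ul) (hu.memHFrac hd0 hα) (he.memHFrac hd0 hα) hu.zero
  rw [← hu.normSq_eq, ← he.normSq_eq] at h2
  have h3 := truncForm_sub_left hΩ hlam (hu.memHFrac hd0 hα) (hul.memHFrac hd0 hα)
    (he.memHFrac hd0 hα)
  rw [truncForm_self] at h3
  have h4 := he.gradForm_sub_left hΩ hΩb hu hul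
  rw [← gradNormSq_eq_gradForm] at h4
  simp only [spatialForm]
  rw [hde p hp, hde pl hpl]
  have h1' := neg_le_of_abs_le h1
  have h2' := neg_le_of_abs_le h2
  have hnu : normSq Ω u ≤ |M| := by
    linarith [gradNormSq_nonneg Ω u, le_abs_self M]
  have hne := normSq_nonneg Ω (u - ul)
  set t := (1 / lam ^ (2 * α)) ^ 2 with ht
  have ht0 : 0 ≤ t := by positivity
  have h5 : c * (κ * (t * normSq Ω u + normSq Ω (u - ul)))
      ≤ c * (κ * (t * |M| + normSq Ω (u - ul))) := by gcongr
  have h6 : c * -(κ * (t * normSq Ω u + normSq Ω (u - ul)))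
      ≤ c * (fullForm α u (u - ul) - truncForm Ω α lam u (u - ul)) :=
    mul_le_mul_of_nonneg_left h2' hc
  have h7 : 0 ≤ K₁ * t := mul_nonneg hK₁ ht0
  have h8 : 0 ≤ c * κ * t := by positivity
  have h9 : 0 ≤ c * κ * |M| * normSq Ω (u - ul) := by positivity
  have h4' : ν * gradNormSq Ω (u - ul)
      = ν * gradForm Ω u (u - ul) - ν * gradForm Ω ul (u - ul) := by rw [h4]; ring
  have h3' : c * truncGagliardoSq Ω α lam (u - ul)
      = c * truncForm Ω α lam u (u - ul) - c * truncForm Ω α lam ul (u - ul) := by rw [h3]; ring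
  linarith

/-! ### Space-time representatives -/

/-- A square-integrable space-time field on `(0, T) × R`, extended by zero, has a strongly
measurable representative with square-integrable slices. -/
lemma exists_measurable_slices {R : Set (Space d)} (hR : MeasurableSet R) {T : ℝ}
    {f : ℝ → Space d → Space d} (hf : MemLp (fun z : ℝ × Space d => f z.1 z.2) 2
      ((timeMeasure T).prod (volume.restrict R))) :
    ∃ F : ℝ × Space d → Space d, StronglyMeasurable F ∧ MemLp F 2 volume ∧
      ∀ᵐ t ∂(timeMeasure T), MemLp (fun x => F (t, x)) 2 volume ∧
        (fun x => F (t, x)) =ᵐ[volume] R.indicator (f t) := by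
  have hS : MeasurableSet (Ioo 0 T ×ˢ R) := measurableSet_Ioo.prod hR
  rw [timeMeasure, Measure.prod_restrict] at hf
  have h1 : MemLp ((Ioo 0 T ×ˢ R).indicator fun z : ℝ × Space d => f z.1 z.2) 2
      ((volume : Measure ℝ).prod volume) := (memLp_indicator_iff_restrict hS).2 hf
  have hF := h1.ae_eq h1.1.ae_eq_mk
  refine ⟨h1.1.mk _, h1.1.stronglyMeasurable_mk, hF, ?_⟩
  have h2 : ∀ᵐ t : ℝ, ∀ᵐ x : Space d, h1.1.mk _ (t, x)
      = (Ioo 0 T ×ˢ R).indicator (fun z : ℝ × Space d => f z.1 z.2) (t, x) :=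
    Measure.ae_ae_of_ae_prod h1.1.ae_eq_mk.symm
  have h3 : ∀ᵐ t : ℝ, Integrable (fun x => ‖h1.1.mk _ (t, x)‖ ^ 2) volume :=
    (hF.integrable_norm_pow two_ne_zero).prod_right_ae
  rw [timeMeasure, ae_restrict_iff' measurableSet_Ioo]
  filter_upwards [h2, h3] with t ht ht3 htT
  constructor
  · have hm : AEStronglyMeasurable (fun x => h1.1.mk _ (t, x)) volume :=
      (h1.1.stronglyMeasurable_mk.comp_measurable (by fun_prop)).aestronglyMeasurable
    exact (memLp_two_iff_integrable_sq_norm hm).2 ht3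
  · filter_upwards [ht] with x hx
    rw [hx]
    by_cases hxR : x ∈ R
    · rw [indicator_of_mem hxR, indicator_of_mem (mk_mem_prod htT hxR)]
    · rw [indicator_of_notMem hxR, indicator_of_notMem fun h => hxR h.2]

/-- Jointly measurable representatives `w` of a time-dependent field `u` and `γ` of its spatial
gradient, extended by zero to space-time. -/
structure IsJointRep (Ω : Set (Space d)) (T : ℝ) (u : ℝ → Space d → Space d)
    (w : ℝ × Space d → Space d) (γ : Fin d → ℝ × Space d → Space d) : Prop where
  stronglyMeasurable : StronglyMeasurable w
  memLp : MemLp w 2 volume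
  grad_stronglyMeasurable : ∀ j, StronglyMeasurable (γ j)
  grad_memLp : ∀ j, MemLp (γ j) 2 volume
  isH10 : ∀ᵐ t ∂(timeMeasure T), IsH10 Ω (u t) (fun j x => γ j (t, x))
  ae_eq : ∀ᵐ t ∂(timeMeasure T), u t =ᵐ[volume] fun x => w (t, x)

lemma MemL2X.exists_isJointRep {Ω R : Set (Space d)} (hΩb : Bornology.IsBounded Ω)
    (hR : IsOpen R) (hΩR : closure Ω ⊆ R) {α T : ℝ} {u : ℝ → Space d → Space d}
    (h : MemL2X Ω R α T u) : ∃ w γ, IsJointRep Ω T u w γ := by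
  obtain ⟨χ, hχ, -, hs, h1, hχ1⟩ := exists_cutoff hΩb.isCompact_closure hR hΩR
  choose g hg hw using h.grad
  have hχg : ∀ j, MemLp (fun z : ℝ × Space d => χ z.2 • g j z.1 z.2) 2
      ((timeMeasure T).prod (volume.restrict R)) := fun j => by
    refine (hg j).mono ((hχ.continuous.comp continuous_snd).aestronglyMeasurable.smul (hg j).1)
      (ae_of_all _ fun z => ?_)
    rw [norm_smul]
    exact mul_le_of_le_one_left (norm_nonneg _)
      (by rw [Real.norm_eq_abs, abs_le]; constructor <;> linarith [(hχ1 z.2).1, (hχ1 z.2).2])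
  obtain ⟨w, hwm, hw2, hws⟩ := exists_measurable_slices hR.measurableSet h.memLp
  choose γ hγm hγ2 hγs using fun j =>
    exists_measurable_slices (f := fun t x => χ x • g j t x) hR.measurableSet (hχg j)
  have hzero : ∀ᵐ t ∂(timeMeasure T), ∀ᵐ x, x ∉ Ω → u t x = 0 :=
    h.mem.mono fun t ht => ht.2.2
  have hueq : ∀ᵐ t ∂(timeMeasure T), u t =ᵐ[volume] fun x => w (t, x) := by
    filter_upwards [hws, hzero] with t ht h0
    filter_upwards [ht.2, h0] with x hx hx0
    rw [hx]
    by_cases hxR : x ∈ R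
    · rw [indicator_of_mem hxR]
    · rw [indicator_of_notMem hxR, hx0 fun hxΩ => hxR (hΩR (subset_closure hxΩ))]
  refine ⟨w, γ, hwm, hw2, hγm, hγ2, ?_, hueq⟩
  filter_upwards [hws, hueq, hzero, eventually_countable_forall.2 hγs,
    eventually_countable_forall.2 hw] with t ht1 ht2 ht3 ht4 ht5
  refine ⟨ht1.1.ae_eq ht2.symm, fun j => (ht4 j).1, fun j => ?_, ht3⟩
  refine ((ht5 j).extend hχ hs (fun x hx => h1 x (subset_closure hx)) ht3).congr
    (ae_of_all _ fun _ => rfl) ?_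
  rw [Measure.restrict_univ]
  filter_upwards [(ht4 j).2] with x hx
  rw [hx]
  by_cases hxR : x ∈ R
  · rw [indicator_of_mem hxR]
  · rw [indicator_of_notMem hxR, image_eq_zero_of_notMem_tsupport fun h => hxR (hs h), zero_smul]

section JointRep

variable {Ω : Set (Space d)} {T : ℝ} {u : ℝ → Space d → Space d} {w : ℝ × Space d → Space d}
  {γ : Fin d → ℝ × Space d → Space d}

lemma IsJointRep.sub {u' : ℝ → Space d → Space d} {w' : ℝ × Space d → Space d}
    {γ' : Fin d → ℝ × Space d → Space d} (h : IsJointRep Ω T u w γ)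
    (h' : IsJointRep Ω T u' w' γ') :
    IsJointRep Ω T (fun t => u t - u' t) (w - w') (fun j => γ j - γ' j) where
  stronglyMeasurable := h.stronglyMeasurable.sub h'.stronglyMeasurable
  memLp := h.memLp.sub h'.memLp
  grad_stronglyMeasurable j := (h.grad_stronglyMeasurable j).sub (h'.grad_stronglyMeasurable j)
  grad_memLp j := (h.grad_memLp j).sub (h'.grad_memLp j)
  isH10 := by
    filter_upwards [h.isH10, h'.isH10] with t h1 h2 using h1.sub h2
  ae_eq := by
    filter_upwards [h.ae_eq, h'.ae_eq] with t h1 h2 using h1.sub h2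

lemma IsJointRep.integrableOn_gradNormSq (hΩ : IsOpen Ω) (hΩb : Bornology.IsBounded Ω)
    (h : IsJointRep Ω T u w γ) : IntegrableOn (fun s => gradNormSq Ω (u s)) (Ioo 0 T) := by
  have h1 : Integrable (fun t : ℝ => ∑ j : Fin d, ∫ x, ‖γ j (t, x)‖ ^ 2) volume :=
    integrable_finsetSum _ fun j _ =>
      ((h.grad_memLp j).integrable_norm_pow two_ne_zero).integral_prod_left
  refine Integrable.congr (h1.integrableOn (s := Ioo 0 T)) ?_
  filter_upwards [h.isH10] with t ht
  rw [ht.gradNormSq_eq hΩ hΩb]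

lemma eLpNorm_two_sq_slices_lintegral {f : ℝ × Space d → Space d} (hm : StronglyMeasurable f) :
    ∫⁻ t, eLpNorm (fun x => f (t, x)) 2 volume ^ 2 = eLpNorm f 2 volume ^ 2 := by
  simp only [eLpNorm_two_sq]
  rw [Measure.volume_eq_prod, lintegral_prod _ (hm.enorm.pow_const 2).aemeasurable]

lemma sq_sum_enorm_le (a : Fin d → ℝ≥0∞) : (∑ j, a j) ^ 2 ≤ ∑ j, ∑ k, (a j ^ 2 + a k ^ 2) := by
  rw [sq, Finset.sum_mul_sum]
  refine Finset.sum_le_sum fun j _ => Finset.sum_le_sum fun k _ => ?_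
  rcases le_total (a j) (a k) with h | h
  · calc a j * a k ≤ a k * a k := by gcongr
      _ ≤ _ := by rw [sq (a k)]; exact le_add_self
  · calc a j * a k ≤ a j * a j := by gcongr
      _ ≤ _ := by rw [sq (a j)]; exact le_self_add

/-- The truncated nonlocal energy is integrable in time: it is measurable because the field has a
jointly measurable representative, and it is dominated by the energy of the gradient. -/
lemma IsJointRep.integrableOn_truncGagliardoSq (hd : 0 < d) {α : ℝ} (hα : α ∈ Ioo (0 : ℝ) 1)
    (hΩ : IsOpen Ω) {lam : ℝ} (hlam : 0 < lam) (h : IsJointRep Ω T u w γ) :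
    IntegrableOn (fun s => truncGagliardoSq Ω α lam (u s)) (Ioo 0 T) := by
  obtain ⟨A, hA, hle⟩ := exists_nonlocal_energy_le hd hα
  set p : ℝ := (d : ℝ) + 2 * α with hp
  have hS := measurableSet_nearPairs (isOpen_union_interactionDomain hΩ hlam).measurableSet lam
  set N := nearPairs (Ω ∪ interactionDomain Ω lam) lam
  obtain ⟨H, hH⟩ : ∃ H : ℝ × (Space d × Space d) → ℝ, H = fun q =>
    ‖w (q.1, q.2.1) - w (q.1, q.2.2)‖ ^ 2 / ‖q.2.1 - q.2.2‖ ^ p := ⟨_, rfl⟩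
  have hHm : Measurable H := by
    rw [hH]
    refine Measurable.div (Measurable.pow_const (StronglyMeasurable.measurable
      (StronglyMeasurable.norm (StronglyMeasurable.sub ?_ ?_))) 2) ?_
    · exact h.stronglyMeasurable.comp_measurable (by fun_prop)
    · exact h.stronglyMeasurable.comp_measurable (by fun_prop)
    · exact (measurable_norm_sub_rpow p).comp measurable_snd
  have hH0 : ∀ q, 0 ≤ H q := fun q => by rw [hH]; positivity
  -- the slices of the energy density are dominated by the square-integrable gradient
  have hbound : ∀ᵐ t ∂(timeMeasure T), ∫⁻ z : Space d × Space d, ENNReal.ofReal (H (t, z))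
      ≤ A * ((∑ j : Fin d, ∑ k : Fin d, (eLpNorm (fun x => γ j (t, x)) 2 volume ^ 2
          + eLpNorm (fun x => γ k (t, x)) 2 volume ^ 2))
        + eLpNorm (fun x => w (t, x)) 2 volume ^ 2) := by
    filter_upwards [h.isH10, h.ae_eq] with t h1 h2
    have h3 : IsH10 Ω (fun x => w (t, x)) (fun j x => γ j (t, x)) :=
      ⟨h1.memLp.ae_eq h2, h1.grad_memLp, fun j => (h1.weak j).congr (by simpa using h2) (by simp),
        by filter_upwards [h1.zero, h2] with x hx hx2 hxΩ; rw [← hx2, hx hxΩ]⟩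
    have h4 := hle _ _ _ h3
    simp only [hH]
    refine h4.trans ?_
    gcongr
    exact sq_sum_enorm_le _
  have hslice : ∀ f : ℝ × Space d → Space d, StronglyMeasurable f →
      Measurable fun t => eLpNorm (fun x => f (t, x)) 2 volume ^ 2 := fun f hf => by
    simp only [eLpNorm_two_sq]
    exact (hf.enorm.pow_const 2).lintegral_prod_right'
  have hfin : ∀ f : ℝ × Space d → Space d, StronglyMeasurable f → MemLp f 2 volume →
      ∫⁻ t, eLpNorm (fun x => f (t, x)) 2 volume ^ 2 < ⊤ := fun f hf hf2 => by
    rw [eLpNorm_two_sq_slices_lintegral hf]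
    exact ENNReal.pow_lt_top hf2.2
  have hγs := fun j => hslice (γ j) (h.grad_stronglyMeasurable j)
  have hγs2 : ∀ j k, Measurable fun t => eLpNorm (fun x => γ j (t, x)) 2 volume ^ 2
      + eLpNorm (fun x => γ k (t, x)) 2 volume ^ 2 := fun j k => (hγs j).add (hγs k)
  have hHi : Integrable H ((timeMeasure T).prod (volume.restrict N)) := by
    refine ⟨hHm.aestronglyMeasurable, ?_⟩
    rw [hasFiniteIntegral_iff_ofReal (ae_of_all _ hH0),
      lintegral_prod _ hHm.ennreal_ofReal.aemeasurable]
    calc _ ≤ ∫⁻ t in Ioo 0 T, A * ((∑ j : Fin d, ∑ k : Fin d,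
            (eLpNorm (fun x => γ j (t, x)) 2 volume ^ 2
              + eLpNorm (fun x => γ k (t, x)) 2 volume ^ 2))
            + eLpNorm (fun x => w (t, x)) 2 volume ^ 2) :=
          lintegral_mono_ae (hbound.mono fun t ht => (setLIntegral_le_lintegral _ _).trans ht)
      _ ≤ ∫⁻ t, A * ((∑ j : Fin d, ∑ k : Fin d,
            (eLpNorm (fun x => γ j (t, x)) 2 volume ^ 2
              + eLpNorm (fun x => γ k (t, x)) 2 volume ^ 2))
            + eLpNorm (fun x => w (t, x)) 2 volume ^ 2) := setLIntegral_le_lintegral _ _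
      _ < ⊤ := by
          rw [lintegral_const_mul' _ _ hA, lintegral_add_right _ (hslice w h.stronglyMeasurable),
            lintegral_finsetSum _ fun j _ => Finset.measurable_fun_sum _ fun k _ =>
              hγs2 j k]
          refine ENNReal.mul_lt_top hA.lt_top (ENNReal.add_lt_top.2
            ⟨ENNReal.sum_lt_top.2 fun j _ => ?_, hfin w h.stronglyMeasurable h.memLp⟩)
          rw [lintegral_finsetSum _ fun k _ => hγs2 j k]
          refine ENNReal.sum_lt_top.2 fun k _ => ?_
          rw [lintegral_add_left (hγs j)]
          exact ENNReal.add_lt_top.2 ⟨hfin _ (h.grad_stronglyMeasurable j) (h.grad_memLp j),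
            hfin _ (h.grad_stronglyMeasurable k) (h.grad_memLp k)⟩
  refine Integrable.congr hHi.integral_prod_left ?_
  filter_upwards [h.isH10, h.ae_eq] with t h1 h2
  rw [← truncForm_self, truncForm_eq_integral hΩ hlam (h1.memHFrac hd hα) (h1.memHFrac hd hα)]
  refine integral_congr_ae (ae_restrict_of_ae ?_)
  filter_upwards [Measure.quasiMeasurePreserving_fst.ae h2,
    Measure.quasiMeasurePreserving_snd.ae h2] with z hz1 hz2
  simp only [hH, nonlocalDensity, real_inner_self_eq_norm_sq, hz1, hz2, hp]

end JointRep

/-! ### The energy of the error -/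

/-- Gronwall's inequality in integral form. -/
lemma integral_le_of_le_integral_add {N : ℝ → ℝ} {T K B : ℝ} (hT : 0 ≤ T)
    (hN : ContinuousOn N (Icc 0 T)) (hK : 1 ≤ K) (hB : 0 ≤ B)
    (h : ∀ τ ∈ Icc 0 T, N τ ≤ K * (∫ s in (0 : ℝ)..τ, N s) + B) :
    ∀ τ ∈ Icc 0 T, ∫ s in (0 : ℝ)..τ, N s ≤ B * Real.exp (K * T) := by
  obtain ⟨F, hF⟩ : ∃ F, F = IccExtend hT ((Icc 0 T).domRestrict N) := ⟨_, rfl⟩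
  have hFc : Continuous F := by
    rw [hF]
    exact (continuousOn_iff_continuous_domRestrict.1 hN).Icc_extend'
  have hFN : ∀ t ∈ Icc 0 T, F t = N t := fun t ht => by
    rw [hF, IccExtend_of_mem _ _ ht]
    rfl
  have hint : ∀ τ ∈ Icc 0 T, ∫ s in (0 : ℝ)..τ, F s = ∫ s in (0 : ℝ)..τ, N s := fun τ hτ => by
    refine intervalIntegral.integral_congr fun s hs => hFN s ?_
    rw [uIcc_of_le hτ.1] at hs
    exact ⟨hs.1, hs.2.trans hτ.2⟩
  have hder : ∀ x, HasDerivAt (fun x => ∫ s in (0 : ℝ)..x, F s) (F x) x := fun x =>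
    intervalIntegral.integral_hasDerivAt_right (hFc.intervalIntegrable _ _)
      (hFc.stronglyMeasurableAtFilter _ _) hFc.continuousAt
  have hg := le_gronwallBound_of_liminf_deriv_right_le (f := fun x => ∫ s in (0 : ℝ)..x, F s)
    (f' := F) (δ := 0) (K := K) (ε := B) (a := 0) (b := T)
    (fun x _ => (hder x).continuousAt.continuousWithinAt)
    (fun x _ r hr => (hder x).hasDerivWithinAt.liminf_right_slope_le hr) (by simp)
    (fun x hx => by
      have hx' : x ∈ Icc 0 T := ⟨hx.1, hx.2.le⟩
      rw [hFN x hx', hint x hx']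
      exact h x hx')
  intro τ hτ
  have h1 := hg τ hτ
  rw [hint τ hτ, sub_zero, gronwallBound_of_K_ne_0 (by positivity)] at h1
  refine h1.trans ?_
  have h2 : Real.exp (K * τ) ≤ Real.exp (K * T) := Real.exp_le_exp.2 (by gcongr; exact hτ.2)
  have h3 : B / K ≤ B := div_le_self hB hK
  have h4 : 0 ≤ Real.exp (K * τ) - 1 := by
    have := Real.add_one_le_exp (K * τ)
    have : 0 ≤ K * τ := mul_nonneg (by linarith) hτ.1
    linarith
  calc 0 * Real.exp (K * τ) + B / K * (Real.exp (K * τ) - 1)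
      ≤ B * (Real.exp (K * τ) - 1) := by
        rw [zero_mul, zero_add]
        gcongr
    _ ≤ B * Real.exp (K * T) := by
        gcongr
        linarith

section CL2

variable {Ω : Set (Space d)} {T : ℝ} {u v : ℝ → Space d → Space d}

lemma normSq_sub_le {a b : Space d → Space d} (ha : MemLp a 2 (volume.restrict Ω))
    (hb : MemLp b 2 (volume.restrict Ω)) :
    normSq Ω (a - b) ≤ 2 * normSq Ω a + 2 * normSq Ω b := by
  have h1 : Integrable (fun x => ‖a x‖ ^ 2) (volume.restrict Ω) :=
    ha.integrable_norm_pow two_ne_zero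
  have h2 : Integrable (fun x => ‖b x‖ ^ 2) (volume.restrict Ω) :=
    hb.integrable_norm_pow two_ne_zero
  have h3 : Integrable (fun x => ‖(a - b) x‖ ^ 2) (volume.restrict Ω) :=
    (ha.sub hb).integrable_norm_pow two_ne_zero
  simp only [normSq]
  rw [← integral_const_mul, ← integral_const_mul,
    ← integral_add (h1.const_mul 2) (h2.const_mul 2)]
  refine integral_mono h3 ((h1.const_mul 2).add (h2.const_mul 2)) fun x => ?_
  have h4 := norm_sub_le (a x) (b x)
  have h5 : ‖a x - b x‖ ^ 2 ≤ (‖a x‖ + ‖b x‖) ^ 2 := by gcongr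
  simp only [Pi.sub_apply]
  nlinarith [sq_nonneg (‖a x‖ - ‖b x‖)]

lemma MemCL2.sub (hu : MemCL2 Ω T u) (hv : MemCL2 Ω T v) :
    MemCL2 Ω T (fun t => u t - v t) := by
  refine ⟨fun t ht => (hu.1 t ht).sub (hv.1 t ht), fun t ht => ?_⟩
  have h1 := ((hu.2 t ht).const_mul 2).add ((hv.2 t ht).const_mul 2)
  rw [mul_zero, add_zero] at h1
  refine squeeze_zero' (Eventually.of_forall fun s => normSq_nonneg _ _) ?_ h1
  filter_upwards [self_mem_nhdsWithin] with s hs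
  have h2 := normSq_sub_le ((hu.1 s hs).sub (hu.1 t ht)) ((hv.1 s hs).sub (hv.1 t ht))
  refine le_of_eq_of_le ?_ h2
  congr 1
  ext1 x
  simp only [Pi.sub_apply]
  abel

lemma MemCL2.continuousOn_normSq (hu : MemCL2 Ω T u) :
    ContinuousOn (fun t => normSq Ω (u t)) (Icc 0 T) := by
  obtain ⟨N, hN⟩ : ∃ N : ℝ → ℝ, N = fun t => (eLpNorm (u t) 2 (volume.restrict Ω)).toReal :=
    ⟨_, rfl⟩
  have hNc : ContinuousOn N (Icc 0 T) := by
    intro t ht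
    rw [ContinuousWithinAt, tendsto_iff_dist_tendsto_zero]
    have h1 := (Real.continuous_sqrt.tendsto 0).comp (hu.2 t ht)
    rw [Real.sqrt_zero] at h1
    refine squeeze_zero' (Eventually.of_forall fun s => dist_nonneg) ?_ h1
    filter_upwards [self_mem_nhdsWithin] with s hs
    have hsub := (hu.1 s hs).sub (hu.1 t ht)
    have e : (Real.sqrt ∘ fun s => normSq Ω fun x => u s x - u t x) s
        = (eLpNorm (u s - u t) 2 (volume.restrict Ω)).toReal := by
      simp only [Function.comp, normSq]
      rw [← Real.sqrt_sq (ENNReal.toReal_nonneg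
        (a := eLpNorm (u s - u t) 2 (volume.restrict Ω))), ← integral_norm_sq_eq hsub]
      rfl
    rw [e]
    simp only [hN]
    rw [← Lp.norm_toLp _ (hu.1 s hs), ← Lp.norm_toLp _ (hu.1 t ht), ← Lp.norm_toLp _ hsub,
      MemLp.toLp_sub]
    exact abs_norm_sub_norm_le _ _
  refine (hNc.pow 2).congr fun t ht => ?_
  rw [hN]
  exact integral_norm_sq_eq (hu.1 t ht)

lemma normSq_sub_normSq {a b : Space d → Space d} (ha : MemLp a 2 (volume.restrict Ω))
    (hb : MemLp b 2 (volume.restrict Ω)) :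
    normSq Ω a - normSq Ω b = ∫ x in Ω, inner ℝ (a x - b x) ((a + b) x) := by
  simp only [normSq]
  rw [← integral_sub (ha.integrable_norm_pow two_ne_zero) (hb.integrable_norm_pow two_ne_zero)]
  refine integral_congr_ae (ae_of_all _ fun x => ?_)
  simp only [Pi.add_apply, inner_add_right, inner_sub_left, real_inner_self_eq_norm_sq,
    real_inner_comm (a x) (b x)]
  ring

end CL2

lemma IsTimeDeriv.integrableOn_and_integral_eq {Ω R : Set (Space d)} {α T : ℝ}
    {u : ℝ → Space d → Space d} {D : ℝ → (Space d → Space d) → ℝ} (hD : IsTimeDeriv Ω R α T u D)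
    {v : Space d → Space d} (hv : v ∈ velocitySpace Ω R α) {t r : ℝ} (ht : t ∈ Ioo 0 T)
    (hr : r ∈ Ioo 0 T) (htr : t < r) :
    IntegrableOn (fun s => D s v) (Ioc t r) ∧
      (∫ x in Ω, inner ℝ (u r x) (v x)) - (∫ x in Ω, inner ℝ (u t x) (v x))
        = ∫ s in Ioc t r, D s v := by
  have hi : IntegrableOn (fun s => D s v) (Ioo 0 T) := hD.integrable v hv
  have hsub : ∀ τ ∈ Ioo 0 T, IntervalIntegrable (fun s => D s v) volume 0 τ := fun τ hτ => by
    rw [intervalIntegrable_iff_integrableOn_Ioc_of_le hτ.1.le]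
    exact hi.mono_set fun s hs => ⟨hs.1, hs.2.trans_lt hτ.2⟩
  refine ⟨hi.mono_set fun s hs => ⟨ht.1.trans hs.1, hs.2.trans_lt hr.2⟩, ?_⟩
  have h1 := hD.eq_integral v hv t ⟨ht.1.le, ht.2.le⟩
  have h2 := hD.eq_integral v hv r ⟨hr.1.le, hr.2.le⟩
  rw [← intervalIntegral.integral_of_le htr.le,
    ← intervalIntegral.integral_interval_sub_left (hsub r hr) (hsub t ht), ← h1, ← h2]
  ring

/-- The gradient of `v_t + v_r - 2 v_s` is controlled by the distances of the slices. -/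
lemma gradNormSq_le_sliceDistSq {Ω : Set (Space d)} (hΩ : IsOpen Ω) (hΩb : Bornology.IsBounded Ω)
    {γ : Fin d → ℝ × Space d → Space d} {v : ℝ → Space d → Space d} {t r s : ℝ}
    (ht : IsH10 Ω (v t) (fun j x => γ j (t, x))) (hr : IsH10 Ω (v r) (fun j x => γ j (r, x)))
    (hs : IsH10 Ω (v s) (fun j x => γ j (s, x))) :
    gradNormSq Ω (v r + v t - (v s + v s))
      ≤ (2 * sliceDistSq γ t s + 2 * sliceDistSq γ r s).toReal := by
  have hlt : ∀ a b : ℝ, IsH10 Ω (v a) (fun j x => γ j (a, x)) →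
      IsH10 Ω (v b) (fun j x => γ j (b, x)) → sliceDistSq γ a b =
        ENNReal.ofReal (∑ j : Fin d, ∫ x, ‖γ j (a, x) - γ j (b, x)‖ ^ 2) := fun a b ha hb => by
    rw [ENNReal.ofReal_sum_of_nonneg fun j _ => integral_nonneg fun x => by positivity]
    refine Finset.sum_congr rfl fun j _ => ?_
    have hi : Integrable (fun x => ‖γ j (a, x) - γ j (b, x)‖ ^ 2) volume :=
      ((ha.grad_memLp j).sub (hb.grad_memLp j)).integrable_norm_pow two_ne_zero
    rw [ofReal_integral_eq_lintegral_ofReal hi (ae_of_all _ fun x => by positivity)]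
    refine lintegral_congr fun x => ?_
    rw [← ofReal_norm, ENNReal.ofReal_pow (norm_nonneg _)]
  have h0 : ∀ a b : ℝ, 0 ≤ ∑ j : Fin d, ∫ x, ‖γ j (a, x) - γ j (b, x)‖ ^ 2 := fun a b =>
    Finset.sum_nonneg fun j _ => integral_nonneg fun x => by positivity
  rw [hlt t s ht hs, hlt r s hr hs, ENNReal.toReal_add (by finiteness) (by finiteness),
    ENNReal.toReal_mul, ENNReal.toReal_mul, ENNReal.toReal_ofReal (h0 t s),
    ENNReal.toReal_ofReal (h0 r s), ((hr.add ht).sub (hs.add hs)).gradNormSq_eq hΩ hΩb,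
    ENNReal.toReal_ofNat, Finset.mul_sum, Finset.mul_sum, ← Finset.sum_add_distrib]
  refine Finset.sum_le_sum fun j _ => ?_
  have h1 : Integrable (fun x => ‖γ j (t, x) - γ j (s, x)‖ ^ 2) volume :=
    ((ht.grad_memLp j).sub (hs.grad_memLp j)).integrable_norm_pow two_ne_zero
  have h2 : Integrable (fun x => ‖γ j (r, x) - γ j (s, x)‖ ^ 2) volume :=
    ((hr.grad_memLp j).sub (hs.grad_memLp j)).integrable_norm_pow two_ne_zero
  have h3 := (((hr.add ht).sub (hs.add hs)).grad_memLp j).integrable_norm_pow two_ne_zero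
  rw [← integral_const_mul, ← integral_const_mul,
    ← integral_add (h1.const_mul 2) (h2.const_mul 2)]
  refine integral_mono h3 ((h1.const_mul 2).add (h2.const_mul 2)) fun x => ?_
  simp only [Pi.add_apply, Pi.sub_apply]
  have e : γ j (r, x) + γ j (t, x) - (γ j (s, x) + γ j (s, x))
      = (γ j (t, x) - γ j (s, x)) + (γ j (r, x) - γ j (s, x)) := by abel
  rw [e]
  have h4 := norm_add_le (γ j (t, x) - γ j (s, x)) (γ j (r, x) - γ j (s, x))
  have h5 : ‖γ j (t, x) - γ j (s, x) + (γ j (r, x) - γ j (s, x))‖ ^ 2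
      ≤ (‖γ j (t, x) - γ j (s, x)‖ + ‖γ j (r, x) - γ j (s, x)‖) ^ 2 := by gcongr
  nlinarith [sq_nonneg (‖γ j (t, x) - γ j (s, x)‖ - ‖γ j (r, x) - γ j (s, x)‖)]

lemma fracConst_nonneg (d : ℕ) {α : ℝ} (hα : α ∈ Ioo (0 : ℝ) 1) : 0 ≤ fracConst d α := by
  have h1 : 0 < Real.Gamma (((d : ℝ) + 2) / 2) := Real.Gamma_pos_of_pos (by positivity)
  have h2 : 0 < Real.Gamma (1 / 2) := Real.Gamma_pos_of_pos (by norm_num)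
  have h3 : 0 < Real.Gamma (1 - α) := Real.Gamma_pos_of_pos (by linarith [hα.2])
  have := hα.1
  rw [fracConst]
  positivity

/-! ### Comparison of two solutions -/

/-- The energy inequality for the difference of a solution of the full model and a solution of the
truncated problem, provided that the rate of change of the energy at a fixed time is at most `Ψ`.
The increments of the energy between `t` and `r` are tested with the fixed field `e(r) + e(t)`. -/
lemma normSq_sub_le_integral (hd : d = 2 ∨ d = 3) {Ω : Set (Space d)} (hΩ : IsOpen Ω)
    (hΩb : Bornology.IsBounded Ω) {α : ℝ} (hα : α ∈ Ioo (0 : ℝ) 1) {ν γ T lam : ℝ} (hT : 0 < T)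
    (hlam : 0 < lam) {f : ℝ → Space d → Space d} {u₀ : Space d → Space d}
    {u ul : ℝ → Space d → Space d} {p pl : ℝ → Space d → ℝ}
    (hu : IsModelSolution Ω α ν γ T f u₀ u p) (hul : IsTruncatedSolution Ω α ν γ T lam f u₀ ul pl)
    {w : ℝ × Space d → Space d} {G : Fin d → ℝ × Space d → Space d}
    (hrep : IsJointRep Ω T (fun t => u t - ul t) w G)
    {Ψ : ℝ → ℝ} (hΨ : IntegrableOn Ψ (Ioo 0 T)) (hrate : ∀ᵐ s ∂(timeMeasure T),
      2 * (spatialForm Ω ν (fun v w => γ * (fracConst d α / 2) * truncForm Ω α lam v w) (ul s)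
          (pl s) (u s - ul s)
        - spatialForm Ω ν (fun v w => γ * (fracConst d α / 2) * fullForm α v w) (u s) (p s)
          (u s - ul s)) ≤ Ψ s) {τ : ℝ} (hτ : τ ∈ Icc 0 T) :
    normSq Ω (u τ - ul τ) ≤ ∫ s in (0 : ℝ)..τ, Ψ s := by
  have hd0 : 0 < d := by omega
  have hRo := isOpen_union_interactionDomain hΩ hlam
  have hRc := closure_subset_union_interactionDomain hΩ hlam
  have hX1 : ∀ {v : Space d → Space d}, v ∈ velocitySpace Ω univ α ↔ ∃ g, IsH10 Ω v g :=
    mem_velocitySpace_iff hd0 hα hΩb isOpen_univ (subset_univ _)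
  have hX2 : ∀ {v : Space d → Space d},
      v ∈ velocitySpace Ω (Ω ∪ interactionDomain Ω lam) α ↔ ∃ g, IsH10 Ω v g :=
    mem_velocitySpace_iff hd0 hα hΩb hRo hRc
  obtain ⟨D, hD, hDm⟩ := hu.momentum
  obtain ⟨Dl, hDl, hDlm⟩ := hul.momentum
  obtain ⟨κ, hκ, hDb⟩ := hD.dual_bound
  obtain ⟨κl, hκl, hDlb⟩ := hDl.dual_bound
  set c := γ * (fracConst d α / 2)
  -- the times at which the error is an admissible test function
  set P : ℝ → Prop := fun t =>
    IsH10 Ω (u t - ul t) (fun j x => G j (t, x)) ∧ IsDivFree Ω (u t - ul t) with hP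
  have hreg : ∀ᵐ s ∂(timeMeasure T), (∃ g, IsH10 Ω (u s) g) ∧ (∃ g, IsH10 Ω (ul s) g) ∧ P s := by
    filter_upwards [hu.memL2X.mem, hul.memL2X.mem, hrep.isH10, hu.incompressible,
      hul.incompressible] with s h1 h2 h3 h4 h5
    obtain ⟨g, hg⟩ := hX1.1 h1
    obtain ⟨l, hl⟩ := hX2.1 h2
    refine ⟨⟨g, hg⟩, ⟨l, hl⟩, h3, IsDivFree.sub hΩ hg hl (fun q hq => ?_) (fun q hq => ?_)⟩
    · simpa only [mul_comm] using h4 q hq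
    · simpa only [mul_comm] using h5 q hq
  have h0 : normSq Ω (u 0 - ul 0) = 0 := by
    rw [normSq, ← integral_zero (Space d) ℝ (μ := volume.restrict Ω)]
    refine integral_congr_ae ?_
    filter_upwards [hu.initial, hul.initial] with x h1 h2
    simp [h1, h2]
  have hinc : ∀ t ∈ Ioo 0 T, ∀ r ∈ Ioo 0 T, t < r → P t → P r → ∃ F : ℝ → ℝ,
      IntegrableOn F (Ioc t r) ∧
      normSq Ω (u r - ul r) - normSq Ω (u t - ul t) = ∫ s in Ioc t r, F s ∧
      ∀ᵐ s ∂(volume.restrict (Ioc t r)), F s ≤ Ψ s + (|κ s| + |κl s|)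
        * Real.sqrt (2 * sliceDistSq G t s + 2 * sliceDistSq G r s).toReal := by
    intro t ht r hr htr hPt hPr
    have ht' : t ∈ Icc 0 T := ⟨ht.1.le, ht.2.le⟩
    have hr' : r ∈ Icc 0 T := ⟨hr.1.le, hr.2.le⟩
    obtain ⟨φ, hφ⟩ : ∃ φ, φ = (u r - ul r) + (u t - ul t) := ⟨_, rfl⟩
    have hφH := hPr.1.add hPt.1
    have hφdiv := hPr.2.add hΩ hPr.1 hPt.1 hPt.2
    rw [← hφ] at hφH hφdiv
    obtain ⟨hi1, he1⟩ := hD.integrableOn_and_integral_eq (hX1.2 ⟨_, hφH⟩) ht hr htr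
    obtain ⟨hi2, he2⟩ := hDl.integrableOn_and_integral_eq (hX2.2 ⟨_, hφH⟩) ht hr htr
    refine ⟨fun s => D s φ - Dl s φ, hi1.sub hi2, ?_, ?_⟩
    · rw [integral_sub hi1 hi2, ← he1, ← he2, normSq_sub_normSq
        ((hu.memCL2.1 r hr').sub (hul.memCL2.1 r hr'))
        ((hu.memCL2.1 t ht').sub (hul.memCL2.1 t ht')), ← hφ]
      have hφ2 := hφH.memLp.restrict Ω
      have j1 := integrable_inner_of_memLp (hu.memCL2.1 r hr') hφ2
      have j2 := integrable_inner_of_memLp (hu.memCL2.1 t ht') hφ2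
      have j3 := integrable_inner_of_memLp (hul.memCL2.1 r hr') hφ2
      have j4 := integrable_inner_of_memLp (hul.memCL2.1 t ht') hφ2
      rw [← integral_sub j1 j2, ← integral_sub j3 j4]
      refine (integral_congr_ae (ae_of_all _ fun x => ?_)).trans
        (integral_sub (j1.sub j2) (j3.sub j4))
      simp only [Pi.sub_apply, inner_sub_left]
      ring
    · have hsub : Ioc t r ⊆ Ioo 0 T := fun s hs => ⟨ht.1.trans hs.1, hs.2.trans_lt hr.2⟩
      refine ae_restrict_of_ae_restrict_of_subset hsub ?_
      filter_upwards [hreg, hrate, hDm, hDlm, hDb, hDlb, hu.pressure, hul.pressure]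
        with s hs hsrate hsm hslm hsb hslb hsp hspl
      obtain ⟨⟨g, hg⟩, ⟨l, hl⟩, hPs⟩ := hs
      -- split the test function into twice the error and a small remainder
      obtain ⟨e, he⟩ : ∃ e, e = u s - ul s := ⟨_, rfl⟩
      have heH := hPs.1
      have hediv := hPs.2
      have hgrad := gradNormSq_le_sliceDistSq (v := fun t => u t - ul t) hΩ hΩb hPt.1 hPr.1 hPs.1
      simp only [← hφ] at hgrad
      rw [← he] at heH hediv hsrate hgrad
      obtain ⟨ρ, hρ⟩ : ∃ ρ, ρ = φ - (e + e) := ⟨_, rfl⟩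
      have hρH := hφH.sub (heH.add heH)
      have hρdiv := hφdiv.sub hΩ hφH (heH.add heH) (hediv.add hΩ heH heH hediv)
      rw [← hρ] at hρH hρdiv hgrad
      have hsplit : φ = (e + e) + ρ := by rw [hρ]; abel
      have hm1 : ∀ v, (∃ g, IsH10 Ω v g) → D s v - Dl s v
          = spatialForm Ω ν (fun v w => c * truncForm Ω α lam v w) (ul s) (pl s) v
            - spatialForm Ω ν (fun v w => c * fullForm α v w) (u s) (p s) v := fun v hv => by
        have a1 := hsm v (hX1.2 hv)
        have a2 := hslm v (hX2.2 hv)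
        simp only [spatialForm]
        linarith
      have hfull : ∀ {v w : Space d → Space d} {k k' : Fin d → Space d → Space d},
          IsH10 Ω v k → IsH10 Ω w k' →
          spatialForm Ω ν (fun v w => c * fullForm α v w) (u s) (p s) (v + w)
            = spatialForm Ω ν (fun v w => c * fullForm α v w) (u s) (p s) v
              + spatialForm Ω ν (fun v w => c * fullForm α v w) (u s) (p s) w :=
        fun hv hw => spatialForm_add_right hd hΩ hΩb hg hv hw hsp (by
          rw [fullForm_add_right (hg.memHFrac hd0 hα) (hv.memHFrac hd0 hα) (hw.memHFrac hd0 hα),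
            mul_add])
      have htrunc : ∀ {v w : Space d → Space d} {k k' : Fin d → Space d → Space d},
          IsH10 Ω v k → IsH10 Ω w k' →
          spatialForm Ω ν (fun v w => c * truncForm Ω α lam v w) (ul s) (pl s) (v + w)
            = spatialForm Ω ν (fun v w => c * truncForm Ω α lam v w) (ul s) (pl s) v
              + spatialForm Ω ν (fun v w => c * truncForm Ω α lam v w) (ul s) (pl s) w :=
        fun hv hw => spatialForm_add_right hd hΩ hΩb hl hv hw hspl (by
          rw [truncForm_add_right hΩ hlam (hl.memHFrac hd0 hα) (hv.memHFrac hd0 hα)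
            (hw.memHFrac hd0 hα), mul_add])
      have hφD := hm1 φ ⟨_, hφH⟩
      have hρD := hm1 ρ ⟨_, hρH⟩
      have hexp : D s φ - Dl s φ
          = 2 * (spatialForm Ω ν (fun v w => c * truncForm Ω α lam v w) (ul s) (pl s) e
            - spatialForm Ω ν (fun v w => c * fullForm α v w) (u s) (p s) e)
            + (D s ρ - Dl s ρ) := by
        rw [hφD, hρD, hsplit, hfull (heH.add heH) hρH, hfull heH heH,
          htrunc (heH.add heH) hρH, htrunc heH heH]
        ring
      have b1 := hsb ρ ((mem_solenoidalSpace_iff hd0 hα hΩb isOpen_univ (subset_univ _)).2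
        ⟨⟨_, hρH⟩, hρdiv⟩)
      have b2 := hslb ρ ((mem_solenoidalSpace_iff hd0 hα hΩb hRo hRc).2 ⟨⟨_, hρH⟩, hρdiv⟩)
      have hsq := Real.sqrt_le_sqrt hgrad
      have hsq0 := Real.sqrt_nonneg (gradNormSq Ω ρ)
      have b3 : κ s * Real.sqrt (gradNormSq Ω ρ) ≤ |κ s| * Real.sqrt
          (2 * sliceDistSq G t s + 2 * sliceDistSq G r s).toReal :=
        mul_le_mul (le_abs_self _) hsq hsq0 (abs_nonneg _)
      have b4 : κl s * Real.sqrt (gradNormSq Ω ρ) ≤ |κl s| * Real.sqrt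
          (2 * sliceDistSq G t s + 2 * sliceDistSq G r s).toReal :=
        mul_le_mul (le_abs_self _) hsq hsq0 (abs_nonneg _)
      have b5 := le_of_abs_le b1
      have b6 := neg_le_of_abs_le b2
      rw [hexp, add_mul]
      linarith
  have hκ' : MemLp (fun s => |κ s| + |κl s|) 2 (timeMeasure T) := hκ.abs.add hκl.abs
  have hmain := energy_le_of_increments hT (E := fun t => normSq Ω (u t - ul t))
    (hu.memCL2.sub hul.memCL2).continuousOn_normSq hΨ hκ' hrep.grad_stronglyMeasurable
    hrep.grad_memLp (hreg.mono fun s hs => hs.2.2) hinc hτ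
  simp only [h0, zero_add] at hmain
  exact hmain

/-- The error is bounded by the size `λ^(-4α)` of the squared tail of the kernel. -/
theorem exists_errorEnergy_le (hd : d = 2 ∨ d = 3) {Ω : Set (Space d)} (hΩ : IsOpen Ω)
    (hΩb : Bornology.IsBounded Ω) {α : ℝ} (hα : α ∈ Ioo (0 : ℝ) 1) {ν γ T : ℝ} (hν : 0 < ν)
    (hγ : 0 ≤ γ) (hT : 0 < T) {f : ℝ → Space d → Space d} {u₀ : Space d → Space d}
    {u : ℝ → Space d → Space d} {p : ℝ → Space d → ℝ}
    (hu : IsModelSolution Ω α ν γ T f u₀ u p) (hreg : EssBoundedH1 Ω T u) :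
    ∃ C : ℝ, 0 < C ∧ ∀ lam : ℝ, 0 < lam → ∀ (ul : ℝ → Space d → Space d)
      (pl : ℝ → Space d → ℝ), IsTruncatedSolution Ω α ν γ T lam f u₀ ul pl →
        IntegrableOn (fun s => gradNormSq Ω (u s - ul s)) (Ioo 0 T) ∧
        IntegrableOn (fun s => truncGagliardoSq Ω α lam (u s - ul s)) (Ioo 0 T) ∧
        ∀ t ∈ Icc 0 T, errorEnergy Ω α ν γ lam (fun s => u s - ul s) t
          ≤ C * (1 / lam ^ (2 * α)) ^ 2 := by
  have hd0 : 0 < d := by omega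
  obtain ⟨M, hM⟩ := hreg
  have hc : 0 ≤ γ * (fracConst d α / 2) := by
    have := fracConst_nonneg d hα
    positivity
  obtain ⟨K₀, hK₀, hrate⟩ := exists_energy_rate_le hd hΩ hΩb hα hν hc M
  -- Gronwall's inequality is applied with a rate at least one
  obtain ⟨K, hK⟩ : ∃ K, K = K₀ + 1 := ⟨_, rfl⟩
  have hK1 : 1 ≤ K := by linarith
  refine ⟨K * (K * T * Real.exp (K * T)) + K * T, by positivity, fun lam hlam ul pl hul => ?_⟩
  obtain ⟨w₁, G₁, h1⟩ := hu.memL2X.exists_isJointRep hΩb isOpen_univ (subset_univ _)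
  obtain ⟨w₂, G₂, h2⟩ := hul.memL2X.exists_isJointRep hΩb
    (isOpen_union_interactionDomain hΩ hlam) (closure_subset_union_interactionDomain hΩ hlam)
  have hrep := h1.sub h2
  have hgi := hrep.integrableOn_gradNormSq hΩ hΩb
  have hti := hrep.integrableOn_truncGagliardoSq hd0 hα hΩ hlam
  have hNc := (hu.memCL2.sub hul.memCL2).continuousOn_normSq
  refine ⟨hgi, hti, ?_⟩
  have hNi : IntegrableOn (fun s => normSq Ω (u s - ul s)) (Ioo 0 T) :=
    hNc.integrableOn_Icc.mono_set Ioo_subset_Icc_self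
  set c := γ * (fracConst d α / 2) with hcdef
  obtain ⟨Λ, hΛ⟩ : ∃ Λ, Λ = (1 / lam ^ (2 * α)) ^ 2 := ⟨_, rfl⟩
  rw [← hΛ]
  have hΛ0 : 0 ≤ Λ := by rw [hΛ]; positivity
  have hii : ∀ {F : ℝ → ℝ}, IntegrableOn F (Ioo 0 T) → ∀ τ ∈ Icc 0 T,
      IntervalIntegrable F volume 0 τ := fun hF τ hτ => by
    rw [intervalIntegrable_iff_integrableOn_Ioo_of_le hτ.1]
    exact hF.mono_set (Ioo_subset_Ioo_right hτ.2)
  have hconst : IntegrableOn (fun _ : ℝ => Λ) (Ioo 0 T) := integrableOn_const (by simp)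
  have hΨ : IntegrableOn (fun s => -(ν * gradNormSq Ω (u s - ul s))
      - 2 * c * truncGagliardoSq Ω α lam (u s - ul s) + K * (normSq Ω (u s - ul s) + Λ))
      (Ioo 0 T) :=
    ((hgi.const_mul ν).neg.sub (hti.const_mul (2 * c))).add ((hNi.add hconst).const_mul K)
  have henergy : ∀ τ ∈ Icc 0 T, normSq Ω (u τ - ul τ)
      + ν * (∫ s in (0 : ℝ)..τ, gradNormSq Ω (u s - ul s))
      + 2 * c * (∫ s in (0 : ℝ)..τ, truncGagliardoSq Ω α lam (u s - ul s))
      ≤ K * (∫ s in (0 : ℝ)..τ, normSq Ω (u s - ul s)) + K * T * Λ := fun τ hτ => by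
    have h := normSq_sub_le_integral hd hΩ hΩb hα hT hlam hu hul hrep hΨ (by
      filter_upwards [hM, h1.isH10, h2.isH10, hu.incompressible, hul.incompressible,
        hu.pressure, hul.pressure] with s a1 a2 a3 a4 a5 a6 a7
      have := hrate lam hlam (u s) (ul s) _ _ (p s) (pl s) a2 a3
        (fun q hq => by simpa only [mul_comm] using a4 q hq)
        (fun q hq => by simpa only [mul_comm] using a5 q hq) a6 a7 a1
      have hN0 := normSq_nonneg Ω (u s - ul s)
      rw [← hΛ] at this
      refine this.trans ?_
      have hKle : K₀ ≤ K := by linarith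
      gcongr) hτ
    have i1 : IntervalIntegrable (fun s => -(ν * gradNormSq Ω (u s - ul s))) volume 0 τ :=
      ((hii hgi τ hτ).const_mul ν).neg
    have i2 : IntervalIntegrable (fun s => 2 * c * truncGagliardoSq Ω α lam (u s - ul s))
      volume 0 τ := (hii hti τ hτ).const_mul (2 * c)
    have i3 : IntervalIntegrable (fun s => normSq Ω (u s - ul s) + Λ) volume 0 τ :=
      (hii hNi τ hτ).add (hii hconst τ hτ)
    rw [intervalIntegral.integral_add (i1.sub i2) (i3.const_mul K),
      intervalIntegral.integral_sub i1 i2, intervalIntegral.integral_neg,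
      intervalIntegral.integral_const_mul, intervalIntegral.integral_const_mul,
      intervalIntegral.integral_const_mul,
      intervalIntegral.integral_add (hii hNi τ hτ) (hii hconst τ hτ),
      intervalIntegral.integral_const, sub_zero, smul_eq_mul, mul_add] at h
    have hτT : K * (τ * Λ) ≤ K * T * Λ := by
      rw [← mul_assoc]
      gcongr
      exact hτ.2
    linarith
  have hpos : ∀ τ ∈ Icc 0 T, 0 ≤ (∫ s in (0 : ℝ)..τ, gradNormSq Ω (u s - ul s)) ∧
      0 ≤ ∫ s in (0 : ℝ)..τ, truncGagliardoSq Ω α lam (u s - ul s) := fun τ hτ =>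
    ⟨intervalIntegral.integral_nonneg hτ.1 fun s _ => gradNormSq_nonneg _ _,
      intervalIntegral.integral_nonneg hτ.1 fun s _ => truncGagliardoSq_nonneg _ _ _ _⟩
  have hgron := integral_le_of_le_integral_add hT.le hNc hK1 (B := K * T * Λ) (by positivity)
    fun τ hτ => by
      have a1 := henergy τ hτ
      have a2 := mul_nonneg hν.le (hpos τ hτ).1
      have a3 := mul_nonneg (mul_nonneg zero_le_two hc) (hpos τ hτ).2
      linarith
  intro τ hτ
  have a1 := henergy τ hτ
  have a2 := mul_nonneg hν.le (hpos τ hτ).1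
  have a3 := mul_nonneg hc (hpos τ hτ).2
  have a4 := mul_le_mul_of_nonneg_left (hgron τ hτ) (by linarith : 0 ≤ K)
  simp only [errorEnergy]
  rw [intervalIntegral.integral_const_mul, intervalIntegral.integral_const_mul, ← hcdef]
  have a5 : (K * (K * T * Real.exp (K * T)) + K * T) * Λ
      = K * (K * T * Λ * Real.exp (K * T)) + K * T * Λ := by ring
  rw [a5]
  linarith

end FracNS

end

theorem mainTheorem3 (d : ℕ) (hd : d = 2 ∨ d = 3)
    (Ω : Set (FracNS.Space d)) (hΩo : IsOpen Ω) (hΩb : Bornology.IsBounded Ω)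
    (α : ℝ) (hα : α ∈ Set.Ioo (0 : ℝ) 1)
    (ν : ℝ) (hν : 0 < ν) (γ : ℝ) (hγ : 0 ≤ γ) (T : ℝ) (hT : 0 < T)
    (f : ℝ → FracNS.Space d → FracNS.Space d)
    (hf : MemLp (fun z : ℝ × FracNS.Space d => f z.1 z.2) 2
      ((FracNS.timeMeasure T).prod (volume.restrict Ω)))
    (u₀ : FracNS.Space d → FracNS.Space d)
    (u : ℝ → FracNS.Space d → FracNS.Space d) (p : ℝ → FracNS.Space d → ℝ)
    (hu : FracNS.IsModelSolution Ω α ν γ T f u₀ u p)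
    (hreg : FracNS.EssBoundedH1 Ω T u) :
    ∃ C : ℝ, 0 < C ∧ ∀ lam : ℝ, 0 < lam →
      ∀ (ul : ℝ → FracNS.Space d → FracNS.Space d) (pl : ℝ → FracNS.Space d → ℝ),
      FracNS.IsTruncatedSolution Ω α ν γ T lam f u₀ ul pl →
        IntegrableOn (fun s => FracNS.gradNormSq Ω (u s - ul s)) (Set.Ioo 0 T) ∧
        IntegrableOn (fun s => FracNS.truncGagliardoSq Ω α lam (u s - ul s)) (Set.Ioo 0 T) ∧
        ∀ t ∈ Set.Icc 0 T,
          FracNS.errorEnergy Ω α ν γ lam (fun s => u s - ul s) t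
              ≤ C * ((1 / lam ^ (2 * α)) ^ 2
                  + ((lam + FracNS.domainRadius Ω) ^ d / lam ^ ((d : ℝ) + 2 * α)) ^ 2
                  + (1 / lam ^ ((d : ℝ) + 2 * α)) ^ 2) ∧
          (1 ≤ lam →
            FracNS.errorEnergy Ω α ν γ lam (fun s => u s - ul s) t
              ≤ C * (1 / lam ^ (2 * α)) ^ 2) := by
  obtain ⟨C, hC, h⟩ := FracNS.exists_errorEnergy_le hd hΩo hΩb hα hν hγ hT hu hreg
  refine ⟨C, hC, fun lam hlam ul pl hul => ?_⟩
  obtain ⟨h1, h2, h3⟩ := h lam hlam ul pl hul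
  refine ⟨h1, h2, fun t ht => ⟨(h3 t ht).trans ?_, fun _ => h3 t ht⟩⟩
  refine mul_le_mul_of_nonneg_left ?_ hC.le
  rw [add_assoc]
  exact le_add_of_nonneg_right (by positivity)
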